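/- All varieties are projective varieties over subfields $k\subset\mathbb C$, identified with their sets of complex points together with their $k$-structure. Let $E\subset\mathbb P^3$ be the curve over $\mathbb Q$ given by $a^2=c^2+d^2,\ b^2=c^2-d^2$, with the involutions $\tau(a,b,c,d)=(a,-b,c,d)$ and $\rho(a,b,c,d)=(a,b,-c,-d)$, let $H$ be the group generated by $\tau$ and $\rho$, acting diagonally on $E\times E$, and let $P_0=[\sqrt2,0,1,1]\in E$. Let $\mathcal B\subset\mathbb P^6$ be the box variety $$W_1^2+W_2^2=Z_3^2,\quad W_1^2+W_3^2=Z_2^2,\quad W_2^2+W_3^2=Z_1^2,\quad W_1^2+W_2^2+W_3^2=C^2,$$ with the involution $\sigma:Z_3\mapsto -Z_3$. Quotients by finite groups are geometric quotients. Then the following hold. 1. $E$ is isomorphic over $\mathbb Q$ to the elliptic curve $y^2=x^3-x$ (in its projective form), and $H\cong(\mathbb Z/2)^2$. 2. The quotient $\mathcal B/\sigma$ over $\mathbb Q$ is the surface in $\mathbb P^5$ with equations $W_1^2+W_3^2=Z_2^2,\ W_2^2+W_3^2=Z_1^2,\ W_1^2+W_2^2+W_3^2=C^2$, the quotient map being the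 projection that forgets $Z_3$. 3. The quotient $(E\times E)/H$ exists as a projective variety over $\mathbb Q$, and there is an isomorphism $\varphi:(E\times E)/H\to\mathcal B/\sigma$ defined over $\mathbb Q(i)$. 4. Over $\mathbb Q(\zeta_8)$ the isomorphism $\varphi$ realizes $\mathcal B/\sigma$ as a Kummer variety: the quotient $X=(E\times E)/\rho$ (with $\rho$ acting diagonally) exists as a projective variety over $\mathbb Q$; over $\mathbb Q(\zeta_8)$ it carries the structure of an abelian variety whose origin is the image of $(P_0,P_0)$ and whose negation is induced by the diagonal action of $\tau$; and the map $X\to\mathcal B/\sigma$ induced by $E\times E\to(E\times E)/H\xrightarrow{\ \varphi\ }\mathcal B/\sigma$ is the quotient of $X$ by $\{\pm1\}$ over $\mathbb Q(\zeta_8)$. -/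

import Mathlib

/-! Projective varieties are treated classically: a variety over a subfield `k` of `ℂ` is the set of
its complex points inside a product of complex projective spaces, together with the
`k`-structure given by multihomogeneous polynomials with coefficients in `k`. -/

noncomputable section

namespace BoxVariety

open MvPolynomial

/-! ### Multiprojective varieties over a subfield of the complex numbers -/

/-- The product over `i : ι` of the complex projective spaces of dimension `n i`
(`ι` is finite in all uses). -/
abbrev MultiProj {ι : Type} (n : ι → ℕ) : Type :=
  ∀ i, Projectivization ℂ (Fin (n i + 1) → ℂ)

/-- The homogeneous coordinates of all factors. -/
abbrev Coord {ι : Type} (n : ι → ℕ) : Type := Σ i, Fin (n i + 1)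

/-- A choice of homogeneous coordinates of a point. The notions below do not depend on it. -/
def homCoord {ι : Type} {n : ι → ℕ} (p : MultiProj n) : Coord n → ℂ :=
  fun c => (p c.1).rep c.2

/-- `F` is multihomogeneous: of degree `d i` in the coordinates of the `i`-th factor. -/
def IsMultiHom {ι : Type} {n : ι → ℕ} {k : IntermediateField ℚ ℂ}
    (F : MvPolynomial (Coord n) k) (d : ι → ℕ) : Prop :=
  ∀ e ∈ F.support, ∀ i, ∑ j, e ⟨i, j⟩ = d i

/-- The value of a polynomial over `k` at the chosen homogeneous coordinates of `p`. -/
def evalAt {ι : Type} {n : ι → ℕ} {k : IntermediateField ℚ ℂ}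
    (F : MvPolynomial (Coord n) k) (p : MultiProj n) : ℂ :=
  aeval (homCoord p) F

/-- `V` is an algebraic subset defined over `k`: the set of common zeros of some multihomogeneous
polynomials with coefficients in `k`. -/
def IsClosedOver (k : IntermediateField ℚ ℂ) {ι : Type} {n : ι → ℕ} (V : Set (MultiProj n)) :
    Prop :=
  ∃ S : Set (MvPolynomial (Coord n) k), (∀ F ∈ S, ∃ d, IsMultiHom F d) ∧
    V = {p | ∀ F ∈ S, evalAt F p = 0}

/-- `U` is open in the Zariski `k`-topology of `V`. -/
def IsOpenOver (k : IntermediateField ℚ ℂ) {ι : Type} {n : ι → ℕ} {V : Set (MultiProj n)}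
    (U : Set V) : Prop :=
  ∃ Z : Set (MultiProj n), IsClosedOver k Z ∧ U = {p : V | p.1 ∉ Z}

/-- `f : V → W` is a morphism defined over `k`: around every point, each component of `f` is given
by multihomogeneous polynomials over `k` of the same multidegree, without common zero at the point.
The proportionality of the polynomial vector to the component of `f` may be asked for on
all of `V` (and says nothing where the vector vanishes): a local representation acquires this
property when it is multiplied by a multihomogeneous polynomial that vanishes outside the
neighbourhood on which it is valid, but not at the given point. -/
def IsRegularMap (k : IntermediateField ℚ ℂ) {ι κ : Type} {n : ι → ℕ} {m : κ → ℕ}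
    {V : Set (MultiProj n)} {W : Set (MultiProj m)} (f : V → W) : Prop :=
  ∀ (p : V) (j : κ), ∃ (d : ι → ℕ) (F : Fin (m j + 1) → MvPolynomial (Coord n) k),
    (∀ l, IsMultiHom (F l) d) ∧ (∃ l, evalAt (F l) p.1 ≠ 0) ∧
    ∀ q : V, (fun l => evalAt (F l) q.1) ∈ ((f q).1 j).submodule

/-- `e` is an isomorphism of varieties defined over `k`. -/
def IsIsoOver (k : IntermediateField ℚ ℂ) {ι κ : Type} {n : ι → ℕ} {m : κ → ℕ}
    {V : Set (MultiProj n)} {W : Set (MultiProj m)} (e : V ≃ W) : Prop :=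
  IsRegularMap k e ∧ IsRegularMap k e.symm

/-- The restriction of `g` to `U` is a regular function defined over `k`: around every point of `U`
it is a quotient of two multihomogeneous polynomials over `k` of the same multidegree. (As above,
the quotient representation may be assumed to hold wherever its denominator does not vanish.) -/
def IsRegularOn (k : IntermediateField ℚ ℂ) {ι : Type} {n : ι → ℕ} {V : Set (MultiProj n)}
    (U : Set V) (g : V → ℂ) : Prop :=
  ∀ p ∈ U, ∃ (d : ι → ℕ) (P Q : MvPolynomial (Coord n) k),
    IsMultiHom P d ∧ IsMultiHom Q d ∧ evalAt Q p.1 ≠ 0 ∧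
    ∀ q ∈ U, evalAt Q q.1 ≠ 0 → g q = evalAt P q.1 / evalAt Q q.1

/-- `π : V → Y` exhibits the projective variety `Y` as the quotient `V / G` over `k`, for a finite
group `G` of automorphisms of `V`: the group acts by `k`-morphisms, `π` is a surjective
`k`-morphism whose fibres are the `G`-orbits, `Y` has the quotient topology, and the regular
functions on `Y` are the `G`-invariant regular functions on `V`. -/
structure IsQuotientBy (k : IntermediateField ℚ ℂ) {ι κ : Type} {n : ι → ℕ} {m : κ → ℕ}
    {V : Set (MultiProj n)} {Y : Set (MultiProj m)} (G : Subgroup (Equiv.Perm V)) (π : V → Y) :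
    Prop where
  finite : Finite G
  action : ∀ g ∈ G, IsRegularMap k g
  source_closed : IsClosedOver k V
  target_closed : IsClosedOver k Y
  regular : IsRegularMap k π
  surjective : Function.Surjective π
  fibre : ∀ p q, π p = π q ↔ ∃ g ∈ G, g p = q
  topology : ∀ U : Set Y, IsOpenOver k U ↔ IsOpenOver k (π ⁻¹' U)
  functions : ∀ U : Set Y, IsOpenOver k U → ∀ g : Y → ℂ,
    IsRegularOn k U g ↔ IsRegularOn k (π ⁻¹' U) (g ∘ π)

/-! ### Products -/

/-- The product of two varieties, in the product of the ambient spaces. -/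
def prodVar {ι κ : Type} {n : ι → ℕ} {m : κ → ℕ} (V : Set (MultiProj n)) (W : Set (MultiProj m)) :
    Set (MultiProj (Sum.elim n m)) :=
  {p | (fun i => p (Sum.inl i) : MultiProj n) ∈ V ∧ (fun j => p (Sum.inr j) : MultiProj m) ∈ W}

/-- The points of the product are the pairs of points. -/
def prodVarEquiv {ι κ : Type} {n : ι → ℕ} {m : κ → ℕ} (V : Set (MultiProj n))
    (W : Set (MultiProj m)) : prodVar V W ≃ V × W where
  toFun p := (⟨_, p.2.1⟩, ⟨_, p.2.2⟩)
  invFun q := ⟨fun | Sum.inl i => q.1.1 i | Sum.inr j => q.2.1 j, q.1.2, q.2.2⟩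
  left_inv p := by
    apply Subtype.ext
    funext i
    cases i <;> rfl
  right_inv _ := rfl

/-- The diagonal action on `V × V` of a permutation of `V`. -/
def diagPerm {ι : Type} {n : ι → ℕ} {V : Set (MultiProj n)} (f : Equiv.Perm V) :
    Equiv.Perm (prodVar V V) :=
  (prodVarEquiv V V).trans ((f.prodCongr f).trans (prodVarEquiv V V).symm)

/-! ### Abelian varieties and Kummer varieties -/

/-- A point that is rational over `k`. -/
def IsRationalPoint (k : IntermediateField ℚ ℂ) {ι : Type} {n : ι → ℕ} (p : MultiProj n) : Prop :=
  ∀ i, ∃ v : Fin (n i + 1) → k, v ≠ 0 ∧ (fun l => (v l : ℂ)) ∈ (p i).submodule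

/-- `A` is irreducible as a complex variety. -/
def IsGeomIrreducible {ι : Type} {n : ι → ℕ} (A : Set (MultiProj n)) : Prop :=
  A.Nonempty ∧ ∀ Z₁ Z₂ : Set (MultiProj n), IsClosedOver ⊤ Z₁ → IsClosedOver ⊤ Z₂ →
    A ⊆ Z₁ ∪ Z₂ → A ⊆ Z₁ ∨ A ⊆ Z₂

/-- `A`, with the given group structure, is an abelian variety over `k`: an irreducible projective
variety with a `k`-rational origin and whose addition and negation are morphisms over `k`.
(Smoothness is automatic in characteristic zero.) -/
structure IsAbelianVariety (k : IntermediateField ℚ ℂ) {ι : Type} {n : ι → ℕ}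
    (A : Set (MultiProj n)) [AddCommGroup A] : Prop where
  closed : IsClosedOver k A
  irreducible : IsGeomIrreducible A
  zero_rational : IsRationalPoint k (0 : A).1
  add_regular : IsRegularMap k
    (fun p : prodVar A A => (prodVarEquiv A A p).1 + (prodVarEquiv A A p).2)
  neg_regular : IsRegularMap k (fun p : A => -p)

/-- `κ : A → Y` exhibits `Y` as the Kummer variety `A / {±1}` of the abelian variety `A` over `k`. -/
def IsKummerVarietyOf (k : IntermediateField ℚ ℂ) {ι κ : Type} {n : ι → ℕ} {m : κ → ℕ}
    (A : Set (MultiProj n)) [AddCommGroup A] (Y : Set (MultiProj m)) (f : A → Y) : Prop :=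
  IsAbelianVariety k A ∧ IsQuotientBy k (Subgroup.zpowers (Equiv.neg A)) f

/-! ### Sign changes of coordinates -/

/-- The linear map multiplying the `j`-th coordinate by the sign `ε j`. -/
def signLin {N : ℕ} (ε : Fin (N + 1) → ℤˣ) : (Fin (N + 1) → ℂ) →ₗ[ℂ] (Fin (N + 1) → ℂ) where
  toFun v j := ((ε j : ℤ) : ℂ) * v j
  map_add' v w := by
    funext j
    simp [mul_add]
  map_smul' c v := by
    funext j
    simp [mul_left_comm]

theorem sign_mul_self (e : ℤˣ) : ((e : ℤ) : ℂ) * ((e : ℤ) : ℂ) = 1 := by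
  rcases Int.units_eq_one_or e with h | h <;> simp [h]

theorem signLin_signLin {N : ℕ} (ε : Fin (N + 1) → ℤˣ) (v : Fin (N + 1) → ℂ) :
    signLin ε (signLin ε v) = v := by
  funext j
  change ((ε j : ℤ) : ℂ) * (((ε j : ℤ) : ℂ) * v j) = v j
  rw [← mul_assoc, sign_mul_self, one_mul]

theorem signLin_injective {N : ℕ} (ε : Fin (N + 1) → ℤˣ) : Function.Injective (signLin ε) :=
  Function.LeftInverse.injective (signLin_signLin ε)

/-- The space `ℙ^N`, as a multiprojective space with a single factor. -/
abbrev Proj (N : ℕ) : Type := MultiProj (fun _ : Unit => N)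

/-- Homogeneous coordinates of a point of `ℙ^N`. -/
def crd {N : ℕ} (p : Proj N) : Fin (N + 1) → ℂ := (p ()).rep

/-- The point of `ℙ^N` with given homogeneous coordinates. -/
def mkPt {N : ℕ} (v : Fin (N + 1) → ℂ) (hv : v ≠ 0) : Proj N := fun _ => Projectivization.mk ℂ v hv

/-- The automorphism of `ℙ^N` multiplying the `j`-th coordinate by the sign `ε j`. -/
def signPerm {N : ℕ} (ε : Fin (N + 1) → ℤˣ) : Equiv.Perm (Proj N) :=
  Function.Involutive.toPerm
    (fun p _ => Projectivization.map (signLin ε) (signLin_injective ε) (p ())) (by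
      intro p
      funext i
      change Projectivization.map (signLin ε) (signLin_injective ε)
        (Projectivization.map (signLin ε) (signLin_injective ε) (p i)) = p i
      induction p i using Projectivization.ind with
      | h v hv => simp only [Projectivization.map_mk, signLin_signLin])

theorem crd_ne_zero {N : ℕ} (p : Proj N) : crd p ≠ 0 := Projectivization.rep_nonzero _

theorem crd_mkPt {N : ℕ} (v : Fin (N + 1) → ℂ) (hv : v ≠ 0) :
    ∃ c : ℂ, c ≠ 0 ∧ ∀ j, crd (mkPt v hv) j = c * v j := by
  obtain ⟨a, ha⟩ := Projectivization.exists_smul_eq_mk_rep ℂ v hv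
  exact ⟨a, a.ne_zero, fun j => (congrFun ha j).symm⟩

theorem crd_signPerm {N : ℕ} (ε : Fin (N + 1) → ℤˣ) (p : Proj N) :
    ∃ c : ℂ, c ≠ 0 ∧ ∀ j, crd (signPerm ε p) j = c * (((ε j : ℤ) : ℂ) * crd p j) := by
  have h0 : signLin ε (crd p) ≠ 0 := fun h =>
    crd_ne_zero p (signLin_injective ε (h.trans (map_zero _).symm))
  have h : signPerm ε p = mkPt (signLin ε (crd p)) h0 := by
    funext i
    change Projectivization.map (signLin ε) (signLin_injective ε) (p i) = _
    conv_lhs => rw [← Projectivization.mk_rep (p i), Projectivization.map_mk]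
    rfl
  rw [h]
  exact crd_mkPt _ h0

theorem crd_signPerm_sq {N : ℕ} (ε : Fin (N + 1) → ℤˣ) (p : Proj N) :
    ∃ c : ℂ, ∀ j, crd (signPerm ε p) j ^ 2 = c * crd p j ^ 2 := by
  obtain ⟨c, -, h⟩ := crd_signPerm ε p
  refine ⟨c ^ 2, fun j => ?_⟩
  rw [h]
  linear_combination c ^ 2 * crd p j ^ 2 * sign_mul_self (ε j)

theorem signPerm_sq {N : ℕ} (ε : Fin (N + 1) → ℤˣ) (p : Proj N) :
    signPerm ε (signPerm ε p) = p := (signPerm ε).left_inv p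

/-! ### The elliptic curve and its involutions -/

/-- The curve `a² = c² + d²`, `b² = c² - d²` in `ℙ³`, with coordinates `(a, b, c, d)`. -/
def curveE : Set (Proj 3) :=
  {p | crd p 0 ^ 2 = crd p 2 ^ 2 + crd p 3 ^ 2 ∧ crd p 1 ^ 2 = crd p 2 ^ 2 - crd p 3 ^ 2}

theorem signPerm_mem_curveE {ε : Fin 4 → ℤˣ} {p : Proj 3} (hp : p ∈ curveE) :
    signPerm ε p ∈ curveE := by
  obtain ⟨c, h⟩ := crd_signPerm_sq ε p
  obtain ⟨h1, h2⟩ := hp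
  refine ⟨?_, ?_⟩
  · simp only [h]
    linear_combination c * h1
  · simp only [h]
    linear_combination c * h2

/-- The automorphism of the curve multiplying the coordinates by the given signs. -/
def curveSign (ε : Fin 4 → ℤˣ) : Equiv.Perm curveE :=
  (signPerm ε).subtypePerm fun p =>
    ⟨fun h => by simpa only [signPerm_sq] using signPerm_mem_curveE (ε := ε) h,
      signPerm_mem_curveE⟩

/-- The involution `τ (a, b, c, d) = (a, -b, c, d)`. -/
def tau : Equiv.Perm curveE := curveSign ![1, -1, 1, 1]

/-- The involution `ρ (a, b, c, d) = (a, b, -c, -d)`. -/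
def rho : Equiv.Perm curveE := curveSign ![1, 1, -1, -1]

/-- The surface `E × E`. -/
abbrev surfEE : Set (MultiProj (Sum.elim (fun _ : Unit => 3) (fun _ : Unit => 3))) :=
  prodVar curveE curveE

/-- The group generated by `τ` and `ρ`, acting diagonally on `E × E`. -/
def groupH : Subgroup (Equiv.Perm surfEE) := Subgroup.closure {diagPerm tau, diagPerm rho}

/-- The point `[√2, 0, 1, 1]` of the curve. -/
def basePt : curveE :=
  ⟨mkPt ![(Real.sqrt 2 : ℂ), 0, 1, 1] fun h => one_ne_zero (congrFun h 2), by
    obtain ⟨c, -, h⟩ := crd_mkPt (N := 3) ![(Real.sqrt 2 : ℂ), 0, 1, 1]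
      fun h => one_ne_zero (congrFun h 2)
    have h2 : (Real.sqrt 2 : ℂ) ^ 2 = 2 := by
      rw [← Complex.ofReal_pow, Real.sq_sqrt (by norm_num)]
      norm_num
    refine ⟨?_, ?_⟩
    · simp only [h]
      simp
      linear_combination c ^ 2 * h2
    · simp only [h]
      simp⟩

/-- The Weierstrass curve `y² = x³ - x` over `ℚ`. -/
def weierE : WeierstrassCurve ℚ := ⟨0, 0, 0, -1, 0⟩

/-- The complex points of the projective plane curve defined by a Weierstrass equation. -/
def weierSet (W : WeierstrassCurve ℚ) : Set (Proj 2) :=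
  {p | (W.baseChange ℂ).toProjective.Equation (crd p)}

/-! ### The box variety and its quotient -/

/-- The box variety in `ℙ⁶`, with coordinates `(Z₁, Z₂, Z₃, W₁, W₂, W₃, C)`. -/
def box : Set (Proj 6) :=
  {p | crd p 3 ^ 2 + crd p 4 ^ 2 = crd p 2 ^ 2 ∧ crd p 3 ^ 2 + crd p 5 ^ 2 = crd p 1 ^ 2 ∧
    crd p 4 ^ 2 + crd p 5 ^ 2 = crd p 0 ^ 2 ∧
    crd p 3 ^ 2 + crd p 4 ^ 2 + crd p 5 ^ 2 = crd p 6 ^ 2}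

theorem signPerm_mem_box {ε : Fin 7 → ℤˣ} {p : Proj 6} (hp : p ∈ box) : signPerm ε p ∈ box := by
  obtain ⟨c, h⟩ := crd_signPerm_sq ε p
  obtain ⟨h1, h2, h3, h4⟩ := hp
  refine ⟨?_, ?_, ?_, ?_⟩
  · simp only [h]
    linear_combination c * h1
  · simp only [h]
    linear_combination c * h2
  · simp only [h]
    linear_combination c * h3
  · simp only [h]
    linear_combination c * h4

/-- The involution `σ : Z₃ ↦ -Z₃` of the box variety. -/
def sigma : Equiv.Perm box :=
  (signPerm ![1, 1, -1, 1, 1, 1, 1]).subtypePerm fun p =>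
    ⟨fun h => by
      simpa only [signPerm_sq] using signPerm_mem_box (ε := ![1, 1, -1, 1, 1, 1, 1]) h,
      signPerm_mem_box⟩

/-- The surface in `ℙ⁵`, with coordinates `(Z₁, Z₂, W₁, W₂, W₃, C)`, given by the
equations of the box variety that do not involve `Z₃`. -/
def boxQuot : Set (Proj 5) :=
  {p | crd p 2 ^ 2 + crd p 4 ^ 2 = crd p 1 ^ 2 ∧ crd p 3 ^ 2 + crd p 4 ^ 2 = crd p 0 ^ 2 ∧
    crd p 2 ^ 2 + crd p 3 ^ 2 + crd p 4 ^ 2 = crd p 5 ^ 2}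

theorem forget_ne_zero {p : Proj 6} (hp : p ∈ box) :
    ![crd p 0, crd p 1, crd p 3, crd p 4, crd p 5, crd p 6] ≠ 0 := by
  intro h
  have h0 : crd p 0 = 0 := congrFun h 0
  have h1 : crd p 1 = 0 := congrFun h 1
  have h3 : crd p 3 = 0 := congrFun h 2
  have h4 : crd p 4 = 0 := congrFun h 3
  have h5 : crd p 5 = 0 := congrFun h 4
  have h6 : crd p 6 = 0 := congrFun h 5
  have h2 : crd p 2 = 0 := by
    have := hp.1
    rw [h3, h4] at this
    exact pow_eq_zero_iff (two_ne_zero) |>.1 (by rw [← this]; ring)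
  apply crd_ne_zero p
  funext j
  fin_cases j <;> assumption

/-- The projection of the box variety that forgets the coordinate `Z₃`. -/
def forgetZ3 (p : box) : boxQuot :=
  ⟨mkPt _ (forget_ne_zero p.2), by
    obtain ⟨c, -, h⟩ := crd_mkPt _ (forget_ne_zero p.2)
    obtain ⟨h1, h2, h3, h4⟩ := p.2
    refine ⟨?_, ?_, ?_⟩
    · simp only [h]
      change (c * crd p.1 3) ^ 2 + (c * crd p.1 5) ^ 2 = (c * crd p.1 1) ^ 2
      linear_combination c ^ 2 * h2
    · simp only [h]
      change (c * crd p.1 4) ^ 2 + (c * crd p.1 5) ^ 2 = (c * crd p.1 0) ^ 2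
      linear_combination c ^ 2 * h3
    · simp only [h]
      change (c * crd p.1 3) ^ 2 + (c * crd p.1 4) ^ 2 + (c * crd p.1 5) ^ 2 = (c * crd p.1 6) ^ 2
      linear_combination c ^ 2 * h4⟩

/-! ### Fields of definition -/

/-- The field of rational numbers. -/
abbrev fieldQ : IntermediateField ℚ ℂ := ⊥

/-- The field `ℚ(i)` of Gauss numbers. -/
def fieldQi : IntermediateField ℚ ℂ := IntermediateField.adjoin ℚ {Complex.I}

/-- The field `ℚ(ζ₈)` of eighth roots of unity. -/
def fieldQzeta8 : IntermediateField ℚ ℂ :=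
  IntermediateField.adjoin ℚ {Complex.exp (2 * Real.pi * Complex.I / 8)}

end BoxVariety

end

/-!
All groups in sight act by changing signs of homogeneous coordinates, up to an isomorphism of the
variety, and all maps are written down by forms with integral coefficients. This makes every
quotient explicit. A map given by forms `φ` is the quotient by a finite group of sign changes as
soon as its fibres are the orbits and every monomial invariant under the group is, after
multiplication by a factor that does not vanish near a given point, a polynomial in the forms `φ`
(`IsSignQuotient.isQuotientBy`). The point is that a fraction `P / Q` which is constant on orbits
can be rewritten with an invariant numerator and an invariant denominator: the relation it satisfies
splits into its even and its odd part for each sign change in turn (`exists_even`).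

*The two presentations of the box surface.* Forgetting `Z₃` is such a quotient map of the box
variety, since `Z₃²` is a form in the other coordinates. On `E × E`, with coordinates `a, b, c, d`
and `a', b', c', d'`, the forms
`Z₁, Z₂ = cc' ± dd'`, `W₂, W₁ = cd' ± dc'`, `W₃ = bb'`, `C = aa'`
satisfy the equations of `B/σ`, and they span the products `cc', dd', cd', dc', aa', bb'`, from
which all monomials invariant under `⟨τ, ρ⟩` can be recovered (Segre embedding). Therefore `B/σ` is
itself the quotient of `E × E` by `H` (`kumMap_isQuotientBy`), already over `ℚ`, and `φ` only
renumbers the factors of the ambient space.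

*The elliptic curve.* The isomorphism with `y² = x³ - x` and its inverse have two representations
by forms each, which together cover the curve. Irreducibility of `E`, and hence of `E × E` and of
its quotients, follows because polynomial functions on the affine curve have the form
`p(x) + q(x) y`, and `x³ - x` is not a square of a rational function. The group law of `E` with
origin `[1, 1, 1, 0]` is given by the addition formulas of the Jacobian elliptic functions
(`d, a, b, c` play the roles of `sn`, `dn`, `cn` and the common denominator), completed by a
second representation (`lawE`). Associativity is a polynomial identity
where the first representation is defined at all four sums. That set is dense, so the identity
extends (`curveAdd_assoc`).

*The abelian surface.* In this group law `ρ` is the translation by the point `[1, 1, -1, 0]` of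
order two (`rho_eq_add`), and `τ P = 2 P₀ - P` (`tau_eq_sub`). Since `ρ` is a translation, the shear
`(P, Q) ↦ (P, Q - P)` turns its diagonal action into its action on the first factor alone. So
`X = (E × E) / ρ` is the product of `E / ρ` and `E`, where `E / ρ` is the curve `splitE` in
`ℙ¹ × ℙ¹` of the pairs `([a, b], [c, d])`. It carries the group law for which the image of `P₀` is
the origin. The translation by `-P₀` exchanges the halves `(a, b)` and `(c, d)` up to a factor `√2`
and a sign. The `√2` disappears projectively, so that addition on `splitE` is given by forms with
rational coefficients (`splitLaw`). Products of abelian varieties are abelian varieties, the image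
of `(P₀, P₀)` is the origin, and `τ P = 2 P₀ - P` says that `τ` induces the negation. Finally
`E × E → B/σ` factors through `X`, and the second factor of a quotient map is the quotient by the
group induced on `X`, which is `{±1}` (`kummerMap_isQuotientBy`).
-/

noncomputable section

namespace BoxVariety

open MvPolynomial

/-! ### Multihomogeneous forms -/

section Forms

variable {ι κ : Type} {n : ι → ℕ} {m : κ → ℕ} {k : IntermediateField ℚ ℂ}

/-- The coordinate vector with the coordinates of the `i`-th factor multiplied by `c i`. -/
def rescale (c : ι → ℂ) (x : Coord n → ℂ) : Coord n → ℂ := fun a => c a.1 * x a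

theorem aeval_eq_sum [Fintype ι] (F : MvPolynomial (Coord n) k) (x : Coord n → ℂ) :
    aeval x F = ∑ e ∈ F.support, ((coeff e F : k) : ℂ) * ∏ a, x a ^ e a := by
  rw [aeval_def, eval₂_eq']
  rfl

theorem prod_rescale [Fintype ι] (c : ι → ℂ) (x : Coord n → ℂ) (e : Coord n →₀ ℕ) :
    ∏ a, rescale c x a ^ e a = (∏ i, c i ^ ∑ j, e ⟨i, j⟩) * ∏ a, x a ^ e a := by
  simp only [rescale, mul_pow, Finset.prod_mul_distrib]
  congr 1
  rw [Fintype.prod_sigma]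
  exact Finset.prod_congr rfl fun i _ => Finset.prod_pow_eq_pow_sum _ (fun j => e ⟨i, j⟩) (c i)

theorem IsMultiHom.aeval_rescale [Fintype ι] {F : MvPolynomial (Coord n) k} {d : ι → ℕ}
    (hF : IsMultiHom F d) (c : ι → ℂ) (x : Coord n → ℂ) :
    aeval (rescale c x) F = (∏ i, c i ^ d i) * aeval x F := by
  rw [aeval_eq_sum, aeval_eq_sum, Finset.mul_sum]
  refine Finset.sum_congr rfl fun e he => ?_
  rw [prod_rescale, Finset.prod_congr rfl fun i _ => by rw [hF e he i]]
  ring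

/-- Over an infinite field a polynomial is multihomogeneous as soon as its values scale as those
of a multihomogeneous polynomial. -/
theorem isMultiHom_of_aeval_rescale [Fintype ι] {F : MvPolynomial (Coord n) k} {d : ι → ℕ}
    (h : ∀ (c : ι → ℂ) (x : Coord n → ℂ),
      aeval (rescale c x) F = (∏ i, c i ^ d i) * aeval x F) : IsMultiHom F d := by
  classical
  intro e he i
  -- scale the `i`-th factor by `2` and compare coefficients
  set c : ι → ℂ := fun i' => if i' = i then 2 else 1 with hc
  have hpow : ∀ f : ι → ℕ, ∏ i', c i' ^ f i' = 2 ^ f i := fun f => by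
    rw [Finset.prod_eq_single i]
    · simp [hc]
    · intro b _ hb
      simp [hc, hb]
    · simp
  set G : MvPolynomial (Coord n) ℂ := ∑ e ∈ F.support,
    monomial e (((coeff e F : k) : ℂ) * ∏ i', c i' ^ ∑ j, e ⟨i', j⟩) with hG
  set K : MvPolynomial (Coord n) ℂ := ∑ e ∈ F.support,
    monomial e (((coeff e F : k) : ℂ) * ∏ i', c i' ^ d i') with hK
  have hGK : G = K := by
    refine MvPolynomial.funext fun x => ?_
    have h1 := h c x
    rw [aeval_eq_sum, aeval_eq_sum, Finset.mul_sum] at h1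
    simp only [hG, hK, map_sum, eval_monomial, Finsupp.prod_fintype, pow_zero, implies_true]
    refine Eq.trans ?_ (h1.trans ?_)
    · refine Finset.sum_congr rfl fun e _ => ?_
      rw [prod_rescale]
      ring
    · refine Finset.sum_congr rfl fun e _ => ?_
      ring
  have hcoeff := congrArg (coeff e) hGK
  simp only [hG, hK, coeff_sum, coeff_monomial, Finset.sum_ite_eq', he, if_true, hpow] at hcoeff
  have hne : ((coeff e F : k) : ℂ) ≠ 0 := by
    have := mem_support_iff.1 he
    exact_mod_cast this
  have h2 := mul_left_cancel₀ hne hcoeff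
  exact Nat.pow_right_injective le_rfl (by exact_mod_cast h2)

theorem IsMultiHom.mul [Fintype ι] {F G : MvPolynomial (Coord n) k} {d e : ι → ℕ}
    (hF : IsMultiHom F d) (hG : IsMultiHom G e) : IsMultiHom (F * G) (d + e) :=
  isMultiHom_of_aeval_rescale fun c x => by
    simp only [map_mul, hF.aeval_rescale, hG.aeval_rescale, Pi.add_apply, pow_add,
      Finset.prod_mul_distrib]
    ring

theorem IsMultiHom.add [Fintype ι] {F G : MvPolynomial (Coord n) k} {d : ι → ℕ}
    (hF : IsMultiHom F d) (hG : IsMultiHom G d) : IsMultiHom (F + G) d :=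
  isMultiHom_of_aeval_rescale fun c x => by
    simp only [map_add, hF.aeval_rescale, hG.aeval_rescale]
    ring

theorem IsMultiHom.sub [Fintype ι] {F G : MvPolynomial (Coord n) k} {d : ι → ℕ}
    (hF : IsMultiHom F d) (hG : IsMultiHom G d) : IsMultiHom (F - G) d :=
  isMultiHom_of_aeval_rescale fun c x => by
    simp only [map_sub, hF.aeval_rescale, hG.aeval_rescale]
    ring

theorem isMultiHom_C [Fintype ι] (a : k) : IsMultiHom (C a : MvPolynomial (Coord n) k) 0 :=
  isMultiHom_of_aeval_rescale fun c x => by simp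

theorem isMultiHom_one [Fintype ι] : IsMultiHom (1 : MvPolynomial (Coord n) k) 0 :=
  isMultiHom_C 1

theorem isMultiHom_X [Fintype ι] [DecidableEq ι] (a : Coord n) :
    IsMultiHom (X a : MvPolynomial (Coord n) k) (Pi.single a.1 1) :=
  isMultiHom_of_aeval_rescale fun c x => by
    simp only [aeval_X, rescale]
    rw [Finset.prod_eq_single a.1]
    · simp
    · intro b _ hb
      simp [Pi.single_eq_of_ne hb]
    · simp

theorem IsMultiHom.pow [Fintype ι] {F : MvPolynomial (Coord n) k} {d : ι → ℕ}
    (hF : IsMultiHom F d) (r : ℕ) : IsMultiHom (F ^ r) (r • d) := by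
  induction r with
  | zero => simpa using isMultiHom_one
  | succ r ih =>
    rw [pow_succ, succ_nsmul]
    exact ih.mul hF

theorem IsMultiHom.prod [Fintype ι] {α : Type} (s : Finset α) {F : α → MvPolynomial (Coord n) k}
    {d : α → ι → ℕ} (hF : ∀ a ∈ s, IsMultiHom (F a) (d a)) :
    IsMultiHom (∏ a ∈ s, F a) (∑ a ∈ s, d a) := by
  classical
  induction s using Finset.induction_on with
  | empty => simpa using isMultiHom_one
  | insert a s ha ih =>
    rw [Finset.prod_insert ha, Finset.sum_insert ha]
    exact (hF a (Finset.mem_insert_self a s)).mul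
      (ih fun b hb => hF b (Finset.mem_insert_of_mem hb))

theorem IsMultiHom.congr {F : MvPolynomial (Coord n) k} {d e : ι → ℕ} (hF : IsMultiHom F d)
    (h : d = e) : IsMultiHom F e := h ▸ hF

theorem aeval_bind₁ (F : Coord m → MvPolynomial (Coord n) k)
    (G : MvPolynomial (Coord m) k) (x : Coord n → ℂ) :
    aeval x (bind₁ F G) = aeval (fun a => aeval x (F a)) G := by
  rw [MvPolynomial.aeval_bind₁]

theorem IsMultiHom.bind₁ [Fintype ι] [Fintype κ] {G : MvPolynomial (Coord m) k} {e : κ → ℕ}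
    (hG : IsMultiHom G e) {F : Coord m → MvPolynomial (Coord n) k} {d : κ → ι → ℕ}
    (hF : ∀ a, IsMultiHom (F a) (d a.1)) :
    IsMultiHom (MvPolynomial.bind₁ F G) (∑ j, e j • d j) :=
  isMultiHom_of_aeval_rescale fun c x => by
    simp only [MvPolynomial.aeval_bind₁, (hF _).aeval_rescale]
    refine (hG.aeval_rescale (fun j => ∏ i, c i ^ d j i) fun a => aeval x (F a)).trans ?_
    congr 1
    simp only [← Finset.prod_pow, Finset.sum_apply, Pi.smul_apply, smul_eq_mul,
      ← Finset.prod_pow_eq_pow_sum]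
    rw [Finset.prod_comm]
    refine Finset.prod_congr rfl fun i _ => Finset.prod_congr rfl fun j _ => ?_
    rw [← pow_mul, mul_comm]

/-! ### Coordinate vectors of points -/

/-- `x` is a vector of homogeneous coordinates of `p`. -/
def IsCoordOf (x : Coord n → ℂ) (p : MultiProj n) : Prop :=
  ∃ c : ι → ℂ, (∀ i, c i ≠ 0) ∧ x = rescale c (homCoord p)

theorem isCoordOf_homCoord (p : MultiProj n) : IsCoordOf (homCoord p) p :=
  ⟨1, fun _ => one_ne_zero, by funext a; simp [rescale]⟩

/-- `v` is a multiple, possibly zero, of a coordinate vector of the point `P`. -/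
theorem mem_submodule_iff {N : ℕ} {P : Projectivization ℂ (Fin (N + 1) → ℂ)}
    {v : Fin (N + 1) → ℂ} : v ∈ P.submodule ↔ ∃ c : ℂ, v = c • P.rep := by
  rw [Projectivization.submodule_eq, Submodule.mem_span_singleton]
  exact ⟨fun ⟨c, h⟩ => ⟨c, h.symm⟩, fun ⟨c, h⟩ => ⟨c, h.symm⟩⟩

theorem eq_of_mem_submodule {N : ℕ} {P Q : Projectivization ℂ (Fin (N + 1) → ℂ)}
    {v : Fin (N + 1) → ℂ} (hv : v ≠ 0) (hP : v ∈ P.submodule) (hQ : v ∈ Q.submodule) : P = Q := by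
  rw [mem_submodule_iff] at hP hQ
  obtain ⟨c, rfl⟩ := hP
  obtain ⟨c', h⟩ := hQ
  have hc : c ≠ 0 := fun h0 => hv (by simp [h0])
  have hc' : c' ≠ 0 := fun h0 => hv (by simp [h, h0])
  rw [← Projectivization.mk_rep P, ← Projectivization.mk_rep Q, Projectivization.mk_eq_mk_iff']
  refine ⟨c⁻¹ * c', ?_⟩
  rw [mul_smul, ← h, smul_smul, inv_mul_cancel₀ hc, one_smul]

theorem isCoordOf_iff {x : Coord n → ℂ} {p : MultiProj n} :
    IsCoordOf x p ↔ ∀ i, (fun j => x ⟨i, j⟩) ≠ 0 ∧ (fun j => x ⟨i, j⟩) ∈ (p i).submodule := by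
  constructor
  · rintro ⟨c, hc, rfl⟩ i
    refine ⟨fun h => (p i).rep_nonzero ?_, mem_submodule_iff.2 ⟨c i, rfl⟩⟩
    funext j
    exact (mul_eq_zero.1 (congrFun h j)).resolve_left (hc i)
  · intro h
    choose c hc using fun i => mem_submodule_iff.1 (h i).2
    refine ⟨c, fun i hi => (h i).1 (by rw [hc, hi, zero_smul]), ?_⟩
    funext a
    exact congrFun (hc a.1) a.2

/-- The vanishing of a form at a point may be tested on any coordinate vector. -/
theorem IsMultiHom.aeval_eq [Fintype ι] {F : MvPolynomial (Coord n) k} {d : ι → ℕ}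
    (hF : IsMultiHom F d) {x : Coord n → ℂ} {p : MultiProj n} (h : IsCoordOf x p) :
    aeval x F = 0 ↔ evalAt F p = 0 := by
  obtain ⟨c, hc, rfl⟩ := h
  rw [hF.aeval_rescale, evalAt, mul_eq_zero, or_iff_right]
  exact Finset.prod_ne_zero_iff.2 fun i _ => pow_ne_zero _ (hc i)

/-! ### Closed and open sets -/

/-- A set is closed iff each point of the complement is separated from it by a form. -/
theorem isClosedOver_iff {V : Set (MultiProj n)} : IsClosedOver k V ↔
    ∀ p ∉ V, ∃ (F : MvPolynomial (Coord n) k) (d : ι → ℕ), IsMultiHom F d ∧ evalAt F p ≠ 0 ∧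
      ∀ q ∈ V, evalAt F q = 0 := by
  constructor
  · rintro ⟨S, hS, rfl⟩ p hp
    simp only [Set.mem_ofPred_eq, not_forall] at hp
    obtain ⟨F, hF, hFp⟩ := hp
    obtain ⟨d, hd⟩ := hS F hF
    exact ⟨F, d, hd, hFp, fun q hq => hq F hF⟩
  · intro h
    refine ⟨{F | (∃ d, IsMultiHom F d) ∧ ∀ q ∈ V, evalAt F q = 0}, fun F hF => hF.1, ?_⟩
    ext p
    refine ⟨fun hp F hF => hF.2 p hp, fun hp => ?_⟩
    by_contra hpV
    obtain ⟨F, d, hd, hFp, hFV⟩ := h p hpV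
    exact hFp (hp F ⟨⟨d, hd⟩, hFV⟩)

theorem isOpenOver_iff {V : Set (MultiProj n)} {U : Set V} : IsOpenOver k U ↔
    ∀ p ∈ U, ∃ (F : MvPolynomial (Coord n) k) (d : ι → ℕ), IsMultiHom F d ∧ evalAt F p.1 ≠ 0 ∧
      ∀ q ∉ U, evalAt F q.1 = 0 := by
  constructor
  · rintro ⟨Z, hZ, rfl⟩ p hp
    obtain ⟨F, d, hd, hFp, hFZ⟩ := isClosedOver_iff.1 hZ p.1 hp
    exact ⟨F, d, hd, hFp, fun q hq => hFZ _ (not_not.1 hq)⟩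
  · intro h
    refine ⟨{p | ∀ F : MvPolynomial (Coord n) k, (∃ d, IsMultiHom F d) →
      (∀ q : V, q ∉ U → evalAt F q.1 = 0) → evalAt F p = 0}, ?_, ?_⟩
    · rw [isClosedOver_iff]
      intro p hp
      simp only [Set.mem_ofPred_eq, not_forall] at hp
      obtain ⟨F, ⟨d, hd⟩, hF, hFp⟩ := hp
      exact ⟨F, d, hd, hFp, fun q hq => hq F ⟨d, hd⟩ hF⟩
    · ext p
      constructor
      · intro hp hpZ
        obtain ⟨F, d, hd, hFp, hFU⟩ := h p hp
        exact hFp (hpZ F ⟨d, hd⟩ hFU)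
      · intro hp
        by_contra hpU
        exact hp fun F _ hF => hF p hpU

/-! ### Regular maps -/

/-- The pullback of forms along a regular map, near a given point. -/
theorem IsRegularMap.exists_pullback [Fintype ι] [Fintype κ] {V : Set (MultiProj n)}
    {W : Set (MultiProj m)} {f : V → W} (hf : IsRegularMap k f) (p : V) :
    ∃ (F : Coord m → MvPolynomial (Coord n) k) (d : κ → ι → ℕ),
      (∀ a, IsMultiHom (F a) (d a.1)) ∧ ∃ c : V → κ → ℂ, (∀ j, c p j ≠ 0) ∧
      ∀ q a, evalAt (F a) q.1 = c q a.1 * homCoord (f q).1 a := by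
  choose d F hF hp hq using hf p
  choose c hc using fun q j => mem_submodule_iff.1 (hq j q)
  have hc' : ∀ q j l, evalAt (F j l) q.1 = c q j * homCoord (f q).1 ⟨j, l⟩ :=
    fun q j l => congrFun (hc q j) l
  refine ⟨fun a => F a.1 a.2, d, fun a => hF _ _, c, fun j h0 => ?_, fun q a => hc' _ _ _⟩
  obtain ⟨l, hl⟩ := hp j
  exact hl (by rw [hc', h0, zero_mul])

theorem evalAt_bind₁ [Fintype ι] [Fintype κ] {G : MvPolynomial (Coord m) k} {e : κ → ℕ}
    (hG : IsMultiHom G e) {F : Coord m → MvPolynomial (Coord n) k} {p : MultiProj n}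
    {q : MultiProj m} {c : κ → ℂ} (h : ∀ a, evalAt (F a) p = c a.1 * homCoord q a) :
    evalAt (bind₁ F G) p = (∏ j, c j ^ e j) * evalAt G q := by
  rw [evalAt, MvPolynomial.aeval_bind₁, evalAt, ← hG.aeval_rescale]
  congr 2
  funext a
  exact h a

theorem IsRegularMap.comp [Fintype ι] [Fintype κ] {ν : Type} {r : ν → ℕ} {V : Set (MultiProj n)}
    {W : Set (MultiProj m)} {T : Set (MultiProj r)} {g : W → T} {f : V → W}
    (hg : IsRegularMap k g) (hf : IsRegularMap k f) : IsRegularMap k (g ∘ f) := by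
  intro p j
  obtain ⟨F, d, hF, c, hc, hev⟩ := hf.exists_pullback p
  obtain ⟨e, G, hG, ⟨l, hl⟩, hq⟩ := hg (f p) j
  refine ⟨_, fun l => bind₁ F (G l), fun l => (hG l).bind₁ hF, ⟨l, ?_⟩, fun q => ?_⟩
  · rw [evalAt_bind₁ (hG l) (hev p)]
    exact mul_ne_zero (Finset.prod_ne_zero_iff.2 fun i _ => pow_ne_zero _ (hc i)) hl
  · simp only [evalAt_bind₁ (hG _) (hev q)]
    exact Submodule.smul_mem _ _ (hq (f q))

theorem IsRegularMap.isOpenOver_preimage [Fintype ι] [Fintype κ] {V : Set (MultiProj n)}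
    {W : Set (MultiProj m)} {f : V → W} (hf : IsRegularMap k f) {U : Set W}
    (hU : IsOpenOver k U) : IsOpenOver k (f ⁻¹' U) := by
  rw [isOpenOver_iff] at hU ⊢
  intro p hp
  obtain ⟨F, d, hF, c, hc, hev⟩ := hf.exists_pullback p
  obtain ⟨G, e, hG, hGp, hGU⟩ := hU (f p) hp
  refine ⟨bind₁ F G, _, hG.bind₁ hF, ?_, fun q hq => ?_⟩
  · rw [evalAt_bind₁ hG (hev p)]
    exact mul_ne_zero (Finset.prod_ne_zero_iff.2 fun i _ => pow_ne_zero _ (hc i)) hGp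
  · rw [evalAt_bind₁ hG (hev q), hGU _ hq, mul_zero]

theorem IsRegularMap.isRegularOn_comp [Fintype ι] [Fintype κ] {V : Set (MultiProj n)}
    {W : Set (MultiProj m)} {f : V → W} (hf : IsRegularMap k f) {U : Set W} {g : W → ℂ}
    (hg : IsRegularOn k U g) : IsRegularOn k (f ⁻¹' U) (g ∘ f) := by
  intro p hp
  obtain ⟨F, d, hF, c, hc, hev⟩ := hf.exists_pullback p
  obtain ⟨e, P, Q, hP, hQ, hQp, hg⟩ := hg (f p) hp
  refine ⟨_, bind₁ F P, bind₁ F Q, hP.bind₁ hF, hQ.bind₁ hF, ?_, fun q hq hQq => ?_⟩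
  · rw [evalAt_bind₁ hQ (hev p)]
    exact mul_ne_zero (Finset.prod_ne_zero_iff.2 fun i _ => pow_ne_zero _ (hc i)) hQp
  · rw [evalAt_bind₁ hQ (hev q)] at hQq ⊢
    rw [evalAt_bind₁ hP (hev q), mul_div_mul_left _ _ (left_ne_zero_of_mul hQq)]
    exact hg _ hq (right_ne_zero_of_mul hQq)

end Forms

/-! ### Products of varieties -/

section Products

variable {ι κ ν : Type} {n : ι → ℕ} {m : κ → ℕ} {r : ν → ℕ} {k : IntermediateField ℚ ℂ}

theorem IsMultiHom.rename_inl [Fintype ι] [Fintype κ] {F : MvPolynomial (Coord n) k} {d : ι → ℕ}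
    (hF : IsMultiHom F d) :
    IsMultiHom (rename (fun a => ⟨Sum.inl a.1, a.2⟩ : Coord n → Coord (Sum.elim n m)) F)
      (Sum.elim d 0) :=
  isMultiHom_of_aeval_rescale fun c x => by
    simp only [aeval_rename, Fintype.prod_sum_type, Sum.elim_inl, Sum.elim_inr, Pi.zero_apply,
      pow_zero, Finset.prod_const_one, mul_one]
    exact hF.aeval_rescale (fun i => c (Sum.inl i)) fun a => x ⟨Sum.inl a.1, a.2⟩

theorem IsMultiHom.rename_inr [Fintype ι] [Fintype κ] {F : MvPolynomial (Coord m) k} {d : κ → ℕ}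
    (hF : IsMultiHom F d) :
    IsMultiHom (rename (fun a => ⟨Sum.inr a.1, a.2⟩ : Coord m → Coord (Sum.elim n m)) F)
      (Sum.elim 0 d) :=
  isMultiHom_of_aeval_rescale fun c x => by
    simp only [aeval_rename, Fintype.prod_sum_type, Sum.elim_inl, Sum.elim_inr, Pi.zero_apply,
      pow_zero, Finset.prod_const_one, one_mul]
    exact hF.aeval_rescale (fun i => c (Sum.inr i)) fun a => x ⟨Sum.inr a.1, a.2⟩

theorem evalAt_rename_inl (F : MvPolynomial (Coord n) k) (p : MultiProj (Sum.elim n m)) :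
    evalAt (rename (fun a => ⟨Sum.inl a.1, a.2⟩ : Coord n → Coord (Sum.elim n m)) F) p =
      evalAt F (fun i => p (Sum.inl i)) := by
  rw [evalAt, aeval_rename]
  rfl

theorem evalAt_rename_inr (F : MvPolynomial (Coord m) k) (p : MultiProj (Sum.elim n m)) :
    evalAt (rename (fun a => ⟨Sum.inr a.1, a.2⟩ : Coord m → Coord (Sum.elim n m)) F) p =
      evalAt F (fun i => p (Sum.inr i)) := by
  rw [evalAt, aeval_rename]
  rfl

theorem IsClosedOver.prodVar [Fintype ι] [Fintype κ] {V : Set (MultiProj n)}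
    {W : Set (MultiProj m)} (hV : IsClosedOver k V) (hW : IsClosedOver k W) :
    IsClosedOver k (prodVar V W) := by
  rw [isClosedOver_iff] at hV hW ⊢
  intro p hp
  by_cases h : (fun i => p (Sum.inl i) : MultiProj n) ∈ V
  · obtain ⟨F, d, hF, hFp, hFW⟩ := hW _ fun h' => hp ⟨h, h'⟩
    exact ⟨_, _, hF.rename_inr, by rwa [evalAt_rename_inr], fun q hq => by
      rw [evalAt_rename_inr, hFW _ hq.2]⟩
  · obtain ⟨F, d, hF, hFp, hFV⟩ := hV _ h
    exact ⟨_, _, hF.rename_inl, by rwa [evalAt_rename_inl], fun q hq => by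
      rw [evalAt_rename_inl, hFV _ hq.1]⟩

theorem isRegularMap_id [Fintype ι] {V : Set (MultiProj n)} : IsRegularMap k (id : V → V) := by
  classical
  intro p i
  refine ⟨Pi.single i 1, fun l => X ⟨i, l⟩, fun l => isMultiHom_X _, ?_, fun q => ?_⟩
  · by_contra! h
    refine (p.1 i).rep_nonzero (funext fun l => ?_)
    have hl := h l
    rwa [evalAt, aeval_X] at hl
  · simp only [evalAt, aeval_X]
    exact mem_submodule_iff.2 ⟨1, by rw [one_smul]; rfl⟩

theorem isRegularMap_fst [Fintype ι] [Fintype κ] {V : Set (MultiProj n)} {W : Set (MultiProj m)} :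
    IsRegularMap k (fun p : prodVar V W => (prodVarEquiv V W p).1) := fun p i =>
  isRegularMap_id (k := k) (V := prodVar V W) p (Sum.inl i)

theorem isRegularMap_snd [Fintype ι] [Fintype κ] {V : Set (MultiProj n)} {W : Set (MultiProj m)} :
    IsRegularMap k (fun p : prodVar V W => (prodVarEquiv V W p).2) := fun p i =>
  isRegularMap_id (k := k) (V := prodVar V W) p (Sum.inr i)

theorem IsRegularMap.pair {T : Set (MultiProj r)} {V : Set (MultiProj n)} {W : Set (MultiProj m)}
    {f : T → V} {g : T → W} (hf : IsRegularMap k f) (hg : IsRegularMap k g) :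
    IsRegularMap k (fun p => (prodVarEquiv V W).symm (f p, g p)) := by
  rintro p (i | j)
  · exact hf p i
  · exact hg p j

end Products

/-! ### Quotients by sign changes of the coordinates -/

section SignQuotients

variable {ι κ : Type} {n : ι → ℕ} {m : κ → ℕ} {k : IntermediateField ℚ ℂ}

/-- The coordinate vector `x` with its coordinates multiplied by the signs `ε`. -/
def signed (ε : Coord n → ℤˣ) (x : Coord n → ℂ) : Coord n → ℂ := fun a => ((ε a : ℤ) : ℂ) * x a

/-- All monomials of `F` are multiplied by `s` under the sign change `ε`. -/
def HasSign [Fintype ι] (ε : Coord n → ℤˣ) (s : ℤˣ) (F : MvPolynomial (Coord n) k) : Prop :=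
  ∀ e ∈ F.support, ∏ a, ε a ^ e a = s

theorem HasSign.aeval_signed [Fintype ι] {ε : Coord n → ℤˣ} {s : ℤˣ}
    {F : MvPolynomial (Coord n) k} (hF : HasSign ε s F) (x : Coord n → ℂ) :
    aeval (signed ε x) F = ((s : ℤ) : ℂ) * aeval x F := by
  rw [aeval_eq_sum, aeval_eq_sum, Finset.mul_sum]
  refine Finset.sum_congr rfl fun e he => ?_
  rw [← hF e he]
  simp only [signed, mul_pow, Finset.prod_mul_distrib]
  push_cast
  ring

theorem HasSign.mul [Fintype ι] {ε : Coord n → ℤˣ} {s t : ℤˣ} {F G : MvPolynomial (Coord n) k}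
    (hF : HasSign ε s F) (hG : HasSign ε t G) : HasSign ε (s * t) (F * G) := by
  classical
  intro e he
  obtain ⟨e₁, h₁, e₂, h₂, rfl⟩ := Finset.mem_add.1 (support_mul F G he)
  rw [← hF _ h₁, ← hG _ h₂, ← Finset.prod_mul_distrib]
  exact Finset.prod_congr rfl fun a _ => by rw [Finsupp.add_apply, pow_add]

/-- A polynomial is the sum of its even and its odd part under a sign change. -/
theorem exists_split [Fintype ι] (ε : Coord n → ℤˣ) (F : MvPolynomial (Coord n) k) :
    ∃ F₁ F₂ : MvPolynomial (Coord n) k, F = F₁ + F₂ ∧ F₁.support ⊆ F.support ∧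
      F₂.support ⊆ F.support ∧ HasSign ε 1 F₁ ∧ HasSign ε (-1) F₂ := by
  classical
  have key : ∀ s : Finset (Coord n →₀ ℕ), s ⊆ F.support →
      ∀ e ∈ (∑ e ∈ s, monomial e (coeff e F)).support, e ∈ s := by
    intro s _ e he
    by_contra hes
    refine mem_support_iff.1 he ?_
    simp [coeff_sum, coeff_monomial, hes]
  set p : (Coord n →₀ ℕ) → Prop := fun e => ∏ a, ε a ^ e a = 1 with hp
  have h₁ := key (F.support.filter p) (Finset.filter_subset _ _)
  have h₂ := key (F.support.filter fun e => ¬ p e) (Finset.filter_subset _ _)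
  refine ⟨_, _, ?_, fun e he => (Finset.mem_filter.1 (h₁ e he)).1,
    fun e he => (Finset.mem_filter.1 (h₂ e he)).1, fun e he => (Finset.mem_filter.1 (h₁ e he)).2,
    fun e he => ?_⟩
  · rw [Finset.sum_filter_add_sum_filter_not]
    exact F.as_sum
  · exact (Int.units_eq_one_or _).resolve_left (Finset.mem_filter.1 (h₂ e he)).2

/-- A relation `A P = B Q` between forms `P` and `Q` with invariant coefficients `A` and `B`
can be replaced by one between forms that are even under a given sign change: the even and the
odd parts of `P` and `Q` satisfy the relation separately. -/
theorem exists_even_step [Fintype ι] {V : Set (MultiProj n)} {W : Set V} {A B : V → ℂ}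
    {ε : Coord n → ℤˣ}
    (hε : ∀ v ∈ W, ∃ v' ∈ W, A v' = A v ∧ B v' = B v ∧ IsCoordOf (signed ε (homCoord v.1)) v'.1)
    {d : ι → ℕ} {P Q : MvPolynomial (Coord n) k} (hP : IsMultiHom P d) (hQ : IsMultiHom Q d)
    (hPQ : ∀ v ∈ W, A v * evalAt P v.1 = B v * evalAt Q v.1) {p : V} (hp : evalAt Q p.1 ≠ 0) :
    ∃ P' Q' : MvPolynomial (Coord n) k, IsMultiHom P' (d + d) ∧ IsMultiHom Q' (d + d) ∧
      HasSign ε 1 P' ∧ HasSign ε 1 Q' ∧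
      (∀ δ, HasSign δ 1 P → HasSign δ 1 Q → HasSign δ 1 P' ∧ HasSign δ 1 Q') ∧
      (∀ v ∈ W, A v * evalAt P' v.1 = B v * evalAt Q' v.1) ∧ evalAt Q' p.1 ≠ 0 := by
  obtain ⟨P₁, P₂, hPe, hP₁, hP₂, hPs₁, hPs₂⟩ := exists_split ε P
  obtain ⟨Q₁, Q₂, hQe, hQ₁, hQ₂, hQs₁, hQs₂⟩ := exists_split ε Q
  have hrel : ∀ v ∈ W, A v * evalAt P₁ v.1 = B v * evalAt Q₁ v.1 ∧
      A v * evalAt P₂ v.1 = B v * evalAt Q₂ v.1 := by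
    intro v hv
    obtain ⟨v', hv', hA, hB, c, hc, hcoord⟩ := hε v hv
    have h := hPQ v hv
    have h' := hPQ v' hv'
    have hfac : (∏ i, c i ^ d i) ≠ 0 := Finset.prod_ne_zero_iff.2 fun i _ => pow_ne_zero _ (hc i)
    have e1 : (∏ i, c i ^ d i) * evalAt P v'.1 = evalAt P₁ v.1 - evalAt P₂ v.1 := by
      rw [evalAt, ← hP.aeval_rescale, ← hcoord, hPe, map_add, hPs₁.aeval_signed,
        hPs₂.aeval_signed]
      simp [evalAt, sub_eq_add_neg]
    have e2 : (∏ i, c i ^ d i) * evalAt Q v'.1 = evalAt Q₁ v.1 - evalAt Q₂ v.1 := by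
      rw [evalAt, ← hQ.aeval_rescale, ← hcoord, hQe, map_add, hQs₁.aeval_signed,
        hQs₂.aeval_signed]
      simp [evalAt, sub_eq_add_neg]
    have e3 : evalAt P v.1 = evalAt P₁ v.1 + evalAt P₂ v.1 := by
      rw [hPe, evalAt, map_add]
      rfl
    have e4 : evalAt Q v.1 = evalAt Q₁ v.1 + evalAt Q₂ v.1 := by
      rw [hQe, evalAt, map_add]
      rfl
    rw [hA, hB] at h'
    rw [e3, e4] at h
    have h'' : A v * (evalAt P₁ v.1 - evalAt P₂ v.1) = B v * (evalAt Q₁ v.1 - evalAt Q₂ v.1) := by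
      rw [← e1, ← e2]
      linear_combination (∏ i, c i ^ d i) * h'
    constructor
    · linear_combination (h + h'') / 2
    · linear_combination (h - h'') / 2
  have hsum : evalAt Q₁ p.1 + evalAt Q₂ p.1 ≠ 0 := by
    intro h0
    apply hp
    rw [hQe, evalAt, map_add]
    exact h0
  have finish : ∀ (s : ℤˣ) (P₀ Q₀ : MvPolynomial (Coord n) k), P₀.support ⊆ P.support →
      Q₀.support ⊆ Q.support → HasSign ε s P₀ → HasSign ε s Q₀ →
      (∀ v ∈ W, A v * evalAt P₀ v.1 = B v * evalAt Q₀ v.1) → evalAt Q₀ p.1 ≠ 0 →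
      ∃ P' Q' : MvPolynomial (Coord n) k, IsMultiHom P' (d + d) ∧ IsMultiHom Q' (d + d) ∧
        HasSign ε 1 P' ∧ HasSign ε 1 Q' ∧
        (∀ δ, HasSign δ 1 P → HasSign δ 1 Q → HasSign δ 1 P' ∧ HasSign δ 1 Q') ∧
        (∀ v ∈ W, A v * evalAt P' v.1 = B v * evalAt Q' v.1) ∧ evalAt Q' p.1 ≠ 0 := by
    intro s P₀ Q₀ hP₀ hQ₀ hPs hQs hr hne
    have hdP : IsMultiHom P₀ d := fun e he => hP e (hP₀ he)
    have hdQ : IsMultiHom Q₀ d := fun e he => hQ e (hQ₀ he)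
    refine ⟨P₀ * Q₀, Q₀ * Q₀, hdP.mul hdQ, hdQ.mul hdQ, ?_, ?_, fun δ hδP hδQ => ⟨?_, ?_⟩,
      fun v hv => ?_, ?_⟩
    · simpa using hPs.mul hQs
    · simpa using hQs.mul hQs
    · simpa using HasSign.mul (ε := δ) (s := 1) (t := 1) (fun e he => hδP e (hP₀ he))
        (fun e he => hδQ e (hQ₀ he))
    · simpa using HasSign.mul (ε := δ) (s := 1) (t := 1) (fun e he => hδQ e (hQ₀ he))
        (fun e he => hδQ e (hQ₀ he))
    · have := hr v hv
      simp only [evalAt, map_mul] at this ⊢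
      linear_combination aeval (homCoord v.1) Q₀ * this
    · simp only [evalAt, map_mul] at hne ⊢
      exact mul_ne_zero hne hne
  by_cases h₁ : evalAt Q₁ p.1 = 0
  · exact finish (-1) P₂ Q₂ hP₂ hQ₂ hPs₂ hQs₂ (fun v hv => (hrel v hv).2) fun h₂ =>
      hsum (by rw [h₁, h₂, add_zero])
  · exact finish 1 P₁ Q₁ hP₁ hQ₁ hPs₁ hQs₁ (fun v hv => (hrel v hv).1) h₁

/-- A relation `A P = B Q` with invariant coefficients `A` and `B` can be replaced by one between
forms of even degree that are even under each of finitely many sign changes. -/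
theorem exists_even [Fintype ι] {V : Set (MultiProj n)} {W : Set V} {A B : V → ℂ}
    (Γ : List (Coord n → ℤˣ))
    (hΓ : ∀ ε ∈ Γ, ∀ v ∈ W, ∃ v' ∈ W, A v' = A v ∧ B v' = B v ∧
      IsCoordOf (signed ε (homCoord v.1)) v'.1)
    {d : ι → ℕ} {P Q : MvPolynomial (Coord n) k} (hP : IsMultiHom P d) (hQ : IsMultiHom Q d)
    (hPQ : ∀ v ∈ W, A v * evalAt P v.1 = B v * evalAt Q v.1) {p : V} (hp : evalAt Q p.1 ≠ 0) :
    ∃ (d' : ι → ℕ) (P' Q' : MvPolynomial (Coord n) k), IsMultiHom P' (2 • d') ∧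
      IsMultiHom Q' (2 • d') ∧ (∀ ε ∈ Γ, HasSign ε 1 P' ∧ HasSign ε 1 Q') ∧
      (∀ v ∈ W, A v * evalAt P' v.1 = B v * evalAt Q' v.1) ∧ evalAt Q' p.1 ≠ 0 := by
  induction Γ with
  | nil =>
    refine ⟨d, P * Q, Q * Q, (hP.mul hQ).congr (two_nsmul d).symm,
      (hQ.mul hQ).congr (two_nsmul d).symm, fun ε h => by simp at h, fun v hv => ?_, ?_⟩
    · have := hPQ v hv
      simp only [evalAt, map_mul] at this ⊢
      linear_combination aeval (homCoord v.1) Q * this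
    · simp only [evalAt, map_mul] at hp ⊢
      exact mul_ne_zero hp hp
  | cons ε Γ ih =>
    obtain ⟨d', P', Q', hP', hQ', hs, hrel, hne⟩ := ih fun δ hδ => hΓ δ (List.mem_cons_of_mem _ hδ)
    obtain ⟨P'', Q'', h1, h2, h3, h4, h5, h6, h7⟩ :=
      exists_even_step (hΓ ε List.mem_cons_self) hP' hQ' hrel hne
    refine ⟨2 • d', P'', Q'', h1.congr (two_nsmul _).symm, h2.congr (two_nsmul _).symm,
      fun δ hδ => ?_, h6, h7⟩
    rcases List.mem_cons.1 hδ with rfl | hδ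
    · exact ⟨h3, h4⟩
    · exact h5 δ (hs δ hδ).1 (hs δ hδ).2

/-- The map `π` is given by forms `Φ` and is invariant under the sign changes in `Γ`, and, up to
a multiplier `M`, every monomial invariant under `Γ` is a polynomial in `Φ`. This is an algebraic
criterion for `π` to be a quotient map. -/
structure IsSignQuotient (k : IntermediateField ℚ ℂ) [Fintype ι] {V : Set (MultiProj n)}
    {Y : Set (MultiProj m)} (Γ : List (Coord n → ℤˣ)) (π : V → Y)
    (Φ : Coord m → MvPolynomial (Coord n) k) : Prop where
  surjective : Function.Surjective π
  lift : ∀ ε ∈ Γ, ∀ v : V, ∃ v' : V, π v' = π v ∧ IsCoordOf (signed ε (homCoord v.1)) v'.1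
  forms : ∃ δ : κ → ι → ℕ, ∀ a, IsMultiHom (Φ a) (δ a.1)
  coord : ∀ v : V, IsCoordOf (fun a => evalAt (Φ a) v.1) (π v).1
  invariants : ∀ (p : V) (d : ι → ℕ), ∃ (M : MvPolynomial (Coord n) k) (d' : κ → ℕ),
    evalAt M p.1 ≠ 0 ∧ ∀ e : Coord n →₀ ℕ, (∀ i, ∑ j, e ⟨i, j⟩ = 2 * d i) →
      (∀ ε ∈ Γ, ∏ a, ε a ^ e a = 1) → ∃ Ψ : MvPolynomial (Coord m) k, IsMultiHom Ψ d' ∧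
        ∀ v : V, evalAt M v.1 * ∏ a, homCoord v.1 a ^ e a =
          aeval (fun a => evalAt (Φ a) v.1) Ψ

namespace IsSignQuotient

variable [Fintype ι] [Fintype κ] {V : Set (MultiProj n)} {Y : Set (MultiProj m)}
  {Γ : List (Coord n → ℤˣ)} {π : V → Y} {Φ : Coord m → MvPolynomial (Coord n) k}

theorem invariant_form (h : IsSignQuotient k Γ π Φ) (p : V) (d : ι → ℕ) :
    ∃ (M : MvPolynomial (Coord n) k) (d' : κ → ℕ), evalAt M p.1 ≠ 0 ∧
      ∀ F : MvPolynomial (Coord n) k, IsMultiHom F (2 • d) → (∀ ε ∈ Γ, HasSign ε 1 F) →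
        ∃ Ψ : MvPolynomial (Coord m) k, IsMultiHom Ψ d' ∧
          ∀ v : V, evalAt M v.1 * evalAt F v.1 = aeval (fun a => evalAt (Φ a) v.1) Ψ := by
  classical
  obtain ⟨M, d', hM, hmono⟩ := h.invariants p d
  refine ⟨M, d', hM, fun F hF hs => ?_⟩
  have hex : ∀ e : F.support, ∃ Ψ : MvPolynomial (Coord m) k, IsMultiHom Ψ d' ∧
      ∀ v : V, evalAt M v.1 * ∏ a, homCoord v.1 a ^ e.1 a =
        aeval (fun a => evalAt (Φ a) v.1) Ψ := fun e =>
    hmono e.1 (fun i => by rw [hF e.1 e.2 i]; rfl) fun ε hε => hs ε hε e.1 e.2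
  choose Ψ hΨ hev using hex
  refine ⟨∑ e ∈ F.support.attach, C (coeff e.1 F) * Ψ e, ?_, fun v => ?_⟩
  · exact isMultiHom_of_aeval_rescale fun c x => by
      simp only [map_sum, map_mul, (hΨ _).aeval_rescale, Finset.mul_sum]
      exact Finset.sum_congr rfl fun e _ => by
        rw [aeval_C, aeval_C]
        ring
  · simp only [map_sum, map_mul, ← hev, aeval_C]
    rw [show evalAt F v.1 = _ from aeval_eq_sum F _, ← Finset.sum_attach, Finset.mul_sum]
    refine Finset.sum_congr rfl fun e _ => ?_
    rw [evalAt]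
    change _ = ((coeff e.1 F : k) : ℂ) * _
    ring

omit [Fintype κ] in
theorem isRegularMap (h : IsSignQuotient k Γ π Φ) : IsRegularMap k π := by
  obtain ⟨δ, hδ⟩ := h.forms
  intro p j
  refine ⟨δ j, fun l => Φ ⟨j, l⟩, fun l => hδ ⟨j, l⟩, ?_,
    fun q => ((isCoordOf_iff.1 (h.coord q)) j).2⟩
  by_contra! h0
  exact ((isCoordOf_iff.1 (h.coord p)) j).1 (funext h0)

theorem aeval_eq_zero_iff (h : IsSignQuotient k Γ π Φ) {Ψ : MvPolynomial (Coord m) k} {d : κ → ℕ}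
    (hΨ : IsMultiHom Ψ d) (v : V) :
    aeval (fun a => evalAt (Φ a) v.1) Ψ = 0 ↔ evalAt Ψ (π v).1 = 0 :=
  hΨ.aeval_eq (h.coord v)

theorem isOpenOver_iff (h : IsSignQuotient k Γ π Φ) (U : Set Y) :
    IsOpenOver k U ↔ IsOpenOver k (π ⁻¹' U) := by
  refine ⟨fun hU => h.isRegularMap.isOpenOver_preimage hU, fun hU => ?_⟩
  rw [BoxVariety.isOpenOver_iff] at hU ⊢
  intro y hy
  obtain ⟨p, rfl⟩ := h.surjective y
  obtain ⟨F, d, hF, hFp, hFU⟩ := hU p hy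
  obtain ⟨d', P, Q, hP, hQ, hs, hrel, hne⟩ := exists_even (W := (π ⁻¹' U)ᶜ) (A := 0) (B := 1) Γ
    (fun ε hε v hv => by
      obtain ⟨v', h1, h2⟩ := h.lift ε hε v
      refine ⟨v', ?_, rfl, rfl, h2⟩
      change π v' ∉ U
      rw [h1]
      exact hv) hF hF (fun v hv => by simp [hFU v hv]) hFp
  obtain ⟨M, d'', hM, hinv⟩ := h.invariant_form p d'
  obtain ⟨Ψ, hΨ, hev⟩ := hinv Q hQ fun ε hε => (hs ε hε).2
  refine ⟨Ψ, d'', hΨ, ?_, fun y' hy' => ?_⟩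
  · rw [Ne, ← h.aeval_eq_zero_iff hΨ, ← hev]
    exact mul_ne_zero hM hne
  · obtain ⟨v, rfl⟩ := h.surjective y'
    rw [← h.aeval_eq_zero_iff hΨ, ← hev]
    have hv := hrel v hy'
    simp only [Pi.zero_apply, zero_mul, Pi.one_apply, one_mul] at hv
    rw [← hv, mul_zero]

theorem isRegularOn_iff (h : IsSignQuotient k Γ π Φ) (U : Set Y) (g : Y → ℂ) :
    IsRegularOn k U g ↔ IsRegularOn k (π ⁻¹' U) (g ∘ π) := by
  refine ⟨fun hg => h.isRegularMap.isRegularOn_comp hg, fun hg => ?_⟩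
  intro y hy
  obtain ⟨p, rfl⟩ := h.surjective y
  obtain ⟨d, P, Q, hP, hQ, hQp, hPQ⟩ := hg p hy
  obtain ⟨d', P', Q', hP', hQ', hs, hrel, hne⟩ := exists_even (W := π ⁻¹' U) (A := 1)
    (B := g ∘ π) (P := P * Q) (Q := Q * Q) (p := p) Γ
    (fun ε hε v hv => by
      obtain ⟨v', h1, h2⟩ := h.lift ε hε v
      refine ⟨v', ?_, rfl, by simp [h1], h2⟩
      change π v' ∈ U
      rw [h1]
      exact hv) (hP.mul hQ) (hQ.mul hQ)
    (fun v hv => by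
      simp only [evalAt, map_mul] at hPQ ⊢
      by_cases h0 : aeval (homCoord v.1) Q = 0
      · simp [h0]
      · rw [hPQ v hv h0, Pi.one_apply]
        field_simp)
    (by
      simp only [evalAt, map_mul] at hQp ⊢
      exact mul_ne_zero hQp hQp)
  obtain ⟨M, d'', hM, hinv⟩ := h.invariant_form p d'
  obtain ⟨Ψ₁, hΨ₁, hev₁⟩ := hinv P' hP' fun ε hε => (hs ε hε).1
  obtain ⟨Ψ₂, hΨ₂, hev₂⟩ := hinv Q' hQ' fun ε hε => (hs ε hε).2
  refine ⟨d'', Ψ₁, Ψ₂, hΨ₁, hΨ₂, ?_, fun y' hy' hne' => ?_⟩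
  · rw [Ne, ← h.aeval_eq_zero_iff hΨ₂, ← hev₂]
    exact mul_ne_zero hM hne
  · obtain ⟨v, rfl⟩ := h.surjective y'
    obtain ⟨c, hc, hcoord⟩ := h.coord v
    have hr := hrel v hy'
    have h1 := hev₁ v
    have h2 := hev₂ v
    rw [hcoord, hΨ₁.aeval_rescale] at h1
    rw [hcoord, hΨ₂.aeval_rescale] at h2
    have hfac : (∏ j, c j ^ d'' j) ≠ 0 :=
      Finset.prod_ne_zero_iff.2 fun i _ => pow_ne_zero _ (hc i)
    simp only [Pi.one_apply, one_mul, Function.comp_apply] at hr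
    rw [eq_div_iff hne']
    refine mul_left_cancel₀ hfac ?_
    change _ = _ * aeval _ Ψ₁
    rw [← h1, hr]
    change _ * (_ * aeval _ Ψ₂) = _
    linear_combination (-(g (π v))) * h2

theorem isQuotientBy (h : IsSignQuotient k Γ π Φ) {G : Subgroup (Equiv.Perm V)} (hfin : Finite G)
    (haction : ∀ g ∈ G, IsRegularMap k g) (hV : IsClosedOver k V) (hY : IsClosedOver k Y)
    (hfibre : ∀ p q, π p = π q ↔ ∃ g ∈ G, g p = q) : IsQuotientBy k G π where
  finite := hfin
  action := haction
  source_closed := hV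
  target_closed := hY
  regular := h.isRegularMap
  surjective := h.surjective
  fibre := hfibre
  topology := h.isOpenOver_iff
  functions U _ g := h.isRegularOn_iff U g

end IsSignQuotient

end SignQuotients

/-! ### Quotients and isomorphisms -/

section Transport

variable {ι κ ν : Type} [Fintype ι] [Fintype κ] [Fintype ν] {n : ι → ℕ} {m : κ → ℕ} {r : ν → ℕ}
  {k : IntermediateField ℚ ℂ} {V : Set (MultiProj n)} {Y : Set (MultiProj m)}
  {T : Set (MultiProj r)}

theorem IsIsoOver.isOpenOver_iff {e : V ≃ Y} (he : IsIsoOver k e) (U : Set Y) :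
    IsOpenOver k U ↔ IsOpenOver k (e ⁻¹' U) := by
  refine ⟨he.1.isOpenOver_preimage, fun h => ?_⟩
  have := he.2.isOpenOver_preimage h
  rwa [← Set.preimage_comp, Equiv.self_comp_symm, Set.preimage_id] at this

theorem IsIsoOver.isRegularOn_iff {e : V ≃ Y} (he : IsIsoOver k e) (U : Set Y) (g : Y → ℂ) :
    IsRegularOn k U g ↔ IsRegularOn k (e ⁻¹' U) (g ∘ e) := by
  refine ⟨he.1.isRegularOn_comp, fun h => ?_⟩
  have := he.2.isRegularOn_comp h
  rwa [← Set.preimage_comp, Function.comp_assoc, Equiv.self_comp_symm, Set.preimage_id] at this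

omit [Fintype ι] [Fintype κ] in
theorem IsIsoOver.symm {e : V ≃ Y} (he : IsIsoOver k e) : IsIsoOver k e.symm := ⟨he.2, he.1⟩

theorem IsQuotientBy.comp_iso {G : Subgroup (Equiv.Perm V)} {π : V → Y} (h : IsQuotientBy k G π)
    {e : Y ≃ T} (he : IsIsoOver k e) (hT : IsClosedOver k T) : IsQuotientBy k G (e ∘ π) where
  finite := h.finite
  action := h.action
  source_closed := h.source_closed
  target_closed := hT
  regular := he.1.comp h.regular
  surjective := e.surjective.comp h.surjective
  fibre p q := by rw [← h.fibre, Function.comp_apply, Function.comp_apply, e.apply_eq_iff_eq]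
  topology U := by rw [he.isOpenOver_iff, h.topology, Set.preimage_comp]
  functions U hU g := by
    rw [he.isRegularOn_iff, h.functions _ ((he.isOpenOver_iff U).1 hU), Set.preimage_comp]
    rfl

/-- A map that becomes regular after composition with a quotient map is regular: the ratios of its
coordinates are invariant functions. -/
theorem IsQuotientBy.descend {G : Subgroup (Equiv.Perm V)} {q : V → Y} (h : IsQuotientBy k G q)
    {f : Y → T} (hf : IsRegularMap k (f ∘ q)) : IsRegularMap k f := by
  classical
  intro y j
  -- work on the open set where the coordinate `l` of the `j`-th component is nonzero
  obtain ⟨l, hl⟩ : ∃ l, homCoord (f y).1 ⟨j, l⟩ ≠ 0 := by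
    by_contra! h0
    exact ((f y).1 j).rep_nonzero (funext h0)
  set UT : Set T := {t | homCoord t.1 ⟨j, l⟩ ≠ 0} with hUT
  have hUTopen : IsOpenOver k UT := by
    rw [isOpenOver_iff]
    intro t ht
    refine ⟨X ⟨j, l⟩, _, isMultiHom_X _, by rwa [evalAt, aeval_X], fun t' ht' => ?_⟩
    rw [evalAt, aeval_X]
    exact not_not.1 ht'
  have hUopen : IsOpenOver k (f ⁻¹' UT) := by
    rw [h.topology]
    exact hf.isOpenOver_preimage hUTopen
  have hreg : ∀ s, IsRegularOn k (f ⁻¹' UT)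
      (fun y => homCoord (f y).1 ⟨j, s⟩ / homCoord (f y).1 ⟨j, l⟩) := by
    intro s
    rw [h.functions _ hUopen]
    refine hf.isRegularOn_comp (U := UT)
      (g := fun t => homCoord t.1 ⟨j, s⟩ / homCoord t.1 ⟨j, l⟩) ?_
    intro t ht
    refine ⟨Pi.single j 1, X ⟨j, s⟩, X ⟨j, l⟩, isMultiHom_X _, isMultiHom_X _, ?_,
      fun t' _ _ => ?_⟩
    · rwa [evalAt, aeval_X]
    · simp only [evalAt, aeval_X]
  obtain ⟨H, dH, hH, hHy, hHU⟩ := isOpenOver_iff.1 hUopen y hl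
  choose d P Q hP hQ hQy hPQ using fun s => hreg s y hl
  refine ⟨dH + ∑ s, 2 • d s,
    fun s => H * (P s * Q s * ∏ s' ∈ Finset.univ.erase s, Q s' ^ 2), fun s => ?_, ?_⟩
  · refine hH.mul (IsMultiHom.congr (((hP s).mul (hQ s)).mul
      (IsMultiHom.prod _ fun s' _ => (hQ s').pow 2)) ?_)
    rw [← Finset.add_sum_erase _ _ (Finset.mem_univ s), two_nsmul]
  have key : ∀ y' s, evalAt (H * (P s * Q s * ∏ s' ∈ Finset.univ.erase s, Q s' ^ 2)) y'.1 =
      evalAt (H * ∏ s', Q s' ^ 2) y'.1 / homCoord (f y').1 ⟨j, l⟩ * homCoord (f y').1 ⟨j, s⟩ := by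
    intro y' s
    simp only [evalAt, map_mul, map_prod, map_pow]
    by_cases hy' : y' ∈ f ⁻¹' UT
    · rw [← Finset.mul_prod_erase _ _ (Finset.mem_univ s)]
      by_cases h0 : aeval (homCoord y'.1) (Q s) = 0
      · simp [h0]
      · have := hPQ s y' hy' h0
        simp only [evalAt] at this
        rw [eq_div_iff h0] at this
        rw [← this]
        ring
    · have := hHU y' hy'
      rw [evalAt] at this
      simp [this]
  have hne : evalAt (H * ∏ s', Q s' ^ 2) y.1 ≠ 0 := by
    simp only [evalAt, map_mul, map_prod, map_pow]
    exact mul_ne_zero hHy (Finset.prod_ne_zero_iff.2 fun s _ => pow_ne_zero _ (hQy s))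
  refine ⟨⟨l, ?_⟩, fun y' => ?_⟩
  · rw [key]
    exact mul_ne_zero (div_ne_zero hne hl) hl
  · simp only [key]
    exact mem_submodule_iff.2 ⟨_, rfl⟩

/-- If `V → Y` and `V → T` are quotient maps and the second factors through `f : Y → T`, then `f` is
the quotient map for any group with the right orbits. -/
theorem IsQuotientBy.of_comp {G G' : Subgroup (Equiv.Perm V)} {q : V → Y}
    (hq : IsQuotientBy k G q) {f : Y → T} (hf : IsQuotientBy k G' (f ∘ q))
    {K : Subgroup (Equiv.Perm Y)} (hfin : Finite K) (haction : ∀ g ∈ K, IsRegularMap k g)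
    (hfibre : ∀ x y, f x = f y ↔ ∃ g ∈ K, g x = y) : IsQuotientBy k K f where
  finite := hfin
  action := haction
  source_closed := hq.target_closed
  target_closed := hf.target_closed
  regular := hq.descend hf.regular
  surjective := hf.surjective.of_comp
  fibre := hfibre
  topology U := by rw [hf.topology, hq.topology, Set.preimage_comp]
  functions U hU g := by
    rw [hf.functions U hU, Set.preimage_comp, ← Function.comp_assoc, ← hq.functions]
    rw [hq.topology, ← Set.preimage_comp, ← hf.topology]
    exact hU

end Transport

/-! ### Irreducibility -/

section Irreducible

variable {ι κ : Type} [Fintype ι] [Fintype κ] {n : ι → ℕ} {m : κ → ℕ}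

omit [Fintype ι] in
/-- A set is irreducible iff two forms that do not vanish on it have a common nonzero. -/
theorem isGeomIrreducible_iff {A : Set (MultiProj n)} : IsGeomIrreducible A ↔ A.Nonempty ∧
    ∀ (F G : MvPolynomial (Coord n) (⊤ : IntermediateField ℚ ℂ)) (d e : ι → ℕ), IsMultiHom F d →
      IsMultiHom G e → (∃ p ∈ A, evalAt F p ≠ 0) → (∃ p ∈ A, evalAt G p ≠ 0) →
      ∃ p ∈ A, evalAt F p ≠ 0 ∧ evalAt G p ≠ 0 := by
  refine and_congr_right fun _ => ⟨fun h F G d e hF hG hFp hGp => ?_, fun h Z₁ Z₂ h₁ h₂ hZ => ?_⟩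
  · by_contra! hcon
    have hcl : ∀ (F : MvPolynomial (Coord n) (⊤ : IntermediateField ℚ ℂ)) (d : ι → ℕ),
        IsMultiHom F d → IsClosedOver ⊤ {p | evalAt F p = 0} := fun F d hF =>
      ⟨{F}, fun F' h' => ⟨d, by rw [Set.mem_singleton_iff.1 h']; exact hF⟩, by simp⟩
    rcases h _ _ (hcl F d hF) (hcl G e hG) (fun p hp => by
      by_cases h0 : evalAt F p = 0
      · exact Or.inl h0
      · exact Or.inr (hcon p hp h0)) with h' | h'
    · obtain ⟨p, hp, hne⟩ := hFp
      exact hne (h' hp)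
    · obtain ⟨p, hp, hne⟩ := hGp
      exact hne (h' hp)
  · by_contra! hcon
    obtain ⟨⟨p, hp, hp₁⟩, ⟨q, hq, hq₂⟩⟩ :=
      And.intro (Set.not_subset.1 hcon.1) (Set.not_subset.1 hcon.2)
    obtain ⟨F, d, hF, hFp, hF0⟩ := isClosedOver_iff.1 h₁ p hp₁
    obtain ⟨G, e, hG, hGq, hG0⟩ := isClosedOver_iff.1 h₂ q hq₂
    obtain ⟨x, hx, hxF, hxG⟩ := h F G d e hF hG ⟨p, hp, hFp⟩ ⟨q, hq, hGq⟩
    rcases hZ hx with h' | h'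
    · exact hxF (hF0 x h')
    · exact hxG (hG0 x h')

theorem IsGeomIrreducible.of_surjective {A : Set (MultiProj n)} {B : Set (MultiProj m)}
    (hA : IsGeomIrreducible A) {f : A → B} (hf : IsRegularMap ⊤ f)
    (hs : Function.Surjective f) : IsGeomIrreducible B := by
  rw [isGeomIrreducible_iff] at hA ⊢
  obtain ⟨⟨a, ha⟩, hA⟩ := hA
  refine ⟨⟨_, (f ⟨a, ha⟩).2⟩, ?_⟩
  rintro F G d e hF hG ⟨p, hp, hFp⟩ ⟨q, hq, hGq⟩
  obtain ⟨p', hp'⟩ := hs ⟨p, hp⟩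
  obtain ⟨q', hq'⟩ := hs ⟨q, hq⟩
  obtain ⟨P, dP, hP, c, hc, hevP⟩ := hf.exists_pullback p'
  obtain ⟨Q, dQ, hQ, c', hc', hevQ⟩ := hf.exists_pullback q'
  obtain ⟨x, hx, hx1, hx2⟩ := hA _ _ _ _ (hF.bind₁ hP) (hG.bind₁ hQ)
    ⟨p', p'.2, by
      rw [evalAt_bind₁ hF (hevP p'), hp']
      exact mul_ne_zero (Finset.prod_ne_zero_iff.2 fun i _ => pow_ne_zero _ (hc i)) hFp⟩
    ⟨q', q'.2, by
      rw [evalAt_bind₁ hG (hevQ q'), hq']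
      exact mul_ne_zero (Finset.prod_ne_zero_iff.2 fun i _ => pow_ne_zero _ (hc' i)) hGq⟩
  rw [evalAt_bind₁ hF (hevP ⟨x, hx⟩)] at hx1
  rw [evalAt_bind₁ hG (hevQ ⟨x, hx⟩)] at hx2
  exact ⟨_, (f ⟨x, hx⟩).2, right_ne_zero_of_mul hx1, right_ne_zero_of_mul hx2⟩

/-- The restriction of a form on a product to a horizontal slice. -/
theorem exists_slice_left {F : MvPolynomial (Coord (Sum.elim n m)) (⊤ : IntermediateField ℚ ℂ)}
    {d : ι ⊕ κ → ℕ} (hF : IsMultiHom F d) (q : MultiProj m) :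
    ∃ G : MvPolynomial (Coord n) (⊤ : IntermediateField ℚ ℂ), IsMultiHom G (d ∘ Sum.inl) ∧
      ∀ p : MultiProj n, evalAt G p =
        evalAt F (fun | Sum.inl i => p i | Sum.inr j => q j : MultiProj (Sum.elim n m)) := by
  let s : Coord (Sum.elim n m) → MvPolynomial (Coord n) (⊤ : IntermediateField ℚ ℂ) := fun
    | ⟨Sum.inl i, a⟩ => X ⟨i, a⟩
    | ⟨Sum.inr j, a⟩ => C ⟨homCoord q ⟨j, a⟩, trivial⟩
  refine ⟨bind₁ s F, isMultiHom_of_aeval_rescale fun c x => ?_, fun p => ?_⟩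
  · rw [aeval_bind₁, aeval_bind₁]
    refine Eq.trans ?_ ((hF.aeval_rescale (Sum.elim c 1) fun a => aeval x (s a)).trans ?_)
    · congr 1
      congr 1
      funext a
      obtain ⟨i | j, a⟩ := a
      · simp [s, rescale]
      · simp [s, rescale]
    · simp
  · rw [evalAt, aeval_bind₁, evalAt]
    congr 2
    funext a
    obtain ⟨i | j, a⟩ := a
    · simp only [s, aeval_X]
      rfl
    · simp only [s, aeval_C]
      rfl

/-- The restriction of a form on a product to a vertical slice. -/
theorem exists_slice_right {F : MvPolynomial (Coord (Sum.elim n m)) (⊤ : IntermediateField ℚ ℂ)}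
    {d : ι ⊕ κ → ℕ} (hF : IsMultiHom F d) (p : MultiProj n) :
    ∃ G : MvPolynomial (Coord m) (⊤ : IntermediateField ℚ ℂ), IsMultiHom G (d ∘ Sum.inr) ∧
      ∀ q : MultiProj m, evalAt G q =
        evalAt F (fun | Sum.inl i => p i | Sum.inr j => q j : MultiProj (Sum.elim n m)) := by
  let s : Coord (Sum.elim n m) → MvPolynomial (Coord m) (⊤ : IntermediateField ℚ ℂ) := fun
    | ⟨Sum.inl i, a⟩ => C ⟨homCoord p ⟨i, a⟩, trivial⟩
    | ⟨Sum.inr j, a⟩ => X ⟨j, a⟩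
  refine ⟨bind₁ s F, isMultiHom_of_aeval_rescale fun c x => ?_, fun q => ?_⟩
  · rw [aeval_bind₁, aeval_bind₁]
    refine Eq.trans ?_ ((hF.aeval_rescale (Sum.elim 1 c) fun a => aeval x (s a)).trans ?_)
    · congr 1
      congr 1
      funext a
      obtain ⟨i | j, a⟩ := a
      · simp [s, rescale]
      · simp [s, rescale]
    · simp
  · rw [evalAt, aeval_bind₁, evalAt]
    congr 2
    funext a
    obtain ⟨i | j, a⟩ := a
    · simp only [s, aeval_C]
      rfl
    · simp only [s, aeval_X]
      rfl

omit [Fintype ι] [Fintype κ] in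
theorem prodVar_point_eta (p : MultiProj (Sum.elim n m)) :
    (fun | Sum.inl i => p (Sum.inl i) | Sum.inr j => p (Sum.inr j) : MultiProj (Sum.elim n m)) =
      p := by
  funext i
  cases i <;> rfl

theorem IsGeomIrreducible.prodVar {A : Set (MultiProj n)} {B : Set (MultiProj m)}
    (hA : IsGeomIrreducible A) (hB : IsGeomIrreducible B) : IsGeomIrreducible (prodVar A B) := by
  rw [isGeomIrreducible_iff] at hA hB ⊢
  obtain ⟨⟨a, ha⟩, hA⟩ := hA
  obtain ⟨⟨b, hb⟩, hB⟩ := hB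
  refine ⟨⟨_, ((prodVarEquiv A B).symm (⟨a, ha⟩, ⟨b, hb⟩)).2⟩, ?_⟩
  rintro F G d e hF hG ⟨p, hp, hFp⟩ ⟨q, hq, hGq⟩
  obtain ⟨F₁, hF₁, hF₁e⟩ := exists_slice_left hF fun j => p (Sum.inr j)
  obtain ⟨G₁, hG₁, hG₁e⟩ := exists_slice_left hG fun j => q (Sum.inr j)
  have hF₁p := (hF₁e fun i => p (Sum.inl i)).trans (congrArg (evalAt F) (prodVar_point_eta p))
  have hG₁q := (hG₁e fun i => q (Sum.inl i)).trans (congrArg (evalAt G) (prodVar_point_eta q))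
  obtain ⟨x, hx, hxF, hxG⟩ := hA F₁ G₁ _ _ hF₁ hG₁
    ⟨_, hp.1, fun h0 => hFp (hF₁p.symm.trans h0)⟩ ⟨_, hq.1, fun h0 => hGq (hG₁q.symm.trans h0)⟩
  obtain ⟨F₂, hF₂, hF₂e⟩ := exists_slice_right hF x
  obtain ⟨G₂, hG₂, hG₂e⟩ := exists_slice_right hG x
  have hF₂p := (hF₂e fun j => p (Sum.inr j)).trans (hF₁e x).symm
  have hG₂q := (hG₂e fun j => q (Sum.inr j)).trans (hG₁e x).symm
  obtain ⟨y, hy, hyF, hyG⟩ := hB F₂ G₂ _ _ hF₂ hG₂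
    ⟨_, hp.2, fun h0 => hxF (hF₂p.symm.trans h0)⟩ ⟨_, hq.2, fun h0 => hxG (hG₂q.symm.trans h0)⟩
  refine ⟨_, ((prodVarEquiv A B).symm (⟨x, hx⟩, ⟨y, hy⟩)).2, ?_, ?_⟩
  · rwa [hF₂e] at hyF
  · rwa [hG₂e] at hyG

omit [Fintype κ] in
/-- Two regular maps on an irreducible variety are equal if they agree wherever some form,
not identically zero, does not vanish. -/
theorem IsRegularMap.eq_of_dense {A : Set (MultiProj n)} {B : Set (MultiProj m)}
    (hA : IsGeomIrreducible A) {f g : A → B} (hf : IsRegularMap ⊤ f) (hg : IsRegularMap ⊤ g)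
    {D : MvPolynomial (Coord n) (⊤ : IntermediateField ℚ ℂ)} {d : ι → ℕ} (hD : IsMultiHom D d)
    (hDne : ∃ p ∈ A, evalAt D p ≠ 0) (hfg : ∀ p : A, evalAt D p.1 ≠ 0 → f p = g p) : f = g := by
  funext p
  apply Subtype.ext
  funext j
  obtain ⟨dF, F, hF, ⟨s, hs⟩, hFm⟩ := hf p j
  obtain ⟨dG, G, hG, ⟨t, ht⟩, hGm⟩ := hg p j
  -- the minors of the two representations vanish identically
  have minor : ∀ l l', evalAt (F l) p.1 * evalAt (G l') p.1 =
      evalAt (F l') p.1 * evalAt (G l) p.1 := by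
    intro l l'
    by_contra hne
    have hmul : ∀ (P Q : MvPolynomial (Coord n) (⊤ : IntermediateField ℚ ℂ)) x,
        evalAt (P * Q) x = evalAt P x * evalAt Q x := fun P Q x => map_mul _ _ _
    have hsub : ∀ (P Q : MvPolynomial (Coord n) (⊤ : IntermediateField ℚ ℂ)) x,
        evalAt (P - Q) x = evalAt P x - evalAt Q x := fun P Q x => map_sub _ _ _
    obtain ⟨x, hx, hx1, hx2⟩ := (isGeomIrreducible_iff.1 hA).2 (F l * G l' - F l' * G l) D _ _
      (((hF l).mul (hG l')).sub ((hF l').mul (hG l))) hD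
      ⟨p, p.2, by rw [hsub, hmul, hmul]; exact sub_ne_zero.2 hne⟩ hDne
    apply hx1
    obtain ⟨c, hc⟩ := mem_submodule_iff.1 (hFm ⟨x, hx⟩)
    obtain ⟨c', hc'⟩ := mem_submodule_iff.1 (hGm ⟨x, hx⟩)
    rw [← hfg ⟨x, hx⟩ hx2] at hc'
    have hcl : ∀ l, evalAt (F l) x = c * (((f ⟨x, hx⟩).1 j).rep l) := fun l => congrFun hc l
    have hcl' : ∀ l, evalAt (G l) x = c' * (((f ⟨x, hx⟩).1 j).rep l) := fun l => congrFun hc' l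
    rw [hsub, hmul, hmul, hcl, hcl, hcl', hcl']
    ring
  refine eq_of_mem_submodule (v := fun l => evalAt (F l) p.1) (fun h0 => hs (congrFun h0 s))
    (hFm p) ?_
  have : (fun l => evalAt (F l) p.1) =
      (evalAt (F t) p.1 / evalAt (G t) p.1) • fun l => evalAt (G l) p.1 := by
    funext l
    rw [Pi.smul_apply, smul_eq_mul, div_mul_eq_mul_div, eq_div_iff ht, minor]
  rw [this]
  exact Submodule.smul_mem _ _ (hGm p)

end Irreducible

/-! ### Maps given by integral forms -/

section IntForms

variable {ι κ : Type} [Fintype ι] {n : ι → ℕ} {m : κ → ℕ}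

/-- `f` is the polynomial function of a multihomogeneous polynomial of degree `d` with integral
coefficients. Such a form is defined over every field `k`. -/
structure IsIntForm (d : ι → ℕ) (f : (Coord n → ℂ) → ℂ) : Prop where
  poly : ∃ F : MvPolynomial (Coord n) ℤ, ∀ x, aeval x F = f x
  scale : ∀ (c : ι → ℂ) (x : Coord n → ℂ), f (rescale c x) = (∏ i, c i ^ d i) * f x

theorem IsIntForm.exists_form {d : ι → ℕ} {f : (Coord n → ℂ) → ℂ} (hf : IsIntForm d f)
    (k : IntermediateField ℚ ℂ) :
    ∃ F : MvPolynomial (Coord n) k, IsMultiHom F d ∧ ∀ x, aeval x F = f x := by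
  obtain ⟨F, hF⟩ := hf.poly
  have hev : ∀ x : Coord n → ℂ, aeval x (map (Int.castRingHom k) F) = f x := fun x => by
    rw [← hF, aeval_def, eval₂_map, aeval_def]
    congr 1
  exact ⟨map (Int.castRingHom k) F,
    isMultiHom_of_aeval_rescale fun c x => by rw [hev, hev, hf.scale], hev⟩

theorem isClosedOver_of_intForms {V : Set (MultiProj n)} {α : Type} {d : α → ι → ℕ}
    {f : α → (Coord n → ℂ) → ℂ} (hf : ∀ a, IsIntForm (d a) (f a))
    (hV : ∀ p, p ∈ V ↔ ∀ a, f a (homCoord p) = 0) (k : IntermediateField ℚ ℂ) :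
    IsClosedOver k V := by
  rw [isClosedOver_iff]
  intro p hp
  rw [hV, not_forall] at hp
  obtain ⟨a, ha⟩ := hp
  obtain ⟨F, hF, hFe⟩ := (hf a).exists_form k
  exact ⟨F, _, hF, by rwa [evalAt, hFe], fun q hq => by rw [evalAt, hFe, (hV q).1 hq a]⟩

theorem isRegularMap_of_intForms {V : Set (MultiProj n)} {W : Set (MultiProj m)} {f : V → W}
    (h : ∀ (p : V) (j : κ), ∃ (d : ι → ℕ) (φ : (Coord n → ℂ) → Fin (m j + 1) → ℂ),
      (∀ l, IsIntForm d fun x => φ x l) ∧ φ (homCoord p.1) ≠ 0 ∧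
      ∀ q : V, φ (homCoord q.1) ∈ ((f q).1 j).submodule)
    (k : IntermediateField ℚ ℂ) : IsRegularMap k f := by
  intro p j
  obtain ⟨d, φ, hφ, hne, hmem⟩ := h p j
  choose F hF hFe using fun l => (hφ l).exists_form k
  refine ⟨d, F, hF, ?_, fun q => ?_⟩
  · obtain ⟨l, hl⟩ := Function.ne_iff.1 hne
    exact ⟨l, by rw [evalAt, hFe]; exact hl⟩
  · simpa only [evalAt, hFe] using hmem q

/-- The line of coordinate vectors of a point of `ℙ^N`. -/
def line {N : ℕ} (P : Proj N) : Submodule ℂ (Fin (N + 1) → ℂ) := (P ()).submodule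

theorem mem_line_iff {N : ℕ} {P : Proj N} {v : Fin (N + 1) → ℂ} :
    v ∈ line P ↔ ∃ c : ℂ, v = c • crd P :=
  mem_submodule_iff

theorem crd_mem_line {N : ℕ} (P : Proj N) : crd P ∈ line P :=
  mem_line_iff.2 ⟨1, (one_smul _ _).symm⟩

theorem mkPt_mem_line {N : ℕ} (v : Fin (N + 1) → ℂ) (hv : v ≠ 0) : v ∈ line (mkPt v hv) :=
  Submodule.mem_span_singleton_self v

/-- Two points with proportional coordinate vectors are equal. -/
theorem eq_of_minors {N : ℕ} {P Q : Proj N} {x y : Fin (N + 1) → ℂ} (hx : x ∈ line P)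
    (hy : y ∈ line Q) (hx0 : x ≠ 0) (hy0 : y ≠ 0) (h : ∀ i j, x i * y j = x j * y i) : P = Q := by
  obtain ⟨j, hj⟩ := Function.ne_iff.1 hy0
  funext u
  refine eq_of_mem_submodule hx0 hx ?_
  have : x = (x j / y j) • y := by
    funext i
    rw [Pi.smul_apply, smul_eq_mul, div_mul_eq_mul_div, eq_div_iff hj, h]
  rw [this]
  exact Submodule.smul_mem _ _ hy

theorem eq_of_mem_line {N : ℕ} {P Q : Proj N} {x : Fin (N + 1) → ℂ} (hx : x ≠ 0)
    (hP : x ∈ line P) (hQ : x ∈ line Q) : P = Q :=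
  eq_of_minors hP hQ hx hx fun _ _ => mul_comm _ _

/-- Two representations by integral forms, proportional to each other and without common zero,
define a map to `ℙ^N` that is regular over every field. -/
theorem exists_map_of_forms {N : ℕ} {V : Set (MultiProj n)} {W : Set (Proj N)}
    {φ : Bool → (Coord n → ℂ) → Fin (N + 1) → ℂ} {d : Bool → ι → ℕ}
    (hφ : ∀ b l, IsIntForm (d b) fun x => φ b x l)
    (hne : ∀ v ∈ V, ∃ b, φ b (homCoord v) ≠ 0)
    (hminor : ∀ v ∈ V, ∀ i j, φ true (homCoord v) i * φ false (homCoord v) j =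
      φ true (homCoord v) j * φ false (homCoord v) i)
    (hW : ∀ v ∈ V, ∀ b, ∀ P : Proj N, φ b (homCoord v) ≠ 0 → φ b (homCoord v) ∈ line P → P ∈ W) :
    ∃ f : V → W, (∀ (v : V) (x : Coord n → ℂ), IsCoordOf x v.1 → ∀ b, φ b x ∈ line (f v).1) ∧
      ∀ k, IsRegularMap k f := by
  have hex : ∀ v : V, ∃ w : W, ∀ b, φ b (homCoord v.1) ∈ line w.1 := by
    intro v
    obtain ⟨b, hb⟩ := hne v v.2
    refine ⟨⟨mkPt _ hb, hW v v.2 b _ hb (mkPt_mem_line _ hb)⟩, fun b' => ?_⟩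
    obtain ⟨j, hj⟩ := Function.ne_iff.1 hb
    have : φ b' (homCoord v.1) =
        (φ b' (homCoord v.1) j / φ b (homCoord v.1) j) • φ b (homCoord v.1) := by
      funext i
      rw [Pi.smul_apply, smul_eq_mul, div_mul_eq_mul_div, eq_div_iff hj]
      have := hminor v v.2
      cases b <;> cases b'
      · exact mul_comm _ _
      · exact this i j
      · rw [mul_comm, this, mul_comm]
      · exact mul_comm _ _
    rw [this]
    exact Submodule.smul_mem _ _ (mkPt_mem_line _ hb)
  choose f hf using hex
  refine ⟨f, fun v x hx b => ?_, isRegularMap_of_intForms fun v j => ?_⟩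
  · obtain ⟨c, hc, rfl⟩ := hx
    have : φ b (rescale c (homCoord v.1)) = (∏ i, c i ^ d b i) • φ b (homCoord v.1) :=
      funext fun l => (hφ b l).scale _ _
    rw [this]
    exact Submodule.smul_mem _ _ (hf v b)
  · obtain ⟨b, hb⟩ := hne v v.2
    exact ⟨d b, φ b, hφ b, hb, fun q => hf q b⟩

theorem isCoordOf_unit {N : ℕ} {P : Proj N} {v : Fin (N + 1) → ℂ} (hv : v ≠ 0)
    (h : v ∈ line P) : IsCoordOf (fun a => v a.2) P :=
  isCoordOf_iff.2 fun _ => ⟨hv, h⟩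

end IntForms

/-! ### The curve in space and its Weierstrass model -/

/-- The equations of the curve `E`, for a vector of coordinates. -/
def OnE (v : Fin 4 → ℂ) : Prop :=
  v 0 ^ 2 = v 2 ^ 2 + v 3 ^ 2 ∧ v 1 ^ 2 = v 2 ^ 2 - v 3 ^ 2

theorem onE_of_mem_line {P : Proj 3} (hP : P ∈ curveE) {v : Fin 4 → ℂ} (hv : v ∈ line P) :
    OnE v := by
  obtain ⟨c, rfl⟩ := mem_line_iff.1 hv
  obtain ⟨h1, h2⟩ := hP
  constructor
  · simp only [Pi.smul_apply, smul_eq_mul]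
    linear_combination c ^ 2 * h1
  · simp only [Pi.smul_apply, smul_eq_mul]
    linear_combination c ^ 2 * h2

theorem mem_curveE_of_onE {P : Proj 3} {v : Fin 4 → ℂ} (h0 : v ≠ 0) (hv : v ∈ line P)
    (h : OnE v) : P ∈ curveE := by
  obtain ⟨c, rfl⟩ := mem_line_iff.1 hv
  have hc : c ^ 2 ≠ 0 := pow_ne_zero _ fun hc => h0 (by rw [hc, zero_smul])
  obtain ⟨h1, h2⟩ := h
  simp only [Pi.smul_apply, smul_eq_mul] at h1 h2
  constructor
  · refine mul_left_cancel₀ hc ?_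
    linear_combination h1
  · refine mul_left_cancel₀ hc ?_
    linear_combination h2

/-- The equation `y² z = x³ - x z²` for a vector of coordinates. -/
def OnW (v : Fin 3 → ℂ) : Prop := v 1 ^ 2 * v 2 = v 0 ^ 3 - v 0 * v 2 ^ 2

theorem mem_weierSet_iff {P : Proj 2} : P ∈ weierSet weierE ↔ OnW (crd P) := by
  change (weierE.baseChange ℂ).toProjective.Equation (crd P) ↔ _
  rw [WeierstrassCurve.Projective.equation_iff]
  simp only [weierE, OnW, WeierstrassCurve.baseChange, WeierstrassCurve.map, map_zero, map_neg,
    map_one]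
  constructor <;> intro h <;> linear_combination h

theorem onW_of_mem_line {P : Proj 2} (hP : P ∈ weierSet weierE) {v : Fin 3 → ℂ}
    (hv : v ∈ line P) : OnW v := by
  obtain ⟨c, rfl⟩ := mem_line_iff.1 hv
  have h := mem_weierSet_iff.1 hP
  simp only [OnW, Pi.smul_apply, smul_eq_mul] at h ⊢
  linear_combination c ^ 3 * h

theorem mem_weierSet_of_onW {P : Proj 2} {v : Fin 3 → ℂ} (h0 : v ≠ 0) (hv : v ∈ line P)
    (h : OnW v) : P ∈ weierSet weierE := by
  obtain ⟨c, rfl⟩ := mem_line_iff.1 hv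
  have hc : c ^ 3 ≠ 0 := pow_ne_zero _ fun hc => h0 (by rw [hc, zero_smul])
  rw [mem_weierSet_iff]
  simp only [OnW, Pi.smul_apply, smul_eq_mul] at h ⊢
  refine mul_left_cancel₀ hc ?_
  linear_combination h

theorem weierE_isElliptic : weierE.IsElliptic := by
  rw [WeierstrassCurve.isElliptic_iff]
  simp only [WeierstrassCurve.Δ, WeierstrassCurve.b₂, WeierstrassCurve.b₄, WeierstrassCurve.b₆,
    WeierstrassCurve.b₈, weierE]
  norm_num

theorem vec3_eq_zero {v : Fin 3 → ℂ} (h0 : v 0 = 0) (h1 : v 1 = 0) (h2 : v 2 = 0) : v = 0 := by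
  funext i
  fin_cases i <;> assumption

theorem vec4_eq_zero {v : Fin 4 → ℂ} (h0 : v 0 = 0) (h1 : v 1 = 0) (h2 : v 2 = 0)
    (h3 : v 3 = 0) : v = 0 := by
  funext i
  fin_cases i <;> assumption

/-- The map `E → ℙ²`: projection from the point `[1, 1, 1, 0]`, and a second representation that
is valid at this point. -/
def toWeier {R : Type} [CommRing R] : Bool → (Fin 4 → R) → Fin 3 → R
  | true, v => ![v 1 - v 0, 2 * v 3, v 0 + v 1 - 2 * v 2]
  | false, v => ![-v 3 * (v 0 + v 1 + 2 * v 2), (v 0 + v 1) * (v 0 + v 1 + 2 * v 2),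
      -(v 0 - v 1) * v 3]

/-- The inverse map from the Weierstrass curve to `E`, in two representations, the second of which
is valid at the point at infinity. -/
def ofWeier {R : Type} [CommRing R] : Bool → (Fin 3 → R) → Fin 4 → R
  | true, w => ![w 0 ^ 2 + 2 * w 0 * w 2 - w 2 ^ 2, w 0 ^ 2 - 2 * w 0 * w 2 - w 2 ^ 2,
      w 0 ^ 2 + w 2 ^ 2, -2 * w 1 * w 2]
  | false, w =>
    ![(w 1 ^ 2 + w 0 * w 2) ^ 2 + 2 * w 0 ^ 2 * (w 1 ^ 2 + w 0 * w 2) - w 0 ^ 4,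
      (w 1 ^ 2 + w 0 * w 2) ^ 2 - 2 * w 0 ^ 2 * (w 1 ^ 2 + w 0 * w 2) - w 0 ^ 4,
      (w 1 ^ 2 + w 0 * w 2) ^ 2 + w 0 ^ 4, -2 * w 0 * w 1 * (w 1 ^ 2 + w 0 * w 2)]

theorem map_toWeier {R S : Type} [CommRing R] [CommRing S] (f : R →+* S) (b : Bool)
    (v : Fin 4 → R) (l : Fin 3) : f (toWeier b v l) = toWeier b (f ∘ v) l := by
  cases b <;> fin_cases l <;> simp [toWeier, map_ofNat f 2]

theorem map_ofWeier {R S : Type} [CommRing R] [CommRing S] (f : R →+* S) (b : Bool)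
    (v : Fin 3 → R) (l : Fin 4) : f (ofWeier b v l) = ofWeier b (f ∘ v) l := by
  cases b <;> fin_cases l <;> simp [ofWeier, map_ofNat f 2]

theorem onW_toWeier {v : Fin 4 → ℂ} (h : OnE v) (b : Bool) : OnW (toWeier b v) := by
  obtain ⟨h1, h2⟩ := h
  cases b <;> simp [OnW, toWeier] <;> grind

theorem toWeier_minor {v : Fin 4 → ℂ} (h : OnE v) (i j : Fin 3) :
    toWeier true v i * toWeier false v j = toWeier true v j * toWeier false v i := by
  obtain ⟨h1, h2⟩ := h
  fin_cases i <;> fin_cases j <;> simp [toWeier] <;> grind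

theorem toWeier_ne_zero {v : Fin 4 → ℂ} (h : OnE v) (hv : v ≠ 0) : ∃ b, toWeier b v ≠ 0 := by
  by_contra! h0
  apply hv
  obtain ⟨h1, h2⟩ := h
  have e0 := congrFun (h0 true) 0
  have e1 := congrFun (h0 true) 1
  have e2 := congrFun (h0 true) 2
  have e3 := congrFun (h0 false) 1
  simp [toWeier] at e0 e1 e2 e3
  apply vec4_eq_zero <;> grind

theorem onE_ofWeier {w : Fin 3 → ℂ} (h : OnW w) (b : Bool) : OnE (ofWeier b w) := by
  rw [OnW] at h
  cases b <;> constructor <;> simp [ofWeier] <;> grind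

theorem ofWeier_minor {w : Fin 3 → ℂ} (h : OnW w) (i j : Fin 4) :
    ofWeier true w i * ofWeier false w j = ofWeier true w j * ofWeier false w i := by
  rw [OnW] at h
  fin_cases i <;> fin_cases j <;> simp [ofWeier] <;> grind

theorem ofWeier_ne_zero {w : Fin 3 → ℂ} (h : OnW w) (hw : w ≠ 0) : ∃ b, ofWeier b w ≠ 0 := by
  by_contra! h0
  apply hw
  rw [OnW] at h
  have e0 := congrFun (h0 true) 0
  have e1 := congrFun (h0 true) 1
  have e2 := congrFun (h0 true) 2
  have e3 := congrFun (h0 false) 2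
  simp [ofWeier] at e0 e1 e2 e3
  apply vec3_eq_zero <;> grind

theorem ofWeier_toWeier {v : Fin 4 → ℂ} (h : OnE v) (i j : Fin 4) :
    ofWeier true (toWeier true v) i * v j = ofWeier true (toWeier true v) j * v i := by
  obtain ⟨h1, h2⟩ := h
  fin_cases i <;> fin_cases j <;> simp [ofWeier, toWeier] <;> grind

theorem toWeier_ofWeier (w : Fin 3 → ℂ) :
    toWeier true (ofWeier true w) = (-4 * w 2) • w := by
  funext i
  fin_cases i <;> simp [ofWeier, toWeier] <;> ring

/-- The two representations `toWeier` glue to a regular map from `E` to the Weierstrass curve. -/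
theorem exists_toWeier_map : ∃ f : curveE → weierSet weierE,
    (∀ (P : curveE) (v : Fin 4 → ℂ), v ≠ 0 → v ∈ line P.1 → ∀ b, toWeier b v ∈ line (f P).1) ∧
      ∀ k, IsRegularMap k f := by
  obtain ⟨f, hf, hreg⟩ := exists_map_of_forms (V := curveE) (W := weierSet weierE)
    (φ := fun b x => toWeier b fun j => x ⟨(), j⟩) (d := fun b _ => cond b 1 2)
    (fun b l => ⟨⟨toWeier b (fun j => X ⟨(), j⟩) l, fun x => by
        refine (map_toWeier (R := MvPolynomial (Coord fun _ : Unit => 3) ℤ) (S := ℂ)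
          (aeval x).toRingHom b _ l).trans ?_
        congr 1
        funext j
        exact aeval_X _ _⟩, fun c x => by
        cases b <;> fin_cases l <;> simp [toWeier, rescale] <;> ring⟩)
    (fun P hP => toWeier_ne_zero (onE_of_mem_line hP (crd_mem_line P)) (crd_ne_zero P))
    (fun P hP => toWeier_minor (onE_of_mem_line hP (crd_mem_line P)))
    (fun P hP b Q h0 hQ => mem_weierSet_of_onW h0 hQ
      (onW_toWeier (onE_of_mem_line hP (crd_mem_line P)) b))
  exact ⟨f, fun P v h0 hv b => hf P _ (isCoordOf_unit h0 hv) b, hreg⟩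

theorem exists_ofWeier_map : ∃ f : weierSet weierE → curveE,
    (∀ (P : weierSet weierE) (v : Fin 3 → ℂ), v ≠ 0 → v ∈ line P.1 →
      ∀ b, ofWeier b v ∈ line (f P).1) ∧ ∀ k, IsRegularMap k f := by
  obtain ⟨f, hf, hreg⟩ := exists_map_of_forms (V := weierSet weierE) (W := curveE)
    (φ := fun b x => ofWeier b fun j => x ⟨(), j⟩) (d := fun b _ => cond b 2 4)
    (fun b l => ⟨⟨ofWeier b (fun j => X ⟨(), j⟩) l, fun x => by
        refine (map_ofWeier (R := MvPolynomial (Coord fun _ : Unit => 2) ℤ) (S := ℂ)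
          (aeval x).toRingHom b _ l).trans ?_
        congr 1
        funext j
        exact aeval_X _ _⟩, fun c x => by
        cases b <;> fin_cases l <;> simp [ofWeier, rescale] <;> ring⟩)
    (fun P hP => ofWeier_ne_zero (onW_of_mem_line hP (crd_mem_line P)) (crd_ne_zero P))
    (fun P hP => ofWeier_minor (onW_of_mem_line hP (crd_mem_line P)))
    (fun P hP b Q h0 hQ => mem_curveE_of_onE h0 hQ
      (onE_ofWeier (onW_of_mem_line hP (crd_mem_line P)) b))
  exact ⟨f, fun P v h0 hv b => hf P _ (isCoordOf_unit h0 hv) b, hreg⟩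

theorem exists_weierIso :
    ∃ e : curveE ≃ weierSet weierE, ∀ k, IsIsoOver k e := by
  obtain ⟨f, hf, hfreg⟩ := exists_toWeier_map
  obtain ⟨g, hg, hgreg⟩ := exists_ofWeier_map
  have hgf : ∀ P, g (f P) = P := by
    intro P
    have hP := onE_of_mem_line P.2 (crd_mem_line P.1)
    have hP0 := crd_ne_zero P.1
    set v := crd P.1 with hv
    have hvP : v ∈ line P.1 := crd_mem_line P.1
    apply Subtype.ext
    by_cases h0 : ofWeier true (toWeier true v) = 0
    · -- this happens only at the point `[1, 1, 1, 0]`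
      obtain ⟨h1, h2⟩ := hP
      have e0 := congrFun h0 0
      have e1 := congrFun h0 1
      have e2 := congrFun h0 2
      simp [ofWeier, toWeier] at e0 e1 e2
      have k0 : v 0 = v 2 := by grind
      have k1 : v 1 = v 2 := by grind
      have k3 : v 3 = 0 := by grind
      have k2 : v 2 ≠ 0 := fun h => hP0 (vec4_eq_zero (k0.trans h) (k1.trans h) h k3)
      have ht : toWeier false v = ![0, 8 * v 2 ^ 2, 0] := by
        funext i
        fin_cases i <;> simp [toWeier, k0, k1, k3]
        ring
      have ht0 : toWeier false v ≠ 0 := fun h => by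
        have := congrFun h 1
        rw [ht] at this
        simp [k2] at this
      refine eq_of_minors (hg _ _ ht0 (hf P v hP0 hvP false) false) hvP ?_ hP0 fun i j => ?_
      · intro h
        have := congrFun h 2
        rw [ht] at this
        simp [ofWeier, k2] at this
      · rw [ht]
        fin_cases i <;> fin_cases j <;> simp [ofWeier, k0, k1, k3]
    · have ht0 : toWeier true v ≠ 0 := fun h => h0 (by
        rw [h]
        funext i
        fin_cases i <;> simp [ofWeier])
      exact eq_of_minors (hg _ _ ht0 (hf P v hP0 hvP true) true) hvP h0 hP0 (ofWeier_toWeier hP)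
  have hfg : ∀ Q, f (g Q) = Q := by
    intro Q
    have hQ := onW_of_mem_line Q.2 (crd_mem_line Q.1)
    have hQ0 := crd_ne_zero Q.1
    set w := crd Q.1 with hw
    have hwQ : w ∈ line Q.1 := crd_mem_line Q.1
    apply Subtype.ext
    by_cases h2 : w 2 = 0
    · -- the point at infinity
      have k0 : w 0 = 0 := by
        rw [OnW, h2] at hQ
        simpa using hQ.symm
      have k1 : w 1 ≠ 0 := fun h => hQ0 (vec3_eq_zero k0 h h2)
      have ht : ofWeier false w = ![w 1 ^ 4, w 1 ^ 4, w 1 ^ 4, 0] := by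
        funext i
        fin_cases i <;> simp [ofWeier, k0, h2, ← pow_mul]
      have ht0 : ofWeier false w ≠ 0 := fun h => by
        have := congrFun h 0
        rw [ht] at this
        simp [k1] at this
      refine eq_of_minors (hf _ _ ht0 (hg Q w hQ0 hwQ false) false) hwQ ?_ hQ0 fun i j => ?_
      · intro h
        have := congrFun h 1
        rw [ht] at this
        simp [toWeier] at this
        exact k1 (by grind)
      · rw [ht]
        fin_cases i <;> fin_cases j <;> simp [toWeier, k0, h2]
    · have hne : toWeier true (ofWeier true w) ≠ 0 := by
        rw [toWeier_ofWeier]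
        exact smul_ne_zero (mul_ne_zero (by norm_num) h2) hQ0
      have ht0 : ofWeier true w ≠ 0 := fun h => hne (by
        rw [h]
        funext i
        fin_cases i <;> simp [toWeier])
      refine eq_of_minors (hf _ _ ht0 (hg Q w hQ0 hwQ true) true) hwQ hne hQ0 fun i j => ?_
      rw [toWeier_ofWeier, Pi.smul_apply, Pi.smul_apply, smul_eq_mul, smul_eq_mul]
      ring
  exact ⟨⟨f, g, hgf, hfg⟩, fun k => ⟨hfreg k, hgreg k⟩⟩

/-! ### Irreducibility of the curve -/

/-- On the affine curve `y² = x³ - x` every polynomial function has the form `p(x) + q(x) y`. -/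
theorem exists_affine_restriction {k : IntermediateField ℚ ℂ}
    (F : MvPolynomial (Coord fun _ : Unit => 2) k) :
    ∃ p q : Polynomial ℂ, ∀ x y : ℂ, y ^ 2 = x ^ 3 - x →
      aeval (fun a => ![x, y, 1] a.2) F = p.eval x + q.eval x * y := by
  induction F using MvPolynomial.induction_on with
  | C a => exact ⟨Polynomial.C (a : ℂ), 0, fun x y _ => by simp⟩
  | add F G hF hG =>
    obtain ⟨p, q, h⟩ := hF
    obtain ⟨p', q', h'⟩ := hG
    refine ⟨p + p', q + q', fun x y hxy => ?_⟩
    rw [map_add, h x y hxy, h' x y hxy, Polynomial.eval_add, Polynomial.eval_add]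
    ring
  | mul_X F a hF =>
    obtain ⟨p, q, h⟩ := hF
    obtain ⟨⟨⟩, j⟩ := a
    fin_cases j
    · refine ⟨p * Polynomial.X, q * Polynomial.X, fun x y hxy => ?_⟩
      simp [h x y hxy]
      ring
    · refine ⟨q * (Polynomial.X ^ 3 - Polynomial.X), p, fun x y hxy => ?_⟩
      simp [h x y hxy]
      linear_combination q.eval x * hxy
    · refine ⟨p, q, fun x y hxy => ?_⟩
      simp [h x y hxy]

/-- `x³ - x` has odd degree, hence is not a square in the field of rational functions. -/
theorem eq_zero_of_sq_eq {p q : Polynomial ℂ}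
    (h : p ^ 2 = q ^ 2 * (Polynomial.X ^ 3 - Polynomial.X)) : p = 0 ∧ q = 0 := by
  have hdeg : (Polynomial.X ^ 3 - Polynomial.X : Polynomial ℂ).natDegree = 3 := by
    compute_degree!
  have hne : (Polynomial.X ^ 3 - Polynomial.X : Polynomial ℂ) ≠ 0 := fun h0 => by
    rw [h0] at hdeg
    simp at hdeg
  have hq : q = 0 := by
    by_contra hq
    have := congrArg Polynomial.natDegree h
    rw [Polynomial.natDegree_mul (pow_ne_zero _ hq) hne, Polynomial.natDegree_pow,
      Polynomial.natDegree_pow, hdeg] at this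
    omega
  refine ⟨?_, hq⟩
  rw [hq] at h
  simpa using h

theorem eq_zero_of_eval {p : Polynomial ℂ} (h : ∀ x, p.eval x = 0) : p = 0 :=
  Polynomial.funext fun x => by rw [h, Polynomial.eval_zero]

/-- A product of two functions `p + q y` on the affine curve vanishes only if one factor does. -/
theorem affine_integral {p q p' q' : Polynomial ℂ}
    (h : ∀ x y : ℂ, y ^ 2 = x ^ 3 - x →
      (p.eval x + q.eval x * y) * (p'.eval x + q'.eval x * y) = 0) :
    (p = 0 ∧ q = 0) ∨ (p' = 0 ∧ q' = 0) := by
  have hnorm : (p ^ 2 - q ^ 2 * (Polynomial.X ^ 3 - Polynomial.X)) *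
      (p' ^ 2 - q' ^ 2 * (Polynomial.X ^ 3 - Polynomial.X)) = 0 := by
    refine eq_zero_of_eval fun x => ?_
    obtain ⟨y, hy⟩ := IsAlgClosed.exists_pow_nat_eq (x ^ 3 - x) (n := 2) (by norm_num)
    have h1 := h x y hy
    simp only [Polynomial.eval_mul, Polynomial.eval_sub, Polynomial.eval_pow, Polynomial.eval_X,
      ← hy]
    linear_combination ((p.eval x - q.eval x * y) * (p'.eval x - q'.eval x * y)) * h1
  rcases mul_eq_zero.1 hnorm with h1 | h1
  · exact Or.inl (eq_zero_of_sq_eq (sub_eq_zero.1 h1))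
  · exact Or.inr (eq_zero_of_sq_eq (sub_eq_zero.1 h1))

theorem isCoordOf_crd {N : ℕ} {P : Proj N} : (fun a : Coord fun _ : Unit => N => crd P a.2) =
    homCoord P := rfl

/-- A form that vanishes on the affine curve also vanishes at the point at infinity. -/
theorem aeval_infinity_eq_zero {k : IntermediateField ℚ ℂ}
    {F : MvPolynomial (Coord fun _ : Unit => 2) k} {d : Unit → ℕ} (hF : IsMultiHom F d)
    (h : ∀ x y : ℂ, y ^ 2 = x ^ 3 - x → aeval (fun a => ![x, y, 1] a.2) F = 0) :
    aeval (fun a => (![0, 1, 0] : Fin 3 → ℂ) a.2) F = 0 := by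
  -- the branch `t ↦ (t, 1, z t)` of the curve at infinity
  set s : ℝ → ℝ := fun t => 1 + Real.sqrt (1 + 4 * t ^ 4) with hs
  have hspos : ∀ t, s t ≠ 0 := fun t => by positivity
  set z : ℝ → ℂ := fun t => ((2 * t ^ 3 / s t : ℝ) : ℂ) with hz
  have hzcont : Continuous z := by
    refine Complex.continuous_ofReal.comp (Continuous.div (by fun_prop) (by fun_prop) hspos)
  have hzeq : ∀ t : ℝ, z t = (t : ℂ) ^ 3 - t * z t ^ 2 := by
    intro t
    have h1 : (Real.sqrt (1 + 4 * t ^ 4)) ^ 2 = 1 + 4 * t ^ 4 := Real.sq_sqrt (by positivity)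
    have h2 : 2 * t ^ 3 / s t = t ^ 3 - t * (2 * t ^ 3 / s t) ^ 2 := by
      have := hspos t
      field_simp
      simp only [hs]
      linear_combination (-t ^ 3) * h1
    simp only [hz]
    exact_mod_cast h2
  set G : ℝ → ℂ := fun t => aeval (fun a : Coord fun _ : Unit => 2 => ![(t : ℂ), 1, z t] a.2) F
    with hG
  have hGcont : Continuous G := by
    simp only [hG, aeval_eq_sum]
    refine continuous_finsetSum _ fun e _ => continuous_const.mul
      (continuous_finsetProd _ fun a _ => Continuous.pow ?_ _)
    obtain ⟨⟨⟩, j⟩ := a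
    fin_cases j
    · exact Complex.continuous_ofReal
    · exact continuous_const
    · exact hzcont
  have hG0 : ∀ t ∈ ({0}ᶜ : Set ℝ), G t = 0 := by
    intro t ht
    have ht' : (t : ℂ) ≠ 0 := by exact_mod_cast ht
    have hz0 : z t ≠ 0 := fun h0 => by
      have := hzeq t
      rw [h0] at this
      simp at this
      exact ht' (pow_eq_zero_iff (n := 3) (by norm_num) |>.1 this.symm)
    have h1 := h (t / z t) (1 / z t) (by
      field_simp
      linear_combination hzeq t)
    have h2 := hF.aeval_rescale (fun _ => z t) fun a => ![(t : ℂ) / z t, 1 / z t, 1] a.2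
    rw [h1, mul_zero] at h2
    refine Eq.trans (congrArg (fun x => aeval x F) (funext fun a => ?_)) h2
    obtain ⟨⟨⟩, j⟩ := a
    fin_cases j
    · exact (mul_div_cancel₀ _ hz0).symm
    · exact (mul_div_cancel₀ _ hz0).symm
    · exact (mul_one _).symm
  have hGz : G 0 = 0 := by
    have : G = fun _ => 0 := hGcont.ext_on (dense_compl_singleton 0) continuous_const hG0
    rw [this]
  simpa [hG, hz] using hGz

/-- Forms that do not vanish identically on the Weierstrass curve have affine nonzeros. -/
theorem exists_affine_ne_zero {k : IntermediateField ℚ ℂ}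
    {F : MvPolynomial (Coord fun _ : Unit => 2) k} {d : Unit → ℕ} (hF : IsMultiHom F d)
    (h : ∃ P ∈ weierSet weierE, evalAt F P ≠ 0) :
    ∃ x y : ℂ, y ^ 2 = x ^ 3 - x ∧ aeval (fun a => ![x, y, 1] a.2) F ≠ 0 := by
  by_contra! h0
  obtain ⟨P, hP, hne⟩ := h
  have hW := mem_weierSet_iff.1 hP
  rw [OnW] at hW
  have hP0 := crd_ne_zero P
  by_cases h2 : crd P 2 = 0
  · have k0 : crd P 0 = 0 := by
      rw [h2] at hW
      simpa using hW.symm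
    have h1 := hF.aeval_rescale (fun _ => crd P 1) fun a => (![0, 1, 0] : Fin 3 → ℂ) a.2
    rw [aeval_infinity_eq_zero hF h0, mul_zero] at h1
    apply hne
    rw [← h1, evalAt, ← isCoordOf_crd]
    congr 2
    funext a
    obtain ⟨⟨⟩, j⟩ := a
    fin_cases j <;> simp [rescale, k0, h2]
  · have h1 := hF.aeval_rescale (fun _ => crd P 2)
      fun a => ![crd P 0 / crd P 2, crd P 1 / crd P 2, 1] a.2
    rw [h0 _ _ (by field_simp; linear_combination hW), mul_zero] at h1
    apply hne
    rw [← h1, evalAt, ← isCoordOf_crd]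
    congr 2
    funext a
    obtain ⟨⟨⟩, j⟩ := a
    fin_cases j <;> simp [rescale] <;> field_simp

theorem exists_weier_point (x y : ℂ) (h : y ^ 2 = x ^ 3 - x) :
    ∃ P ∈ weierSet weierE, (![x, y, 1] : Fin 3 → ℂ) ∈ line P := by
  have h0 : (![x, y, 1] : Fin 3 → ℂ) ≠ 0 := fun h => one_ne_zero (congrFun h 2)
  refine ⟨mkPt _ h0, mem_weierSet_of_onW h0 (mkPt_mem_line _ h0) ?_, mkPt_mem_line _ h0⟩
  simpa [OnW] using h

theorem weierSet_irreducible : IsGeomIrreducible (weierSet weierE) := by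
  rw [isGeomIrreducible_iff]
  refine ⟨?_, fun F G d e hF hG hFne hGne => ?_⟩
  · obtain ⟨P, hP, -⟩ := exists_weier_point 0 0 (by norm_num)
    exact ⟨P, hP⟩
  by_contra! hcon
  obtain ⟨p, q, hpq⟩ := exists_affine_restriction F
  obtain ⟨p', q', hpq'⟩ := exists_affine_restriction G
  obtain ⟨x, y, hxy, hx⟩ := exists_affine_ne_zero hF hFne
  obtain ⟨x', y', hxy', hx'⟩ := exists_affine_ne_zero hG hGne
  rcases affine_integral (p := p) (q := q) (p' := p') (q' := q') fun x y hxy => by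
    rw [← hpq x y hxy, ← hpq' x y hxy]
    obtain ⟨P, hP, hline⟩ := exists_weier_point x y hxy
    have hc := isCoordOf_unit (fun h => one_ne_zero (congrFun h 2)) hline
    by_cases h0 : evalAt F P = 0
    · rw [(hF.aeval_eq hc).2 h0, zero_mul]
    · rw [(hG.aeval_eq hc).2 (hcon P hP h0), mul_zero] with ⟨rfl, rfl⟩ | ⟨rfl, rfl⟩
  · exact hx (by simp [hpq x y hxy])
  · exact hx' (by simp [hpq' x' y' hxy'])

theorem curveE_irreducible : IsGeomIrreducible curveE := by
  obtain ⟨e, he⟩ := exists_weierIso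
  exact weierSet_irreducible.of_surjective (he ⊤).2 e.symm.surjective

/-! ### The group law of the curve -/

/-- Two biquadratic addition laws on `E` with origin `[1, 1, 1, 0]`: the addition theorem of the
Jacobi functions `sn = d / c`, `cn = b / c`, `dn = a / c` of modulus `k² = -1`, and
a second one that does not vanish where the first one does. -/
def lawE {R : Type} [CommRing R] : Bool → (Fin 4 → R) → (Fin 4 → R) → Fin 4 → R
  | true, v, w =>
    ![v 0 * w 0 * v 2 * w 2 + v 3 * w 3 * v 1 * w 1, v 1 * w 1 * v 2 * w 2 - v 3 * w 3 * v 0 * w 0,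
      v 2 ^ 2 * w 2 ^ 2 + v 3 ^ 2 * w 3 ^ 2, v 3 * v 2 * w 0 * w 1 + w 3 * w 2 * v 0 * v 1]
  | false, v, w =>
    ![v 3 * v 0 * w 1 * w 2 - w 3 * w 0 * v 1 * v 2, v 3 * v 1 * w 0 * w 2 - w 3 * w 1 * v 0 * v 2,
      v 3 * v 2 * w 0 * w 1 - w 3 * w 2 * v 0 * v 1, v 3 ^ 2 * w 2 ^ 2 - w 3 ^ 2 * v 2 ^ 2]

theorem map_lawE {R S : Type} [CommRing R] [CommRing S] (f : R →+* S) (b : Bool)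
    (v w : Fin 4 → R) (l : Fin 4) : f (lawE b v w l) = lawE b (f ∘ v) (f ∘ w) l := by
  cases b <;> fin_cases l <;> simp [lawE]

theorem lawE_smul {R : Type} [CommRing R] (b : Bool) (s t : R) (v w : Fin 4 → R) :
    lawE b (s • v) (t • w) = (s ^ 2 * t ^ 2) • lawE b v w := by
  funext l
  cases b <;> fin_cases l <;> simp [lawE] <;> ring

theorem onE_lawE {v w : Fin 4 → ℂ} (hv : OnE v) (hw : OnE w) (b : Bool) : OnE (lawE b v w) := by
  obtain ⟨h1, h2⟩ := hv
  obtain ⟨h3, h4⟩ := hw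
  cases b <;> constructor <;> simp [lawE] <;> grind

theorem lawE_minor {v w : Fin 4 → ℂ} (hv : OnE v) (hw : OnE w) (i j : Fin 4) :
    lawE true v w i * lawE false v w j = lawE true v w j * lawE false v w i := by
  obtain ⟨h1, h2⟩ := hv
  obtain ⟨h3, h4⟩ := hw
  fin_cases i <;> fin_cases j <;> simp [lawE] <;> grind

theorem OnE.tail_ne_zero {v : Fin 4 → ℂ} (h : OnE v) (hv : v ≠ 0) : v 2 ≠ 0 ∨ v 3 ≠ 0 := by
  by_contra! h0
  obtain ⟨h1, h2⟩ := h
  refine hv (vec4_eq_zero ?_ ?_ h0.1 h0.2) <;> grind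

theorem lawE_ne_zero {v w : Fin 4 → ℂ} (hv : OnE v) (hw : OnE w) (hv0 : v ≠ 0) (hw0 : w ≠ 0) :
    ∃ b, lawE b v w ≠ 0 := by
  by_contra! h0
  have k1 := hv.tail_ne_zero hv0
  have k2 := hw.tail_ne_zero hw0
  obtain ⟨h1, h2⟩ := hv
  obtain ⟨h3, h4⟩ := hw
  have e1 := congrFun (h0 true) 2
  have e2 := congrFun (h0 true) 3
  have e3 := congrFun (h0 false) 2
  have e4 := congrFun (h0 false) 3
  simp [lawE] at e1 e2 e3 e4
  clear h0 hv0 hw0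
  by_cases hc : v 2 = 0
  · grind
  · have : w 2 = 0 := by grind
    grind

/-- The coordinate vector of a pair of points. -/
def pairCoord {ι κ : Type} {n : ι → ℕ} {m : κ → ℕ} (x : Coord n → ℂ) (y : Coord m → ℂ) :
    Coord (Sum.elim n m) → ℂ := fun
  | ⟨Sum.inl i, a⟩ => x ⟨i, a⟩
  | ⟨Sum.inr j, a⟩ => y ⟨j, a⟩

theorem isCoordOf_pair {ι κ : Type} {n : ι → ℕ} {m : κ → ℕ} {V : Set (MultiProj n)}
    {W : Set (MultiProj m)} {p : V} {q : W} {x : Coord n → ℂ} {y : Coord m → ℂ}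
    (hx : IsCoordOf x p.1) (hy : IsCoordOf y q.1) :
    IsCoordOf (pairCoord x y) ((prodVarEquiv V W).symm (p, q)).1 := by
  rw [isCoordOf_iff] at *
  rintro (i | j)
  · exact hx i
  · exact hy j

theorem exists_addition : ∃ f : surfEE → curveE,
    (∀ (P Q : curveE) (v w : Fin 4 → ℂ), v ≠ 0 → v ∈ line P.1 → w ≠ 0 → w ∈ line Q.1 →
      ∀ b, lawE b v w ∈ line (f ((prodVarEquiv _ _).symm (P, Q))).1) ∧ ∀ k, IsRegularMap k f := by
  have hcrd : ∀ p ∈ surfEE, (OnE fun j => homCoord p ⟨Sum.inl (), j⟩) ∧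
      (OnE fun j => homCoord p ⟨Sum.inr (), j⟩) ∧ (fun j => homCoord p ⟨Sum.inl (), j⟩) ≠ 0 ∧
      (fun j => homCoord p ⟨Sum.inr (), j⟩) ≠ 0 := fun p hp =>
    ⟨onE_of_mem_line hp.1 (crd_mem_line _), onE_of_mem_line hp.2 (crd_mem_line _),
      (p (Sum.inl ())).rep_nonzero, (p (Sum.inr ())).rep_nonzero⟩
  obtain ⟨f, hf, hreg⟩ := exists_map_of_forms (V := surfEE) (W := curveE)
    (φ := fun b x => lawE b (fun j => x ⟨Sum.inl (), j⟩) fun j => x ⟨Sum.inr (), j⟩)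
    (d := fun _ _ => 2)
    (fun b l => ⟨⟨lawE b (fun j => X ⟨Sum.inl (), j⟩) (fun j => X ⟨Sum.inr (), j⟩) l, fun x => by
        refine (map_lawE (R := MvPolynomial (Coord _) ℤ) (S := ℂ)
          (aeval x).toRingHom b _ _ l).trans ?_
        congr 1 <;> funext j <;> exact aeval_X _ _⟩, fun c x => by
        refine (congrFun (lawE_smul b (c (Sum.inl ())) (c (Sum.inr ())) _ _) l).trans ?_
        simp [Fintype.prod_sum_type]⟩)
    (fun p hp => by
      obtain ⟨h1, h2, h3, h4⟩ := hcrd p hp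
      exact lawE_ne_zero h1 h2 h3 h4)
    (fun p hp => lawE_minor (hcrd p hp).1 (hcrd p hp).2.1)
    (fun p hp b Q h0 hQ => mem_curveE_of_onE h0 hQ
      (onE_lawE (hcrd p hp).1 (hcrd p hp).2.1 b))
  exact ⟨f, fun P Q v w hv hvP hw hwQ b =>
    hf _ _ (isCoordOf_pair (isCoordOf_unit hv hvP) (isCoordOf_unit hw hwQ)) b, hreg⟩

/-- Addition on `E` with origin `[1, 1, 1, 0]`. -/
def curveAdd (P Q : curveE) : curveE :=
  exists_addition.choose ((prodVarEquiv _ _).symm (P, Q))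

theorem lawE_mem_line {P Q : curveE} {v w : Fin 4 → ℂ} (hv : v ≠ 0) (hvP : v ∈ line P.1)
    (hw : w ≠ 0) (hwQ : w ∈ line Q.1) (b : Bool) : lawE b v w ∈ line (curveAdd P Q).1 :=
  exists_addition.choose_spec.1 P Q v w hv hvP hw hwQ b

theorem curveAdd_regular (k : IntermediateField ℚ ℂ) : IsRegularMap k
    (fun p : surfEE => curveAdd (prodVarEquiv _ _ p).1 (prodVarEquiv _ _ p).2) := by
  have h : (fun p : surfEE => curveAdd (prodVarEquiv _ _ p).1 (prodVarEquiv _ _ p).2) =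
      exists_addition.choose :=
    funext fun p => congrArg exists_addition.choose (Equiv.symm_apply_apply _ p)
  rw [h]
  exact exists_addition.choose_spec.2 k

/-- A sum is known as soon as both addition laws give multiples of a coordinate vector. -/
theorem curveAdd_eq {P Q R : curveE} {v w x : Fin 4 → ℂ} (hv : v ≠ 0) (hvP : v ∈ line P.1)
    (hw : w ≠ 0) (hwQ : w ∈ line Q.1) (hxR : x ∈ line R.1)
    (h : ∀ b, ∃ s : ℂ, lawE b v w = s • x) : curveAdd P Q = R := by
  obtain ⟨b, hb⟩ := lawE_ne_zero (onE_of_mem_line P.2 hvP) (onE_of_mem_line Q.2 hwQ) hv hw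
  obtain ⟨s, hs⟩ := h b
  refine Subtype.ext (eq_of_mem_line hb (lawE_mem_line hv hvP hw hwQ b) ?_)
  rw [hs]
  exact Submodule.smul_mem _ _ hxR

theorem curveAdd_comm (P Q : curveE) : curveAdd P Q = curveAdd Q P := by
  have hP := crd_mem_line P.1
  have hQ := crd_mem_line Q.1
  have hP0 := crd_ne_zero P.1
  have hQ0 := crd_ne_zero Q.1
  obtain ⟨b, hb⟩ := lawE_ne_zero (onE_of_mem_line P.2 hP) (onE_of_mem_line Q.2 hQ) hP0 hQ0
  have hsymm : lawE b (crd P.1) (crd Q.1) = (cond b 1 (-1) : ℂ) • lawE b (crd Q.1) (crd P.1) := by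
    funext i
    cases b <;> fin_cases i <;> simp [lawE] <;> ring
  refine Subtype.ext (eq_of_mem_line hb (lawE_mem_line hP0 hP hQ0 hQ b) ?_)
  rw [hsymm]
  exact Submodule.smul_mem _ _ (lawE_mem_line hQ0 hQ hP0 hP b)

/-- The point of `E` with given coordinates. -/
def curvePt (v : Fin 4 → ℂ) (h0 : v ≠ 0) (h : OnE v) : curveE :=
  ⟨mkPt v h0, mem_curveE_of_onE h0 (mkPt_mem_line v h0) h⟩

/-- The origin `[1, 1, 1, 0]`. -/
def curveZero : curveE :=
  curvePt ![1, 1, 1, 0] (fun h => one_ne_zero (congrFun h 0)) (by constructor <;> simp)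

theorem curveZero_line : ![1, 1, 1, 0] ∈ line curveZero.1 := mkPt_mem_line _ _

theorem vec_ne_zero_of_head {x y z : ℂ} : ![1, x, y, z] ≠ 0 :=
  fun h => one_ne_zero (congrFun h 0)

theorem curveZero_add (P : curveE) : curveAdd curveZero P = P := by
  refine curveAdd_eq vec_ne_zero_of_head curveZero_line (crd_ne_zero P.1) (crd_mem_line P.1)
    (crd_mem_line P.1) fun b => ⟨cond b (crd P.1 2) (-crd P.1 3), ?_⟩
  funext i
  cases b <;> fin_cases i <;> simp [lawE] <;> ring

/-- Sign changes of coordinates on the lines of coordinate vectors. -/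
theorem signed_mem_line {ε : Fin 4 → ℤˣ} {P : curveE} {v : Fin 4 → ℂ} (hv : v ∈ line P.1) :
    (fun j => ((ε j : ℤ) : ℂ) * v j) ∈ line (curveSign ε P).1 := by
  obtain ⟨c, rfl⟩ := mem_line_iff.1 hv
  obtain ⟨c', hc', h⟩ := crd_signPerm ε P.1
  refine mem_line_iff.2 ⟨c / c', ?_⟩
  funext j
  change _ = (c / c') * crd (signPerm ε P.1) j
  rw [h, Pi.smul_apply, smul_eq_mul]
  field_simp

theorem curveNeg_line {P : curveE} {v : Fin 4 → ℂ} (hv : v ∈ line P.1) :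
    ![v 0, v 1, v 2, -v 3] ∈ line (curveSign ![1, 1, 1, -1] P).1 := by
  convert signed_mem_line (ε := ![1, 1, 1, -1]) hv using 1
  funext j
  fin_cases j <;> simp

theorem tau_line {P : curveE} {v : Fin 4 → ℂ} (hv : v ∈ line P.1) :
    ![v 0, -v 1, v 2, v 3] ∈ line (tau P).1 := by
  change _ ∈ line (curveSign ![1, -1, 1, 1] P).1
  convert signed_mem_line (ε := ![1, -1, 1, 1]) hv using 1
  funext j
  fin_cases j <;> simp

theorem rho_line {P : curveE} {v : Fin 4 → ℂ} (hv : v ∈ line P.1) :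
    ![v 0, v 1, -v 2, -v 3] ∈ line (rho P).1 := by
  change _ ∈ line (curveSign ![1, 1, -1, -1] P).1
  convert signed_mem_line (ε := ![1, 1, -1, -1]) hv using 1
  funext j
  fin_cases j <;> simp

theorem curveNeg_add (P : curveE) : curveAdd (curveSign ![1, 1, 1, -1] P) P = curveZero := by
  have hP := onE_of_mem_line P.2 (crd_mem_line P.1)
  have hP0 := crd_ne_zero P.1
  have hne : ![crd P.1 0, crd P.1 1, crd P.1 2, -crd P.1 3] ≠ 0 := fun h => hP0 (by
    have e0 := congrFun h 0
    have e1 := congrFun h 1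
    have e2 := congrFun h 2
    have e3 := congrFun h 3
    simp at e0 e1 e2 e3
    exact vec4_eq_zero e0 e1 e2 e3)
  set v := crd P.1 with hv
  refine curveAdd_eq hne (curveNeg_line (crd_mem_line P.1)) hP0 (crd_mem_line P.1)
    curveZero_line fun b => ⟨cond b (v 2 ^ 4 + v 3 ^ 4) (-2 * v 0 * v 1 * v 2 * v 3), ?_⟩
  obtain ⟨h1, h2⟩ := hP
  funext i
  cases b <;> fin_cases i <;> simp [lawE] <;> grind

section Associativity

variable {v w u : Fin 4 → ℂ}

/-! The coordinates of a threefold sum, sorted by the last argument and with the squares of the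
first two coordinates eliminated. -/

theorem lawE_lawE_two (hv : OnE v) (hw : OnE w) (u : Fin 4 → ℂ) :
    lawE true (lawE true v w) u 2 =
      u 2 ^ 2 * (w 2 ^ 2 * v 2 ^ 2 + w 3 ^ 2 * v 3 ^ 2) ^ 2 +
      u 3 ^ 2 * (w 3 ^ 2 * w 2 ^ 2 * (v 2 ^ 4 - v 3 ^ 4) + v 3 ^ 2 * v 2 ^ 2 * (w 2 ^ 4 - w 3 ^ 4) +
        2 * w 2 * w 3 * v 2 * v 3 * w 0 * w 1 * v 0 * v 1) := by
  obtain ⟨h1, h2⟩ := hv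
  obtain ⟨h3, h4⟩ := hw
  simp [lawE]
  grind

theorem lawE_lawE_three (hv : OnE v) (hw : OnE w) (u : Fin 4 → ℂ) :
    lawE true (lawE true v w) u 3 =
      (v 3 * v 2 * w 0 * w 1 + w 3 * w 2 * v 0 * v 1) *
        (v 2 ^ 2 * w 2 ^ 2 + v 3 ^ 2 * w 3 ^ 2) * (u 0 * u 1) +
      u 3 * u 2 * (v 0 * v 1 * (w 0 * w 1) * (v 2 ^ 2 * w 2 ^ 2 - v 3 ^ 2 * w 3 ^ 2) -
        2 * v 2 * w 2 * v 3 * w 3 * (v 2 ^ 2 * w 3 ^ 2 + v 3 ^ 2 * w 2 ^ 2)) := by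
  obtain ⟨h1, h2⟩ := hv
  obtain ⟨h3, h4⟩ := hw
  simp [lawE]
  grind

theorem lawE_lawE_zero (hv : OnE v) (hw : OnE w) (u : Fin 4 → ℂ) :
    lawE true (lawE true v w) u 0 =
      (v 2 ^ 2 * w 2 ^ 2 + v 3 ^ 2 * w 3 ^ 2) *
        (v 0 * w 0 * v 2 * w 2 + v 3 * w 3 * v 1 * w 1) * u 0 * u 2 +
      u 3 * u 1 *
        (w 0 * v 1 * v 3 * w 2 *
            (v 2 ^ 2 * w 2 ^ 2 - 2 * v 2 ^ 2 * w 3 ^ 2 - v 3 ^ 2 * w 3 ^ 2) +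
          v 0 * w 1 * w 3 * v 2 *
            (v 2 ^ 2 * w 2 ^ 2 - 2 * w 2 ^ 2 * v 3 ^ 2 - v 3 ^ 2 * w 3 ^ 2)) := by
  obtain ⟨h1, h2⟩ := hv
  obtain ⟨h3, h4⟩ := hw
  simp [lawE]
  grind

theorem lawE_lawE_one (hv : OnE v) (hw : OnE w) (u : Fin 4 → ℂ) :
    lawE true (lawE true v w) u 1 =
      (v 2 ^ 2 * w 2 ^ 2 + v 3 ^ 2 * w 3 ^ 2) *
        (v 1 * w 1 * v 2 * w 2 - v 3 * w 3 * v 0 * w 0) * u 1 * u 2 -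
      u 3 * u 0 *
        (v 0 * w 1 * v 3 * w 2 *
            (v 2 ^ 2 * w 2 ^ 2 + 2 * v 2 ^ 2 * w 3 ^ 2 - v 3 ^ 2 * w 3 ^ 2) +
          v 1 * w 0 * w 3 * v 2 *
            (v 2 ^ 2 * w 2 ^ 2 + 2 * w 2 ^ 2 * v 3 ^ 2 - v 3 ^ 2 * w 3 ^ 2)) := by
  obtain ⟨h1, h2⟩ := hv
  obtain ⟨h3, h4⟩ := hw
  simp [lawE]
  grind

/-- Associativity for the last two coordinates, with `eᵢ` for the product `aᵢ bᵢ`. -/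
theorem assoc_identity_three {c₁ d₁ e₁ c₂ d₂ e₂ c₃ d₃ e₃ : ℂ} (h₁ : e₁ ^ 2 = c₁ ^ 4 - d₁ ^ 4)
    (h₂ : e₂ ^ 2 = c₂ ^ 4 - d₂ ^ 4) (h₃ : e₃ ^ 2 = c₃ ^ 4 - d₃ ^ 4) :
    ((d₁ * c₁ * e₂ + d₂ * c₂ * e₁) * (c₁ ^ 2 * c₂ ^ 2 + d₁ ^ 2 * d₂ ^ 2) * e₃ +
      d₃ * c₃ * (e₁ * e₂ * (c₁ ^ 2 * c₂ ^ 2 - d₁ ^ 2 * d₂ ^ 2) -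
        2 * c₁ * c₂ * d₁ * d₂ * (c₁ ^ 2 * d₂ ^ 2 + d₁ ^ 2 * c₂ ^ 2))) *
    (c₁ ^ 2 * (c₂ ^ 2 * c₃ ^ 2 + d₂ ^ 2 * d₃ ^ 2) ^ 2 +
      d₁ ^ 2 * (d₂ ^ 2 * c₂ ^ 2 * (c₃ ^ 4 - d₃ ^ 4) + d₃ ^ 2 * c₃ ^ 2 * (c₂ ^ 4 - d₂ ^ 4) +
        2 * c₂ * d₂ * c₃ * d₃ * e₂ * e₃)) =
    ((d₃ * c₃ * e₂ + d₂ * c₂ * e₃) * (c₃ ^ 2 * c₂ ^ 2 + d₃ ^ 2 * d₂ ^ 2) * e₁ +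
      d₁ * c₁ * (e₃ * e₂ * (c₃ ^ 2 * c₂ ^ 2 - d₃ ^ 2 * d₂ ^ 2) -
        2 * c₃ * c₂ * d₃ * d₂ * (c₃ ^ 2 * d₂ ^ 2 + d₃ ^ 2 * c₂ ^ 2))) *
    (c₃ ^ 2 * (c₂ ^ 2 * c₁ ^ 2 + d₂ ^ 2 * d₁ ^ 2) ^ 2 +
      d₃ ^ 2 * (d₂ ^ 2 * c₂ ^ 2 * (c₁ ^ 4 - d₁ ^ 4) + d₁ ^ 2 * c₁ ^ 2 * (c₂ ^ 4 - d₂ ^ 4) +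
        2 * c₂ * d₂ * c₁ * d₁ * e₂ * e₁)) := by
  grind

theorem lawE_assoc_three (hv : OnE v) (hw : OnE w) (hu : OnE u) :
    lawE true (lawE true v w) u 3 * lawE true (lawE true u w) v 2 =
      lawE true (lawE true u w) v 3 * lawE true (lawE true v w) u 2 := by
  rw [lawE_lawE_three hv hw, lawE_lawE_three hu hw, lawE_lawE_two hv hw, lawE_lawE_two hu hw]
  have key : ∀ x : Fin 4 → ℂ, OnE x → (x 0 * x 1) ^ 2 = x 2 ^ 4 - x 3 ^ 4 := fun x hx => by
    rw [mul_pow, hx.1, hx.2]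
    ring
  linear_combination assoc_identity_three (key v hv) (key w hw) (key u hu)

/-- Comparison of the coefficients of the two sides of the associativity law, after the squares
of the `aᵢ` and `bᵢ` are eliminated. -/
theorem assoc_coeff {a₁ b₁ a₂ b₂ a₃ b₃ p₁ q₁ p₂ q₂ p₃ q₃ A B C D A' B' C' D' K K' M M' : ℂ}
    (ha₁ : a₁ ^ 2 = p₁) (hb₁ : b₁ ^ 2 = q₁) (ha₂ : a₂ ^ 2 = p₂) (hb₂ : b₂ ^ 2 = q₂)
    (ha₃ : a₃ ^ 2 = p₃) (hb₃ : b₃ ^ 2 = q₃)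
    (hA : A * K' + D * M' * (q₂ * q₃) = A' * K + D' * M * (q₂ * q₁))
    (hB : B * K' + C * M' * (p₂ * q₃) = D' * K + A' * M * (p₂ * p₁))
    (hC : C * K' + B * M' * (q₂ * p₃) = C' * K + B' * M * (q₂ * p₁))
    (hD : D * K' + A * M' * (p₂ * p₃) = B' * K + C' * M * (p₂ * q₁)) :
    (A * (a₁ * a₂ * a₃) + B * (b₁ * b₂ * a₃) + C * (b₁ * a₂ * b₃) + D * (a₁ * b₂ * b₃)) *
        (K' + M' * (a₂ * b₂ * a₃ * b₃)) =
      (A' * (a₃ * a₂ * a₁) + B' * (b₃ * b₂ * a₁) + C' * (b₃ * a₂ * b₁) + D' * (a₃ * b₂ * b₁)) *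
        (K + M * (a₂ * b₂ * a₁ * b₁)) := by
  subst ha₁ hb₁ ha₂ hb₂ ha₃ hb₃
  linear_combination (a₁ * a₂ * a₃) * hA + (b₁ * b₂ * a₃) * hB + (b₁ * a₂ * b₃) * hC +
    (a₁ * b₂ * b₃) * hD

theorem lawE_assoc_zero (hv : OnE v) (hw : OnE w) (hu : OnE u) :
    lawE true (lawE true v w) u 0 * lawE true (lawE true u w) v 2 =
      lawE true (lawE true u w) v 0 * lawE true (lawE true v w) u 2 := by
  rw [lawE_lawE_zero hv hw, lawE_lawE_zero hu hw, lawE_lawE_two hv hw, lawE_lawE_two hu hw]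
  linear_combination assoc_coeff hv.1 hv.2 hw.1 hw.2 hu.1 hu.2
    (A := (v 2 ^ 2 * w 2 ^ 2 + v 3 ^ 2 * w 3 ^ 2) * (v 2 * w 2 * u 2))
    (B := (v 2 ^ 2 * w 2 ^ 2 + v 3 ^ 2 * w 3 ^ 2) * (v 3 * w 3 * u 2))
    (C := (v 3 * u 3 * w 2) *
      (v 2 ^ 2 * w 2 ^ 2 - 2 * v 2 ^ 2 * w 3 ^ 2 - v 3 ^ 2 * w 3 ^ 2))
    (D := (u 3 * w 3 * v 2) *
      (v 2 ^ 2 * w 2 ^ 2 - 2 * w 2 ^ 2 * v 3 ^ 2 - v 3 ^ 2 * w 3 ^ 2))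
    (K := u 2 ^ 2 * (w 2 ^ 2 * v 2 ^ 2 + w 3 ^ 2 * v 3 ^ 2) ^ 2 + u 3 ^ 2 *
      (w 3 ^ 2 * w 2 ^ 2 * (v 2 ^ 4 - v 3 ^ 4) + v 3 ^ 2 * v 2 ^ 2 * (w 2 ^ 4 - w 3 ^ 4)))
    (M := u 3 ^ 2 * (2 * w 2 * w 3 * v 2 * v 3))
    (A' := (u 2 ^ 2 * w 2 ^ 2 + u 3 ^ 2 * w 3 ^ 2) * (v 2 * w 2 * u 2))
    (B' := (u 2 ^ 2 * w 2 ^ 2 + u 3 ^ 2 * w 3 ^ 2) * (u 3 * w 3 * v 2))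
    (C' := (v 3 * u 3 * w 2) *
      (u 2 ^ 2 * w 2 ^ 2 - 2 * u 2 ^ 2 * w 3 ^ 2 - u 3 ^ 2 * w 3 ^ 2))
    (D' := (v 3 * w 3 * u 2) *
      (u 2 ^ 2 * w 2 ^ 2 - 2 * w 2 ^ 2 * u 3 ^ 2 - u 3 ^ 2 * w 3 ^ 2))
    (K' := v 2 ^ 2 * (w 2 ^ 2 * u 2 ^ 2 + w 3 ^ 2 * u 3 ^ 2) ^ 2 + v 3 ^ 2 *
      (w 3 ^ 2 * w 2 ^ 2 * (u 2 ^ 4 - u 3 ^ 4) + u 3 ^ 2 * u 2 ^ 2 * (w 2 ^ 4 - w 3 ^ 4)))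
    (M' := v 3 ^ 2 * (2 * w 2 * w 3 * u 2 * u 3))
    (by ring) (by ring) (by ring) (by ring)

theorem lawE_assoc_one (hv : OnE v) (hw : OnE w) (hu : OnE u) :
    lawE true (lawE true v w) u 1 * lawE true (lawE true u w) v 2 =
      lawE true (lawE true u w) v 1 * lawE true (lawE true v w) u 2 := by
  rw [lawE_lawE_one hv hw, lawE_lawE_one hu hw, lawE_lawE_two hv hw, lawE_lawE_two hu hw]
  linear_combination assoc_coeff hv.2 hv.1 hw.2 hw.1 hu.2 hu.1
    (A := (v 2 ^ 2 * w 2 ^ 2 + v 3 ^ 2 * w 3 ^ 2) * (v 2 * w 2 * u 2))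
    (B := -(v 2 ^ 2 * w 2 ^ 2 + v 3 ^ 2 * w 3 ^ 2) * (v 3 * w 3 * u 2))
    (C := -(v 3 * u 3 * w 2) *
      (v 2 ^ 2 * w 2 ^ 2 + 2 * v 2 ^ 2 * w 3 ^ 2 - v 3 ^ 2 * w 3 ^ 2))
    (D := -(u 3 * w 3 * v 2) *
      (v 2 ^ 2 * w 2 ^ 2 + 2 * w 2 ^ 2 * v 3 ^ 2 - v 3 ^ 2 * w 3 ^ 2))
    (K := u 2 ^ 2 * (w 2 ^ 2 * v 2 ^ 2 + w 3 ^ 2 * v 3 ^ 2) ^ 2 + u 3 ^ 2 *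
      (w 3 ^ 2 * w 2 ^ 2 * (v 2 ^ 4 - v 3 ^ 4) + v 3 ^ 2 * v 2 ^ 2 * (w 2 ^ 4 - w 3 ^ 4)))
    (M := u 3 ^ 2 * (2 * w 2 * w 3 * v 2 * v 3))
    (A' := (u 2 ^ 2 * w 2 ^ 2 + u 3 ^ 2 * w 3 ^ 2) * (v 2 * w 2 * u 2))
    (B' := -(u 2 ^ 2 * w 2 ^ 2 + u 3 ^ 2 * w 3 ^ 2) * (u 3 * w 3 * v 2))
    (C' := -(v 3 * u 3 * w 2) *
      (u 2 ^ 2 * w 2 ^ 2 + 2 * u 2 ^ 2 * w 3 ^ 2 - u 3 ^ 2 * w 3 ^ 2))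
    (D' := -(v 3 * w 3 * u 2) *
      (u 2 ^ 2 * w 2 ^ 2 + 2 * w 2 ^ 2 * u 3 ^ 2 - u 3 ^ 2 * w 3 ^ 2))
    (K' := v 2 ^ 2 * (w 2 ^ 2 * u 2 ^ 2 + w 3 ^ 2 * u 3 ^ 2) ^ 2 + v 3 ^ 2 *
      (w 3 ^ 2 * w 2 ^ 2 * (u 2 ^ 4 - u 3 ^ 4) + u 3 ^ 2 * u 2 ^ 2 * (w 2 ^ 4 - w 3 ^ 4)))
    (M' := v 3 ^ 2 * (2 * w 2 * w 3 * u 2 * u 3))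
    (by ring) (by ring) (by ring) (by ring)

theorem lawE_comm_true (v w : Fin 4 → ℂ) : lawE true v w = lawE true w v := by
  funext i
  fin_cases i <;> simp [lawE] <;> ring

/-- Associativity of the first addition law, up to the common factor by which the two
representations differ. -/
theorem lawE_assoc (hv : OnE v) (hw : OnE w) (hu : OnE u) (i : Fin 4) :
    lawE true (lawE true v w) u i * lawE true v (lawE true w u) 2 =
      lawE true v (lawE true w u) i * lawE true (lawE true v w) u 2 := by
  rw [lawE_comm_true v (lawE true w u), lawE_comm_true w u]
  fin_cases i
  · exact lawE_assoc_zero hv hw hu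
  · exact lawE_assoc_one hv hw hu
  · exact mul_comm _ _
  · exact lawE_assoc_three hv hw hu

end Associativity

theorem minor_of_pivot {x y : Fin 4 → ℂ} {s : Fin 4} (h : ∀ i, x i * y s = y i * x s)
    (i j : Fin 4) : x i * y j * y s * x s = x j * y i * y s * x s := by
  linear_combination (y j * x s) * h i - (y i * x s) * h j

theorem lawE_ne_zero_left {v w : Fin 4 → ℂ} {i : Fin 4} (h : lawE true v w i ≠ 0) : v ≠ 0 := by
  rintro rfl
  fin_cases i <;> simp [lawE] at h

theorem lawE_ne_zero_right {v w : Fin 4 → ℂ} {i : Fin 4} (h : lawE true v w i ≠ 0) : w ≠ 0 := by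
  rintro rfl
  fin_cases i <;> simp [lawE] at h

theorem curveAdd_assoc_regular : IsRegularMap ⊤ (fun p : prodVar curveE surfEE =>
      curveAdd (curveAdd (prodVarEquiv _ _ p).1 (prodVarEquiv _ _ (prodVarEquiv _ _ p).2).1)
        (prodVarEquiv _ _ (prodVarEquiv _ _ p).2).2) ∧
    IsRegularMap ⊤ (fun p : prodVar curveE surfEE =>
      curveAdd (prodVarEquiv _ _ p).1 (curveAdd (prodVarEquiv _ _ (prodVarEquiv _ _ p).2).1
        (prodVarEquiv _ _ (prodVarEquiv _ _ p).2).2)) := by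
  have h1 : IsRegularMap ⊤ (fun p : prodVar curveE surfEE => (prodVarEquiv _ _ p).1) :=
    isRegularMap_fst
  have h2 : IsRegularMap ⊤ (fun p : prodVar curveE surfEE =>
      (prodVarEquiv _ _ (prodVarEquiv _ _ p).2).1) := isRegularMap_fst.comp isRegularMap_snd
  have h3 : IsRegularMap ⊤ (fun p : prodVar curveE surfEE =>
      (prodVarEquiv _ _ (prodVarEquiv _ _ p).2).2) := isRegularMap_snd.comp isRegularMap_snd
  exact ⟨(curveAdd_regular ⊤).comp (((curveAdd_regular ⊤).comp (h1.pair h2)).pair h3),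
    (curveAdd_regular ⊤).comp (h1.pair ((curveAdd_regular ⊤).comp (h2.pair h3)))⟩

theorem curveAdd_assoc (P Q R : curveE) :
    curveAdd (curveAdd P Q) R = curveAdd P (curveAdd Q R) := by
  -- the two sides agree where the first addition law is valid for all four sums
  obtain ⟨D, hD, hDe⟩ := IsIntForm.exists_form
    (n := Sum.elim (fun _ : Unit => 3) (Sum.elim (fun _ : Unit => 3) (fun _ : Unit => 3)))
    (d := Sum.elim (fun _ => 6) (Sum.elim (fun _ => 8) (fun _ => 6)))
    (f := fun x => lawE true (lawE true (fun j => x ⟨Sum.inl (), j⟩)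
        fun j => x ⟨Sum.inr (Sum.inl ()), j⟩) (fun j => x ⟨Sum.inr (Sum.inr ()), j⟩) 2 *
      lawE true (fun j => x ⟨Sum.inl (), j⟩) (lawE true (fun j => x ⟨Sum.inr (Sum.inl ()), j⟩)
        fun j => x ⟨Sum.inr (Sum.inr ()), j⟩) 2)
    ⟨⟨lawE true (lawE true (fun j => X ⟨Sum.inl (), j⟩)
        fun j => X ⟨Sum.inr (Sum.inl ()), j⟩) (fun j => X ⟨Sum.inr (Sum.inr ()), j⟩) 2 *
      lawE true (fun j => X ⟨Sum.inl (), j⟩) (lawE true (fun j => X ⟨Sum.inr (Sum.inl ()), j⟩)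
        fun j => X ⟨Sum.inr (Sum.inr ()), j⟩) 2, fun x => by simp [lawE]⟩, fun c x => by
      simp [lawE, rescale, Fintype.prod_sum_type]
      ring⟩ ⊤
  have key := IsRegularMap.eq_of_dense
    (curveE_irreducible.prodVar (curveE_irreducible.prodVar curveE_irreducible))
    curveAdd_assoc_regular.1 curveAdd_assoc_regular.2 hD
    ⟨_, ((prodVarEquiv _ _).symm (curveZero, (prodVarEquiv _ _).symm (curveZero, curveZero))).2, by
      have h0 : (![1, 1, 1, 0] : Fin 4 → ℂ) ≠ 0 := vec_ne_zero_of_head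
      have hc := isCoordOf_unit h0 curveZero_line
      refine mt (hD.aeval_eq (isCoordOf_pair hc (isCoordOf_pair hc hc))).2 ?_
      rw [hDe]
      simp [lawE, pairCoord]⟩ fun p hp => by
      rw [evalAt, hDe] at hp
      have hP := crd_mem_line (prodVarEquiv _ _ p).1.1
      have hQ := crd_mem_line (prodVarEquiv _ _ (prodVarEquiv _ _ p).2).1.1
      have hR := crd_mem_line (prodVarEquiv _ _ (prodVarEquiv _ _ p).2).2.1
      have hP0 := crd_ne_zero (prodVarEquiv _ _ p).1.1
      have hQ0 := crd_ne_zero (prodVarEquiv _ _ (prodVarEquiv _ _ p).2).1.1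
      have hR0 := crd_ne_zero (prodVarEquiv _ _ (prodVarEquiv _ _ p).2).2.1
      obtain ⟨h1, h2⟩ := mul_ne_zero_iff.1 hp
      have e1 := lawE_mem_line (lawE_ne_zero_left h1) (lawE_mem_line hP0 hP hQ0 hQ true) hR0 hR true
      have e2 := lawE_mem_line hP0 hP (lawE_ne_zero_right h2) (lawE_mem_line hQ0 hQ hR0 hR true)
        true
      have prop := lawE_assoc (onE_of_mem_line (prodVarEquiv _ _ p).1.2 hP)
        (onE_of_mem_line (prodVarEquiv _ _ (prodVarEquiv _ _ p).2).1.2 hQ)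
        (onE_of_mem_line (prodVarEquiv _ _ (prodVarEquiv _ _ p).2).2.2 hR)
      refine Subtype.ext (eq_of_minors e1 e2 (fun h => h1 (congrFun h 2))
        (fun h => h2 (congrFun h 2)) fun i j => ?_)
      refine mul_right_cancel₀ h2 (mul_right_cancel₀ h1 ?_)
      exact minor_of_pivot (fun i => prop i) i j
  exact congrFun key ((prodVarEquiv _ _).symm (P, (prodVarEquiv _ _).symm (Q, R)))

instance : Zero curveE := ⟨curveZero⟩

instance : Add curveE := ⟨curveAdd⟩

instance : Neg curveE := ⟨fun P => curveSign ![1, 1, 1, -1] P⟩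

/-- The curve `E` as an abelian group with origin `[1, 1, 1, 0]`. -/
instance : AddCommGroup curveE where
  add_assoc := curveAdd_assoc
  zero_add := curveZero_add
  add_zero P := (curveAdd_comm P curveZero).trans (curveZero_add P)
  neg_add_cancel := curveNeg_add
  add_comm := curveAdd_comm
  nsmul := nsmulRec
  zsmul := zsmulRec

/-! ### The groups of sign changes -/

theorem mem_zpowers_involution {G : Type} [Group G] {a g : G} (ha : a * a = 1) :
    g ∈ Subgroup.zpowers a ↔ g = 1 ∨ g = a := by
  constructor
  · rintro ⟨z, rfl⟩
    rcases Int.even_or_odd' z with ⟨t, rfl | rfl⟩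
    · left
      simp only [zpow_mul, zpow_ofNat, pow_two, ha, one_zpow]
    · right
      change a ^ (2 * t + 1) = a
      rw [zpow_add_one, zpow_mul, zpow_ofNat, pow_two, ha, one_zpow, one_mul]
  · rintro (rfl | rfl)
    · exact one_mem _
    · exact Subgroup.mem_zpowers _

theorem mem_closure_involutions {G : Type} [Group G] {a b g : G} (ha : a * a = 1) (hb : b * b = 1)
    (hab : a * b = b * a) :
    g ∈ Subgroup.closure {a, b} ↔ g = 1 ∨ g = a ∨ g = b ∨ g = a * b := by
  constructor
  · intro h
    induction h using Subgroup.closure_induction_left with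
    | one => exact Or.inl rfl
    | mul_left x hx y hy ih =>
      have e1 : b * a * a = b := by rw [mul_assoc, ha, mul_one]
      rcases hx with rfl | rfl <;> rcases ih with rfl | rfl | rfl | rfl <;>
        simp [ha, hb, ← mul_assoc, hab, e1]
    | inv_mul_cancel x hx y hy ih =>
      have e1 : b * a * a = b := by rw [mul_assoc, ha, mul_one]
      have ha' : a⁻¹ = a := inv_eq_of_mul_eq_one_left ha
      have hb' : b⁻¹ = b := inv_eq_of_mul_eq_one_left hb
      rcases hx with rfl | rfl <;> rcases ih with rfl | rfl | rfl | rfl <;>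
        simp [ha, hb, ha', hb', ← mul_assoc, hab, e1]
  · have hA : a ∈ Subgroup.closure {a, b} := Subgroup.subset_closure (by simp)
    have hB : b ∈ Subgroup.closure {a, b} := Subgroup.subset_closure (by simp)
    rintro (rfl | rfl | rfl | rfl)
    exacts [one_mem _, hA, hB, mul_mem hA hB]

theorem finite_zpowers_involution {G : Type} [Group G] {a : G} (ha : a * a = 1) :
    Finite (Subgroup.zpowers a) := by
  have : (Subgroup.zpowers a : Set G) ⊆ {1, a} := fun g hg => (mem_zpowers_involution ha).1 hg
  exact Set.Finite.subset (Set.toFinite _) this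

section SignMaps

variable {ι : Type} [Fintype ι] {n : ι → ℕ}

/-- A map that changes the signs of coordinates is regular over every field. -/
theorem isRegularMap_of_signed {V W : Set (MultiProj n)} {f : V → W} (ε : Coord n → ℤˣ)
    (h : ∀ p : V, IsCoordOf (signed ε (homCoord p.1)) (f p).1) (k : IntermediateField ℚ ℂ) :
    IsRegularMap k f := by
  classical
  refine isRegularMap_of_intForms (fun p j => ⟨Pi.single j 1,
    fun x l => ((ε ⟨j, l⟩ : ℤ) : ℂ) * x ⟨j, l⟩, fun l => ⟨⟨C (ε ⟨j, l⟩ : ℤ) * X ⟨j, l⟩, ?_⟩, ?_⟩,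
    ((isCoordOf_iff.1 (h p)) j).1, fun q => ((isCoordOf_iff.1 (h q)) j).2⟩) k
  · intro x
    simp
  · intro c x
    rw [Finset.prod_eq_single j]
    · simp [rescale]
      ring
    · intro b _ hb
      simp [Pi.single_eq_of_ne hb]
    · simp

theorem isCoordOf_signPerm {N : ℕ} (ε : Fin (N + 1) → ℤˣ) (p : Proj N) :
    IsCoordOf (signed (fun a => ε a.2) (homCoord p)) (signPerm ε p) := by
  obtain ⟨c, hc, h⟩ := crd_signPerm ε p
  refine ⟨fun _ => c⁻¹, fun _ => inv_ne_zero hc, ?_⟩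
  funext a
  change _ = c⁻¹ * crd (signPerm ε p) a.2
  rw [h, inv_mul_cancel_left₀ hc]
  rfl

end SignMaps

/-! ### The quotient of the box variety -/

theorem sigma_mul_self : sigma * sigma = 1 := by
  ext1 p
  exact Subtype.ext (signPerm_sq _ _)

/-- The sign change of `Z₃`. -/
def signZ3 : Coord (fun _ : Unit => 6) → ℤˣ := fun a => ![1, 1, -1, 1, 1, 1, 1] a.2

theorem isCoordOf_sigma (p : box) : IsCoordOf (signed signZ3 (homCoord p.1)) (sigma p).1 :=
  isCoordOf_signPerm _ _

theorem sigma_regular (k : IntermediateField ℚ ℂ) : IsRegularMap k sigma :=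
  isRegularMap_of_signed _ isCoordOf_sigma k

/-- The coordinate vector without the coordinate `Z₃`. -/
def dropZ3 {R : Type} (v : Fin 7 → R) : Fin 6 → R := ![v 0, v 1, v 3, v 4, v 5, v 6]

theorem forgetZ3_line {p : box} {v : Fin 7 → ℂ} (hv : v ∈ line p.1) :
    dropZ3 v ∈ line (forgetZ3 p).1 := by
  obtain ⟨c, rfl⟩ := mem_line_iff.1 hv
  have : dropZ3 (c • crd p.1) = c • dropZ3 (crd p.1) := by
    funext i
    fin_cases i <;> simp [dropZ3]
  rw [this]
  exact Submodule.smul_mem _ _ (mkPt_mem_line _ (forget_ne_zero p.2))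

theorem forgetZ3_sigma (p : box) : forgetZ3 (sigma p) = forgetZ3 p := by
  obtain ⟨c, hc, h⟩ := crd_signPerm ![1, 1, -1, 1, 1, 1, 1] p.1
  refine Subtype.ext (eq_of_mem_line (forget_ne_zero (sigma p).2)
    (forgetZ3_line (crd_mem_line _)) ?_)
  have : dropZ3 (crd (sigma p).1) = c • dropZ3 (crd p.1) := by
    funext i
    fin_cases i <;> refine (h _).trans ?_ <;> simp [dropZ3]
  change dropZ3 (crd (sigma p).1) ∈ line _
  rw [this]
  exact Submodule.smul_mem _ _ (forgetZ3_line (crd_mem_line _))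

theorem mem_box_of_line {P : Proj 6} {v : Fin 7 → ℂ} (h0 : v ≠ 0) (hv : v ∈ line P)
    (h1 : v 3 ^ 2 + v 4 ^ 2 = v 2 ^ 2) (h2 : v 3 ^ 2 + v 5 ^ 2 = v 1 ^ 2)
    (h3 : v 4 ^ 2 + v 5 ^ 2 = v 0 ^ 2) (h4 : v 3 ^ 2 + v 4 ^ 2 + v 5 ^ 2 = v 6 ^ 2) :
    P ∈ box := by
  obtain ⟨c, rfl⟩ := mem_line_iff.1 hv
  have hc : c ^ 2 ≠ 0 := pow_ne_zero _ fun hc => h0 (by rw [hc, zero_smul])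
  simp only [Pi.smul_apply, smul_eq_mul] at h1 h2 h3 h4
  refine ⟨?_, ?_, ?_, ?_⟩ <;> refine mul_left_cancel₀ hc ?_
  · linear_combination h1
  · linear_combination h2
  · linear_combination h3
  · linear_combination h4

theorem forgetZ3_surjective : Function.Surjective forgetZ3 := by
  intro Q
  obtain ⟨z, hz⟩ := IsAlgClosed.exists_pow_nat_eq (crd Q.1 2 ^ 2 + crd Q.1 3 ^ 2) (n := 2)
    (by norm_num)
  set w := crd Q.1 with hw
  set v : Fin 7 → ℂ := ![w 0, w 1, z, w 2, w 3, w 4, w 5] with hv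
  have hdrop : dropZ3 v = w := by
    funext i
    fin_cases i <;> simp [dropZ3, hv]
  have hw0 : w ≠ 0 := crd_ne_zero _
  have hv0 : v ≠ 0 := fun h => hw0 (by
    rw [← hdrop, h]
    funext i
    fin_cases i <;> simp [dropZ3])
  obtain ⟨h1, h2, h3⟩ := Q.2
  refine ⟨⟨mkPt v hv0, mem_box_of_line hv0 (mkPt_mem_line v hv0) hz.symm h1 h2 h3⟩, ?_⟩
  refine Subtype.ext (eq_of_mem_line hw0 ?_ (crd_mem_line _))
  have hline := forgetZ3_line
    (p := ⟨mkPt v hv0, mem_box_of_line hv0 (mkPt_mem_line v hv0) hz.symm h1 h2 h3⟩)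
    (mkPt_mem_line v hv0)
  rwa [hdrop] at hline

theorem forgetZ3_eq_iff (p q : box) :
    forgetZ3 p = forgetZ3 q ↔ ∃ g ∈ Subgroup.zpowers sigma, g p = q := by
  constructor
  · intro h
    have hp := forgetZ3_line (crd_mem_line p.1)
    have hq := forgetZ3_line (crd_mem_line q.1)
    rw [h] at hp
    obtain ⟨c, hc⟩ := mem_line_iff.1 hp
    obtain ⟨c', hc'⟩ := mem_line_iff.1 hq
    have hc0 : c ≠ 0 := fun h => forget_ne_zero p.2 (by rw [h, zero_smul] at hc; exact hc)
    have hc0' : c' ≠ 0 := fun h => forget_ne_zero q.2 (by rw [h, zero_smul] at hc'; exact hc')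
    -- normalize the coordinate vectors so that they agree away from `Z₃`
    set x := c⁻¹ • crd p.1 with hx
    set y := c'⁻¹ • crd q.1 with hy
    have hx0 : x ≠ 0 := smul_ne_zero (inv_ne_zero hc0) (crd_ne_zero _)
    have hy0 : y ≠ 0 := smul_ne_zero (inv_ne_zero hc0') (crd_ne_zero _)
    have hxp : x ∈ line p.1 := Submodule.smul_mem _ _ (crd_mem_line _)
    have hyq : y ∈ line q.1 := Submodule.smul_mem _ _ (crd_mem_line _)
    have hxy : dropZ3 x = dropZ3 y := by
      have e1 : dropZ3 x = c⁻¹ • dropZ3 (crd p.1) := by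
        funext i
        fin_cases i <;> simp [dropZ3, hx]
      have e2 : dropZ3 y = c'⁻¹ • dropZ3 (crd q.1) := by
        funext i
        fin_cases i <;> simp [dropZ3, hy]
      rw [e1, e2, hc, hc', smul_smul, smul_smul, inv_mul_cancel₀ hc0, inv_mul_cancel₀ hc0']
    have hx2 : x 3 ^ 2 + x 4 ^ 2 = x 2 ^ 2 := by
      simp only [hx, Pi.smul_apply, smul_eq_mul]
      linear_combination (c⁻¹) ^ 2 * p.2.1
    have hy2 : y 3 ^ 2 + y 4 ^ 2 = y 2 ^ 2 := by
      simp only [hy, Pi.smul_apply, smul_eq_mul]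
      linear_combination (c'⁻¹) ^ 2 * q.2.1
    have k0 : x 0 = y 0 := congrFun hxy 0
    have k1 : x 1 = y 1 := congrFun hxy 1
    have k3 : x 3 = y 3 := congrFun hxy 2
    have k4 : x 4 = y 4 := congrFun hxy 3
    have k5 : x 5 = y 5 := congrFun hxy 4
    have k6 : x 6 = y 6 := congrFun hxy 5
    have hsq : x 2 ^ 2 = y 2 ^ 2 := by rw [← hx2, ← hy2, k3, k4]
    rcases sq_eq_sq_iff_eq_or_eq_neg.1 hsq with k2 | k2
    · refine ⟨1, one_mem _, Subtype.ext (eq_of_mem_line hx0 hxp ?_)⟩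
      have : x = y := by
        funext i
        fin_cases i <;> assumption
      rwa [this]
    · refine ⟨sigma, Subgroup.mem_zpowers _, Subtype.ext (eq_of_mem_line hy0 ?_ hyq)⟩
      obtain ⟨d, hd, hs⟩ := crd_signPerm ![1, 1, -1, 1, 1, 1, 1] p.1
      refine mem_line_iff.2 ⟨c⁻¹ * d⁻¹, ?_⟩
      funext i
      change y i = c⁻¹ * d⁻¹ * crd (signPerm _ p.1) i
      have hxi : ∀ i, c⁻¹ * crd p.1 i = x i := fun i => rfl
      rw [hs, show ∀ s : ℂ, c⁻¹ * d⁻¹ * (d * (s * crd p.1 i)) = s * (c⁻¹ * crd p.1 i) from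
        fun s => by field_simp, hxi]
      fin_cases i <;> simp [k0, k1, k2, k3, k4, k5, k6]
  · rintro ⟨g, hg, rfl⟩
    rcases (mem_zpowers_involution sigma_mul_self).1 hg with rfl | rfl
    · rfl
    · exact (forgetZ3_sigma p).symm

theorem box_closed (k : IntermediateField ℚ ℂ) : IsClosedOver k box := by
  refine isClosedOver_of_intForms (α := Fin 4) (d := fun _ _ => 2)
    (f := ![fun x => x ⟨(), 3⟩ ^ 2 + x ⟨(), 4⟩ ^ 2 - x ⟨(), 2⟩ ^ 2,
      fun x => x ⟨(), 3⟩ ^ 2 + x ⟨(), 5⟩ ^ 2 - x ⟨(), 1⟩ ^ 2,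
      fun x => x ⟨(), 4⟩ ^ 2 + x ⟨(), 5⟩ ^ 2 - x ⟨(), 0⟩ ^ 2,
      fun x => x ⟨(), 3⟩ ^ 2 + x ⟨(), 4⟩ ^ 2 + x ⟨(), 5⟩ ^ 2 - x ⟨(), 6⟩ ^ 2])
    (fun a => ⟨⟨(![X ⟨(), 3⟩ ^ 2 + X ⟨(), 4⟩ ^ 2 - X ⟨(), 2⟩ ^ 2,
      X ⟨(), 3⟩ ^ 2 + X ⟨(), 5⟩ ^ 2 - X ⟨(), 1⟩ ^ 2,
      X ⟨(), 4⟩ ^ 2 + X ⟨(), 5⟩ ^ 2 - X ⟨(), 0⟩ ^ 2,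
      X ⟨(), 3⟩ ^ 2 + X ⟨(), 4⟩ ^ 2 + X ⟨(), 5⟩ ^ 2 - X ⟨(), 6⟩ ^ 2] : Fin 4 → _) a,
        fun x => by fin_cases a <;> simp⟩, fun c x => by
        fin_cases a <;> simp [rescale] <;> ring⟩) (fun p => ?_) k
  constructor
  · rintro ⟨h0, h1, h2, h3⟩ a
    fin_cases a
    exacts [sub_eq_zero.2 h0, sub_eq_zero.2 h1, sub_eq_zero.2 h2, sub_eq_zero.2 h3]
  · intro h
    exact ⟨sub_eq_zero.1 (h 0), sub_eq_zero.1 (h 1), sub_eq_zero.1 (h 2), sub_eq_zero.1 (h 3)⟩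

theorem boxQuot_closed (k : IntermediateField ℚ ℂ) : IsClosedOver k boxQuot := by
  refine isClosedOver_of_intForms (α := Fin 3) (d := fun _ _ => 2)
    (f := ![fun x => x ⟨(), 2⟩ ^ 2 + x ⟨(), 4⟩ ^ 2 - x ⟨(), 1⟩ ^ 2,
      fun x => x ⟨(), 3⟩ ^ 2 + x ⟨(), 4⟩ ^ 2 - x ⟨(), 0⟩ ^ 2,
      fun x => x ⟨(), 2⟩ ^ 2 + x ⟨(), 3⟩ ^ 2 + x ⟨(), 4⟩ ^ 2 - x ⟨(), 5⟩ ^ 2])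
    (fun a => ⟨⟨(![X ⟨(), 2⟩ ^ 2 + X ⟨(), 4⟩ ^ 2 - X ⟨(), 1⟩ ^ 2,
      X ⟨(), 3⟩ ^ 2 + X ⟨(), 4⟩ ^ 2 - X ⟨(), 0⟩ ^ 2,
      X ⟨(), 2⟩ ^ 2 + X ⟨(), 3⟩ ^ 2 + X ⟨(), 4⟩ ^ 2 - X ⟨(), 5⟩ ^ 2] : Fin 3 → _) a,
        fun x => by fin_cases a <;> simp⟩, fun c x => by
        fin_cases a <;> simp [rescale] <;> ring⟩) (fun p => ?_) k
  constructor
  · rintro ⟨h0, h1, h2⟩ a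
    fin_cases a
    exacts [sub_eq_zero.2 h0, sub_eq_zero.2 h1, sub_eq_zero.2 h2]
  · intro h
    exact ⟨sub_eq_zero.1 (h 0), sub_eq_zero.1 (h 1), sub_eq_zero.1 (h 2)⟩

theorem curveE_closed (k : IntermediateField ℚ ℂ) : IsClosedOver k curveE := by
  refine isClosedOver_of_intForms (α := Fin 2) (d := fun _ _ => 2)
    (f := ![fun x => x ⟨(), 0⟩ ^ 2 - (x ⟨(), 2⟩ ^ 2 + x ⟨(), 3⟩ ^ 2),
      fun x => x ⟨(), 1⟩ ^ 2 - (x ⟨(), 2⟩ ^ 2 - x ⟨(), 3⟩ ^ 2)])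
    (fun a => ⟨⟨(![X ⟨(), 0⟩ ^ 2 - (X ⟨(), 2⟩ ^ 2 + X ⟨(), 3⟩ ^ 2),
      X ⟨(), 1⟩ ^ 2 - (X ⟨(), 2⟩ ^ 2 - X ⟨(), 3⟩ ^ 2)] : Fin 2 → _) a,
        fun x => by fin_cases a <;> simp⟩, fun c x => by
        fin_cases a <;> simp [rescale] <;> ring⟩) (fun p => ?_) k
  constructor
  · rintro ⟨h0, h1⟩ a
    fin_cases a
    exacts [sub_eq_zero.2 h0, sub_eq_zero.2 h1]
  · intro h
    exact ⟨sub_eq_zero.1 (h 0), sub_eq_zero.1 (h 1)⟩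

theorem even_of_neg_one_pow {t : ℕ} (h : (-1 : ℤˣ) ^ t = 1) : Even t := by
  by_contra h0
  rw [Nat.not_even_iff_odd] at h0
  rw [h0.neg_one_pow] at h
  exact absurd h (by decide)

/-- The forms that define the projection away from `Z₃`. -/
def dropForms (k : IntermediateField ℚ ℂ) (a : Coord (fun _ : Unit => 5)) :
    MvPolynomial (Coord fun _ : Unit => 6) k :=
  dropZ3 (fun j => X ⟨(), j⟩) a.2

theorem evalAt_dropForms {k : IntermediateField ℚ ℂ} (P : Proj 6) :
    (fun a => evalAt (dropForms k a) P) = fun a => dropZ3 (crd P) a.2 := by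
  funext ⟨⟨⟩, j⟩
  fin_cases j <;> simp [dropForms, dropZ3, evalAt] <;> rfl

theorem forgetZ3_isSignQuotient (k : IntermediateField ℚ ℂ) :
    IsSignQuotient k [signZ3] forgetZ3 (dropForms k) where
  surjective := forgetZ3_surjective
  lift ε hε v := by
    rw [List.mem_singleton.1 hε]
    exact ⟨sigma v, forgetZ3_sigma v, isCoordOf_sigma v⟩
  forms := ⟨fun _ _ => 1, fun a => isMultiHom_of_aeval_rescale fun c x => by
    obtain ⟨⟨⟩, j⟩ := a
    fin_cases j <;> simp [dropForms, dropZ3, rescale]⟩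
  coord v := by
    rw [evalAt_dropForms]
    exact isCoordOf_unit (forget_ne_zero v.2) (forgetZ3_line (crd_mem_line _))
  invariants p d := by
    refine ⟨1, fun _ => 2 * d (), by simp [evalAt], fun e he hs => ?_⟩
    have hdeg := he ()
    have hev := hs signZ3 (List.mem_singleton_self _)
    rw [Fintype.prod_sigma] at hev
    simp only [signZ3, Finset.univ_unique, Finset.prod_singleton, Fin.prod_univ_succ] at hev
    simp at hev
    obtain ⟨t, ht⟩ := even_of_neg_one_pow hev
    simp only [Fin.sum_univ_succ] at hdeg
    simp at hdeg
    refine ⟨X ⟨(), 0⟩ ^ e ⟨(), 0⟩ * X ⟨(), 1⟩ ^ e ⟨(), 1⟩ * (X ⟨(), 2⟩ ^ 2 + X ⟨(), 3⟩ ^ 2) ^ t *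
      X ⟨(), 2⟩ ^ e ⟨(), 3⟩ * X ⟨(), 3⟩ ^ e ⟨(), 4⟩ * X ⟨(), 4⟩ ^ e ⟨(), 5⟩ *
      X ⟨(), 5⟩ ^ e ⟨(), 6⟩, isMultiHom_of_aeval_rescale fun c x => ?_, fun v => ?_⟩
    · have h2 : c () ^ (2 * d ()) = c () ^ e ⟨(), 0⟩ * c () ^ e ⟨(), 1⟩ * (c () ^ 2) ^ t *
          c () ^ e ⟨(), 3⟩ * c () ^ e ⟨(), 4⟩ * c () ^ e ⟨(), 5⟩ * c () ^ e ⟨(), 6⟩ := by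
        rw [← hdeg, ht]
        ring
      simp only [rescale, map_mul, map_pow, map_add, aeval_X, Finset.univ_unique,
        Finset.prod_singleton, PUnit.default_eq_unit, mul_pow, ← mul_add]
      rw [h2]
      ring
    · have h3 : crd v.1 3 ^ 2 + crd v.1 4 ^ 2 = crd v.1 2 ^ 2 := v.2.1
      rw [evalAt_dropForms]
      simp only [map_mul, map_pow, map_add, aeval_X]
      simp only [dropZ3, Matrix.cons_val]
      rw [h3, ← pow_mul, two_mul, ← ht, Fintype.prod_sigma]
      simp only [Finset.univ_unique, Finset.prod_singleton, PUnit.default_eq_unit]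
      simp only [evalAt, map_one, one_mul]
      exact Fin.prod_univ_seven _

theorem forgetZ3_isQuotientBy (k : IntermediateField ℚ ℂ) :
    IsQuotientBy k (Subgroup.zpowers sigma) forgetZ3 :=
  (forgetZ3_isSignQuotient k).isQuotientBy (finite_zpowers_involution sigma_mul_self)
    (fun g hg => by
      rcases (mem_zpowers_involution sigma_mul_self).1 hg with rfl | rfl
      exacts [isRegularMap_id, sigma_regular k])
    (box_closed k) (boxQuot_closed k) forgetZ3_eq_iff

/-! ### The group generated by the diagonal actions -/

theorem diagPerm_mul {f g : Equiv.Perm curveE} :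
    diagPerm f * diagPerm g = diagPerm (f * g) := rfl

theorem diagPerm_one : diagPerm (1 : Equiv.Perm curveE) = 1 := by
  ext1 p
  exact (prodVarEquiv curveE curveE).symm_apply_apply p

theorem diagPerm_injective :
    Function.Injective (diagPerm : Equiv.Perm curveE → Equiv.Perm surfEE) := by
  intro f g h
  ext1 P
  have := congrArg (fun s => (prodVarEquiv _ _ (s ((prodVarEquiv _ _).symm (P, P)))).1) h
  exact this

theorem curveSign_mul_self (ε : Fin 4 → ℤˣ) : curveSign ε * curveSign ε = 1 := by
  ext1 p
  exact Subtype.ext (signPerm_sq _ _)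

theorem curveSign_mul (ε ε' : Fin 4 → ℤˣ) : curveSign ε * curveSign ε' = curveSign (ε * ε') := by
  ext1 P
  refine Subtype.ext (eq_of_mem_line (x := fun j => (((ε * ε') j : ℤ) : ℂ) * crd P.1 j) ?_ ?_
    (signed_mem_line (crd_mem_line P.1)))
  · intro h
    refine crd_ne_zero P.1 (funext fun j => ?_)
    have hj := congrFun h j
    rcases Int.units_eq_one_or ((ε * ε') j) with hs | hs <;> simpa [hs] using hj
  · have h := signed_mem_line (ε := ε) (signed_mem_line (ε := ε') (crd_mem_line P.1))
    have hs : (fun j => (((ε * ε') j : ℤ) : ℂ) * crd P.1 j) =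
        fun j => ((ε j : ℤ) : ℂ) * (((ε' j : ℤ) : ℂ) * crd P.1 j) := by
      funext j
      simp [mul_assoc]
    rw [hs]
    exact h

theorem curveSign_ne {ε ε' : Fin 4 → ℤˣ} (h0 : ε 0 = 1) (h0' : ε' 0 = 1)
    (h : ε 1 ≠ ε' 1 ∨ ε 2 ≠ ε' 2) : curveSign ε ≠ curveSign ε' := by
  intro he
  have h1 := signed_mem_line (ε := ε) curveZero_line
  have h2 := signed_mem_line (ε := ε') curveZero_line
  rw [he] at h1
  obtain ⟨c, hc⟩ := mem_line_iff.1 h1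
  obtain ⟨c', hc'⟩ := mem_line_iff.1 h2
  have e0 : 1 = c * crd (curveSign ε' curveZero).1 0 := by simpa [h0] using congrFun hc 0
  have e0' : 1 = c' * crd (curveSign ε' curveZero).1 0 := by simpa [h0'] using congrFun hc' 0
  have hcc : c = c' := by
    refine mul_right_cancel₀ (fun h => ?_) (e0.symm.trans e0')
    rw [h, mul_zero] at e0
    exact one_ne_zero e0
  rw [hcc, ← hc'] at hc
  have e1 := congrFun hc 1
  have e2 := congrFun hc 2
  simp at e1 e2
  have hinj : ∀ s t : ℤˣ, ((s : ℤ) : ℂ) = ((t : ℤ) : ℂ) → s = t := fun s t h =>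
    Units.ext (by exact_mod_cast h)
  rcases h with h | h
  · exact h (hinj _ _ (by simpa using e1))
  · exact h (hinj _ _ (by simpa using e2))

theorem tau_mul_self : tau * tau = 1 := curveSign_mul_self _

theorem rho_mul_self : rho * rho = 1 := curveSign_mul_self _

theorem tau_mul_rho : tau * rho = rho * tau := by
  rw [tau, rho, curveSign_mul, curveSign_mul, mul_comm]

theorem diagPerm_tau_mul_self : diagPerm tau * diagPerm tau = 1 := by
  rw [diagPerm_mul, tau_mul_self, diagPerm_one]

theorem diagPerm_rho_mul_self : diagPerm rho * diagPerm rho = 1 := by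
  rw [diagPerm_mul, rho_mul_self, diagPerm_one]

theorem mem_groupH {g : Equiv.Perm surfEE} :
    g ∈ groupH ↔ g = 1 ∨ g = diagPerm tau ∨ g = diagPerm rho ∨
      g = diagPerm tau * diagPerm rho :=
  mem_closure_involutions diagPerm_tau_mul_self diagPerm_rho_mul_self (by
    rw [diagPerm_mul, diagPerm_mul, tau_mul_rho])

theorem groupH_coe : (groupH : Set (Equiv.Perm surfEE)) =
    diagPerm '' {curveSign 1, curveSign ![1, -1, 1, 1], curveSign ![1, 1, -1, -1],
      curveSign ![1, -1, -1, -1]} := by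
  have h1 : curveSign 1 = 1 := by
    rw [← curveSign_mul_self 1, curveSign_mul, mul_one]
  have h2 : tau * rho = curveSign ![1, -1, -1, -1] := by
    rw [tau, rho, curveSign_mul]
    congr 1
    decide
  ext g
  simp only [Set.image_insert_eq, Set.image_singleton, Set.mem_insert_iff, Set.mem_singleton_iff,
    h1, ← h2, diagPerm_one, ← diagPerm_mul, SetLike.mem_coe, mem_groupH]
  rfl

theorem isKleinFour_groupH : IsKleinFour groupH where
  card_four := by
    change Nat.card (groupH : Set (Equiv.Perm surfEE)) = 4
    rw [groupH_coe, Nat.card_image_of_injective diagPerm_injective, Nat.card_coe_set_eq]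
    rw [Set.ncard_insert_of_notMem, Set.ncard_insert_of_notMem, Set.ncard_insert_of_notMem,
      Set.ncard_singleton]
    · simp only [Set.mem_singleton_iff]
      exact curveSign_ne rfl rfl (by decide)
    · simp only [Set.mem_insert_iff, Set.mem_singleton_iff, not_or]
      exact ⟨curveSign_ne rfl rfl (by decide), curveSign_ne rfl rfl (by decide)⟩
    · simp only [Set.mem_insert_iff, Set.mem_singleton_iff, not_or]
      exact ⟨curveSign_ne rfl rfl (by decide), curveSign_ne rfl rfl (by decide),
        curveSign_ne rfl rfl (by decide)⟩
  exponent_two := by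
    have hdvd : Monoid.exponent groupH ∣ 2 := Monoid.exponent_dvd_of_forall_pow_eq_one fun g => by
      obtain ⟨g, hg⟩ := g
      have hg' : g ∈ (groupH : Set (Equiv.Perm surfEE)) := hg
      rw [groupH_coe] at hg'
      obtain ⟨f, hf, rfl⟩ := hg'
      refine Subtype.ext ?_
      change diagPerm f ^ 2 = 1
      rw [pow_two, diagPerm_mul]
      rcases hf with rfl | rfl | rfl | rfl <;> rw [curveSign_mul_self, diagPerm_one]
    refine ((Nat.dvd_prime Nat.prime_two).1 hdvd).resolve_left fun h1 => ?_
    rw [Monoid.exp_eq_one_iff] at h1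
    have h2 : diagPerm tau = diagPerm 1 := by
      rw [diagPerm_one]
      exact congrArg Subtype.val (Subsingleton.elim
        (⟨diagPerm tau, Subgroup.subset_closure (by simp)⟩ : groupH) 1)
    refine curveSign_ne (ε := ![1, -1, 1, 1]) (ε' := 1) rfl rfl (by decide)
      ((diagPerm_injective h2).trans ?_)
    rw [← curveSign_mul_self 1, curveSign_mul, mul_one]

/-- A pair of sign changes. -/
def pairSign {ι κ : Type} {n : ι → ℕ} {m : κ → ℕ} (ε : Coord n → ℤˣ) (ε' : Coord m → ℤˣ) :
    Coord (Sum.elim n m) → ℤˣ := fun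
  | ⟨Sum.inl i, a⟩ => ε ⟨i, a⟩
  | ⟨Sum.inr j, a⟩ => ε' ⟨j, a⟩

theorem isCoordOf_pairSign {ι κ : Type} {n : ι → ℕ} {m : κ → ℕ} {V : Set (MultiProj n)}
    {W : Set (MultiProj m)} {p : prodVar V W} {q : V} {r : W} {ε : Coord n → ℤˣ}
    {ε' : Coord m → ℤˣ} (hq : IsCoordOf (signed ε (homCoord (prodVarEquiv V W p).1.1)) q.1)
    (hr : IsCoordOf (signed ε' (homCoord (prodVarEquiv V W p).2.1)) r.1) :
    IsCoordOf (signed (pairSign ε ε') (homCoord p.1)) ((prodVarEquiv V W).symm (q, r)).1 := by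
  convert isCoordOf_pair hq hr using 1
  funext a
  obtain ⟨i | j, a⟩ := a <;> rfl

/-- The signs of an automorphism of `E`, on the coordinates of both factors of `E × E`. -/
def diagSign (ε : Fin 4 → ℤˣ) : Coord (Sum.elim (fun _ : Unit => 3) fun _ : Unit => 3) → ℤˣ :=
  pairSign (fun a => ε a.2) fun a => ε a.2

theorem isCoordOf_diagSign (ε : Fin 4 → ℤˣ) (p : surfEE) :
    IsCoordOf (signed (diagSign ε) (homCoord p.1)) (diagPerm (curveSign ε) p).1 :=
  isCoordOf_pairSign (isCoordOf_signPerm _ _) (isCoordOf_signPerm _ _)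

theorem diagPerm_regular (ε : Fin 4 → ℤˣ) (k : IntermediateField ℚ ℂ) :
    IsRegularMap k (diagPerm (curveSign ε)) :=
  isRegularMap_of_signed _ (isCoordOf_diagSign ε) k

theorem finite_groupH : Finite groupH := by
  have : (groupH : Set (Equiv.Perm surfEE)).Finite := groupH_coe ▸ (Set.toFinite _).image _
  exact this

theorem groupH_regular (k : IntermediateField ℚ ℂ) : ∀ g ∈ groupH, IsRegularMap k g := by
  intro g hg
  have hg' : g ∈ (groupH : Set (Equiv.Perm surfEE)) := hg
  rw [groupH_coe] at hg'
  obtain ⟨f, hf, rfl⟩ := hg'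
  rcases hf with rfl | rfl | rfl | rfl <;> exact diagPerm_regular _ k

/-! ### Functions that are forms in given functions -/

/-- The function `g` is a form of multidegree `d` over `k` in the functions `φ a`. -/
def IsFormIn (k : IntermediateField ℚ ℂ) {κ α : Type} {m : κ → ℕ} (φ : Coord m → α → ℂ)
    (d : κ → ℕ) (g : α → ℂ) : Prop :=
  ∃ Ψ : MvPolynomial (Coord m) k, IsMultiHom Ψ d ∧ ∀ v, g v = aeval (fun a => φ a v) Ψ

namespace IsFormIn

variable {k : IntermediateField ℚ ℂ} {κ α : Type} {m : κ → ℕ} {φ : Coord m → α → ℂ}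
  {d d' : κ → ℕ} {f g : α → ℂ}

theorem congr (h : IsFormIn k φ d f) (hd : d = d') (hg : ∀ v, f v = g v) :
    IsFormIn k φ d' g := by
  obtain ⟨Ψ, h1, h2⟩ := h
  exact ⟨Ψ, hd ▸ h1, fun v => (hg v).symm.trans (h2 v)⟩

variable [Fintype κ]

theorem add (hf : IsFormIn k φ d f) (hg : IsFormIn k φ d g) : IsFormIn k φ d (f + g) := by
  obtain ⟨Ψ, h1, h2⟩ := hf
  obtain ⟨Ψ', h1', h2'⟩ := hg
  exact ⟨Ψ + Ψ', h1.add h1', fun v => by rw [Pi.add_apply, h2, h2', map_add]⟩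

theorem sub (hf : IsFormIn k φ d f) (hg : IsFormIn k φ d g) : IsFormIn k φ d (f - g) := by
  obtain ⟨Ψ, h1, h2⟩ := hf
  obtain ⟨Ψ', h1', h2'⟩ := hg
  exact ⟨Ψ - Ψ', h1.sub h1', fun v => by rw [Pi.sub_apply, h2, h2', map_sub]⟩

theorem mul (hf : IsFormIn k φ d f) (hg : IsFormIn k φ d' g) :
    IsFormIn k φ (d + d') (f * g) := by
  obtain ⟨Ψ, h1, h2⟩ := hf
  obtain ⟨Ψ', h1', h2'⟩ := hg
  exact ⟨Ψ * Ψ', h1.mul h1', fun v => by rw [Pi.mul_apply, h2, h2', map_mul]⟩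

theorem one : IsFormIn k φ 0 1 :=
  ⟨1, isMultiHom_one, fun v => by rw [map_one]; rfl⟩

theorem pow (hf : IsFormIn k φ d f) (t : ℕ) : IsFormIn k φ (t • d) (f ^ t) := by
  induction t with
  | zero => exact one.congr (zero_smul ℕ d).symm fun v => by rw [pow_zero]
  | succ t ih => exact (ih.mul hf).congr (succ_nsmul d t).symm fun v => by rw [pow_succ]

theorem gen [DecidableEq κ] (a : Coord m) : IsFormIn k φ (Pi.single a.1 1) (φ a) :=
  ⟨X a, isMultiHom_X a, fun v => by rw [aeval_X]⟩

theorem half (hf : IsFormIn k φ d f) : IsFormIn k φ d fun v => f v / 2 := by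
  obtain ⟨Ψ, h1, h2⟩ := hf
  refine ⟨C (2⁻¹ : k) * Ψ, ((isMultiHom_C _).mul h1).congr (zero_add d), fun v => ?_⟩
  change f v / 2 = _
  rw [map_mul, aeval_C, h2, div_eq_inv_mul]
  simp
  exact Or.inl rfl

end IsFormIn

/-! ### The map from the product to the quotient of the box variety -/

/-- The coordinates `(Z₁, Z₂, W₁, W₂, W₃, C)` of the image of a pair of points of `E`. -/
def kumVec {R : Type} [CommRing R] (v w : Fin 4 → R) : Fin 6 → R :=
  ![v 2 * w 2 + v 3 * w 3, v 2 * w 2 - v 3 * w 3, v 2 * w 3 - v 3 * w 2, v 2 * w 3 + v 3 * w 2,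
    v 1 * w 1, v 0 * w 0]

theorem kumVec_smul (s t : ℂ) (v w : Fin 4 → ℂ) :
    kumVec (s • v) (t • w) = (s * t) • kumVec v w := by
  funext i
  fin_cases i <;> simp [kumVec] <;> ring

theorem kumVec_eq_iff {v w x y : Fin 4 → ℂ} : kumVec v w = kumVec x y ↔
    v 2 * w 2 = x 2 * y 2 ∧ v 3 * w 3 = x 3 * y 3 ∧ v 2 * w 3 = x 2 * y 3 ∧
      v 3 * w 2 = x 3 * y 2 ∧ v 1 * w 1 = x 1 * y 1 ∧ v 0 * w 0 = x 0 * y 0 := by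
  constructor
  · intro h
    have h0 : v 2 * w 2 + v 3 * w 3 = x 2 * y 2 + x 3 * y 3 := congrFun h 0
    have h1 : v 2 * w 2 - v 3 * w 3 = x 2 * y 2 - x 3 * y 3 := congrFun h 1
    have h2 : v 2 * w 3 - v 3 * w 2 = x 2 * y 3 - x 3 * y 2 := congrFun h 2
    have h3 : v 2 * w 3 + v 3 * w 2 = x 2 * y 3 + x 3 * y 2 := congrFun h 3
    have h4 : v 1 * w 1 = x 1 * y 1 := congrFun h 4
    have h5 : v 0 * w 0 = x 0 * y 0 := congrFun h 5
    refine ⟨?_, ?_, ?_, ?_, h4, h5⟩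
    · linear_combination (h0 + h1) / 2
    · linear_combination (h0 - h1) / 2
    · linear_combination (h3 + h2) / 2
    · linear_combination (h3 - h2) / 2
  · rintro ⟨h1, h2, h3, h4, h5, h6⟩
    simp only [kumVec, h1, h2, h3, h4, h5, h6]

theorem kumVec_ne_zero {v w : Fin 4 → ℂ} (hv : OnE v) (hv0 : v ≠ 0) (hw : OnE w) (hw0 : w ≠ 0) :
    kumVec v w ≠ 0 := by
  intro h
  have h0 : kumVec v w = kumVec 0 0 := h.trans (by funext i; fin_cases i <;> simp [kumVec])
  obtain ⟨h1, h2, h3, h4, -, -⟩ := kumVec_eq_iff.1 h0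
  simp only [Pi.zero_apply, mul_zero] at h1 h2 h3 h4
  rcases hv.tail_ne_zero hv0 with hc | hc <;> rcases hw.tail_ne_zero hw0 with hd | hd
  exacts [mul_ne_zero hc hd h1, mul_ne_zero hc hd h3, mul_ne_zero hc hd h4, mul_ne_zero hc hd h2]

theorem mem_boxQuot_of_line {P : Proj 5} {x : Fin 6 → ℂ} (h0 : x ≠ 0) (hx : x ∈ line P)
    (h1 : x 2 ^ 2 + x 4 ^ 2 = x 1 ^ 2) (h2 : x 3 ^ 2 + x 4 ^ 2 = x 0 ^ 2)
    (h3 : x 2 ^ 2 + x 3 ^ 2 + x 4 ^ 2 = x 5 ^ 2) : P ∈ boxQuot := by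
  obtain ⟨c, rfl⟩ := mem_line_iff.1 hx
  have hc : c ^ 2 ≠ 0 := pow_ne_zero _ fun hc => h0 (by rw [hc, zero_smul])
  simp only [Pi.smul_apply, smul_eq_mul] at h1 h2 h3
  refine ⟨?_, ?_, ?_⟩ <;> refine mul_left_cancel₀ hc ?_
  · linear_combination h1
  · linear_combination h2
  · linear_combination h3

theorem mkPt_kumVec_mem {v w : Fin 4 → ℂ} (hv : OnE v) (hw : OnE w) (h0 : kumVec v w ≠ 0) :
    mkPt (kumVec v w) h0 ∈ boxQuot := by
  obtain ⟨h1, h2⟩ := hv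
  obtain ⟨h3, h4⟩ := hw
  refine mem_boxQuot_of_line h0 (mkPt_mem_line _ _) ?_ ?_ ?_
  · change (v 2 * w 3 - v 3 * w 2) ^ 2 + (v 1 * w 1) ^ 2 = (v 2 * w 2 - v 3 * w 3) ^ 2
    rw [mul_pow, h2, h4]
    ring
  · change (v 2 * w 3 + v 3 * w 2) ^ 2 + (v 1 * w 1) ^ 2 = (v 2 * w 2 + v 3 * w 3) ^ 2
    rw [mul_pow, h2, h4]
    ring
  · change (v 2 * w 3 - v 3 * w 2) ^ 2 + (v 2 * w 3 + v 3 * w 2) ^ 2 + (v 1 * w 1) ^ 2 =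
      (v 0 * w 0) ^ 2
    rw [mul_pow, mul_pow, h1, h2, h3, h4]
    ring

theorem kumVec_crd_ne_zero (P Q : curveE) : kumVec (crd P.1) (crd Q.1) ≠ 0 :=
  kumVec_ne_zero (onE_of_mem_line P.2 (crd_mem_line _)) (crd_ne_zero _)
    (onE_of_mem_line Q.2 (crd_mem_line _)) (crd_ne_zero _)

/-- The map `E × E → B / σ`. -/
def kumMap (p : surfEE) : boxQuot :=
  ⟨_, mkPt_kumVec_mem (onE_of_mem_line (prodVarEquiv _ _ p).1.2 (crd_mem_line _))
    (onE_of_mem_line (prodVarEquiv _ _ p).2.2 (crd_mem_line _))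
    (kumVec_crd_ne_zero (prodVarEquiv _ _ p).1 (prodVarEquiv _ _ p).2)⟩

theorem kumMap_line {p : surfEE} {v w : Fin 4 → ℂ} (hv : v ∈ line (prodVarEquiv _ _ p).1.1)
    (hw : w ∈ line (prodVarEquiv _ _ p).2.1) : kumVec v w ∈ line (kumMap p).1 := by
  obtain ⟨c, rfl⟩ := mem_line_iff.1 hv
  obtain ⟨c', rfl⟩ := mem_line_iff.1 hw
  rw [kumVec_smul]
  exact Submodule.smul_mem _ _ (mkPt_mem_line _ _)

/-- A two by two matrix of determinant zero has rank at most one. -/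
theorem exists_rank_one {m n p q : ℂ} (h : m * n = p * q) :
    ∃ c d c' d' : ℂ, c * c' = m ∧ d * d' = n ∧ c * d' = p ∧ d * c' = q := by
  by_cases hm : m = 0
  · by_cases hp : p = 0
    · exact ⟨0, 1, q, n, by simp [hm], by simp, by simp [hp], by simp⟩
    · refine ⟨p, n, 0, 1, by simp [hm], by simp, by simp, ?_⟩
      rw [hm, zero_mul] at h
      rw [mul_zero]
      exact ((mul_eq_zero.1 h.symm).resolve_left hp).symm
  · exact ⟨m, q, 1, p / m, by simp, by field_simp; linear_combination -h, by field_simp, by simp⟩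

theorem exists_sqrt_mul {A A' C : ℂ} (h : A * A' = C ^ 2) :
    ∃ a a' : ℂ, a ^ 2 = A ∧ a' ^ 2 = A' ∧ a * a' = C := by
  obtain ⟨a, ha⟩ := IsAlgClosed.exists_pow_nat_eq A (n := 2) (by norm_num)
  obtain ⟨a', ha'⟩ := IsAlgClosed.exists_pow_nat_eq A' (n := 2) (by norm_num)
  have : (a * a') ^ 2 = C ^ 2 := by rw [mul_pow, ha, ha', h]
  rcases sq_eq_sq_iff_eq_or_eq_neg.1 this with h1 | h1
  · exact ⟨a, a', ha, ha', h1⟩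
  · exact ⟨-a, a', by rw [neg_sq, ha], ha', by rw [neg_mul, h1, neg_neg]⟩

theorem kumMap_surjective : Function.Surjective kumMap := by
  intro Y
  have hx0 : crd Y.1 ≠ 0 := crd_ne_zero _
  obtain ⟨h1, h2, h3⟩ := Y.2
  set x := crd Y.1 with hx
  obtain ⟨c, d, c', d', hm, hn, hp, hq⟩ := exists_rank_one (m := (x 0 + x 1) / 2)
    (n := (x 0 - x 1) / 2) (p := (x 3 + x 2) / 2) (q := (x 3 - x 2) / 2)
    (by linear_combination (h1 - h2) / 4)
  obtain ⟨a, a', ha, ha', haa⟩ := exists_sqrt_mul (A := c ^ 2 + d ^ 2) (A' := c' ^ 2 + d' ^ 2)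
    (C := x 5) (by
      calc _ = (c * c') ^ 2 + (d * d') ^ 2 + (c * d') ^ 2 + (d * c') ^ 2 := by ring
        _ = _ := by
          rw [hm, hn, hp, hq]
          linear_combination h3 - h1 / 2 - h2 / 2)
  obtain ⟨b, b', hb, hb', hbb⟩ := exists_sqrt_mul (A := c ^ 2 - d ^ 2) (A' := c' ^ 2 - d' ^ 2)
    (C := x 4) (by
      calc _ = (c * c') ^ 2 + (d * d') ^ 2 - (c * d') ^ 2 - (d * c') ^ 2 := by ring
        _ = _ := by
          rw [hm, hn, hp, hq]
          linear_combination - h1 / 2 - h2 / 2)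
  have hkum : kumVec ![a, b, c, d] ![a', b', c', d'] = x := by
    funext i
    fin_cases i
    · change c * c' + d * d' = x 0
      rw [hm, hn]
      ring
    · change c * c' - d * d' = x 1
      rw [hm, hn]
      ring
    · change c * d' - d * c' = x 2
      rw [hp, hq]
      ring
    · change c * d' + d * c' = x 3
      rw [hp, hq]
      ring
    · exact hbb
    · exact haa
  have hv0 : ![a, b, c, d] ≠ 0 := fun h => hx0 (by
    rw [← hkum, h]
    funext i
    fin_cases i <;> simp [kumVec])
  have hw0 : ![a', b', c', d'] ≠ 0 := fun h => hx0 (by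
    rw [← hkum, h]
    funext i
    fin_cases i <;> simp [kumVec])
  refine ⟨(prodVarEquiv _ _).symm (curvePt _ hv0 ⟨ha, hb⟩, curvePt _ hw0 ⟨ha', hb'⟩),
    Subtype.ext (eq_of_mem_line hx0 ?_ (crd_mem_line _))⟩
  have := kumMap_line (p := (prodVarEquiv _ _).symm (curvePt _ hv0 ⟨ha, hb⟩,
    curvePt _ hw0 ⟨ha', hb'⟩)) (mkPt_mem_line _ hv0) (mkPt_mem_line _ hw0)
  rwa [hkum] at this

/-- Two factorizations of the same nonzero matrix of rank one are proportional. -/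
theorem rank_one_unique {c d c' d' e f e' f' : ℂ} (h0 : c ≠ 0 ∨ d ≠ 0) (h0' : c' ≠ 0 ∨ d' ≠ 0)
    (h1 : c * c' = e * e') (h2 : d * d' = f * f') (h3 : c * d' = e * f') (h4 : d * c' = f * e') :
    ∃ t : ℂ, t ≠ 0 ∧ e = t * c ∧ f = t * d ∧ c' = t * e' ∧ d' = t * f' := by
  have hdet : e * d = f * c := by
    rcases h0' with h | h
    · refine mul_right_cancel₀ h ?_
      linear_combination e * h4 - f * h1
    · refine mul_right_cancel₀ h ?_
      linear_combination e * h2 - f * h3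
  have hef : e ≠ 0 ∨ f ≠ 0 := by
    by_contra! h
    simp only [h.1, h.2, zero_mul, mul_eq_zero] at h1 h2 h3 h4
    tauto
  have key : ∃ t, e = t * c ∧ f = t * d := by
    rcases h0 with h | h
    · exact ⟨e / c, by field_simp, by field_simp; linear_combination -hdet⟩
    · exact ⟨f / d, by field_simp; linear_combination hdet, by field_simp⟩
  obtain ⟨t, rfl, rfl⟩ := key
  have ht : t ≠ 0 := by
    rintro rfl
    simp at hef
  refine ⟨t, ht, rfl, rfl, ?_, ?_⟩
  · rcases h0 with h | h <;> refine mul_left_cancel₀ h ?_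
    · linear_combination h1
    · linear_combination h4
  · rcases h0 with h | h <;> refine mul_left_cancel₀ h ?_
    · linear_combination h3
    · linear_combination h2

/-- Two pairs of numbers with the same squares and the same product agree up to a common sign. -/
theorem exists_common_sign {a a' e e' : ℂ} (h : e ^ 2 = a ^ 2) (h' : e' ^ 2 = a' ^ 2)
    (hm : e * e' = a * a') : ∃ s : ℤˣ, e = ((s : ℤ) : ℂ) * a ∧ e' = ((s : ℤ) : ℂ) * a' := by
  by_cases h0 : a = 0
  · have he : e = 0 := by
      rw [h0, zero_pow two_ne_zero] at h
      exact pow_eq_zero_iff two_ne_zero |>.1 h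
    rcases sq_eq_sq_iff_eq_or_eq_neg.1 h' with h1 | h1
    · exact ⟨1, by simp [h0, he], by simp [h1]⟩
    · exact ⟨-1, by simp [h0, he], by simp [h1]⟩
  · rcases sq_eq_sq_iff_eq_or_eq_neg.1 h with h1 | h1
    · refine ⟨1, by simp [h1], mul_left_cancel₀ h0 ?_⟩
      rw [h1] at hm
      simp [hm]
    · refine ⟨-1, by simp [h1], mul_left_cancel₀ h0 ?_⟩
      rw [h1] at hm
      simp
      linear_combination -hm

theorem curveSign_neg (ε : Fin 4 → ℤˣ) : curveSign (-ε) = curveSign ε := by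
  ext1 P
  refine Subtype.ext (eq_of_mem_line (x := fun j => ((ε j : ℤ) : ℂ) * crd P.1 j) ?_ ?_
    (signed_mem_line (crd_mem_line P.1)))
  · intro h
    refine crd_ne_zero P.1 (funext fun j => ?_)
    have hj := congrFun h j
    rcases Int.units_eq_one_or (ε j) with hs | hs <;> simpa [hs] using hj
  · have h := Submodule.neg_mem _ (signed_mem_line (ε := -ε) (crd_mem_line P.1))
    convert h using 1
    funext j
    simp

theorem diagPerm_curveSign_mem (s t : ℤˣ) : diagPerm (curveSign ![s, t, 1, 1]) ∈ groupH := by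
  rw [← SetLike.mem_coe, groupH_coe]
  refine Set.mem_image_of_mem _ ?_
  rcases Int.units_eq_one_or s with rfl | rfl <;> rcases Int.units_eq_one_or t with rfl | rfl
  · exact Or.inl (congrArg _ (by decide))
  · exact Or.inr (Or.inl rfl)
  · refine Or.inr (Or.inr (Or.inr ?_))
    rw [Set.mem_singleton_iff, ← curveSign_neg]
    exact congrArg _ (by decide)
  · refine Or.inr (Or.inr (Or.inl ?_))
    rw [← curveSign_neg]
    exact congrArg _ (by decide)

theorem kumMap_diagPerm {ε : Fin 4 → ℤˣ} (h23 : ε 2 = ε 3) (p : surfEE) :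
    kumMap (diagPerm (curveSign ε) p) = kumMap p := by
  refine Subtype.ext (eq_of_mem_line (kumVec_crd_ne_zero (prodVarEquiv _ _ p).1
    (prodVarEquiv _ _ p).2) ?_ (kumMap_line (crd_mem_line _) (crd_mem_line _)))
  have h := kumMap_line (p := diagPerm (curveSign ε) p)
    (signed_mem_line (ε := ε) (crd_mem_line (prodVarEquiv _ _ p).1.1))
    (signed_mem_line (ε := ε) (crd_mem_line (prodVarEquiv _ _ p).2.1))
  convert h using 1
  have e0 := sign_mul_self (ε 0)
  have e1 := sign_mul_self (ε 1)
  have e2 := sign_mul_self (ε 3)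
  refine kumVec_eq_iff.2 ⟨?_, ?_, ?_, ?_, ?_, ?_⟩
  · rw [h23]
    linear_combination -crd (prodVarEquiv _ _ p).1.1 2 * crd (prodVarEquiv _ _ p).2.1 2 * e2
  · linear_combination -crd (prodVarEquiv _ _ p).1.1 3 * crd (prodVarEquiv _ _ p).2.1 3 * e2
  · rw [h23]
    linear_combination -crd (prodVarEquiv _ _ p).1.1 2 * crd (prodVarEquiv _ _ p).2.1 3 * e2
  · rw [h23]
    linear_combination -crd (prodVarEquiv _ _ p).1.1 3 * crd (prodVarEquiv _ _ p).2.1 2 * e2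
  · linear_combination -crd (prodVarEquiv _ _ p).1.1 1 * crd (prodVarEquiv _ _ p).2.1 1 * e1
  · linear_combination -crd (prodVarEquiv _ _ p).1.1 0 * crd (prodVarEquiv _ _ p).2.1 0 * e0

theorem kumMap_eq_iff (p q : surfEE) : kumMap p = kumMap q ↔ ∃ g ∈ groupH, g p = q := by
  constructor
  · intro h
    have hp := kumMap_line (crd_mem_line (prodVarEquiv _ _ p).1.1)
      (crd_mem_line (prodVarEquiv _ _ p).2.1)
    have hq := kumMap_line (crd_mem_line (prodVarEquiv _ _ q).1.1)
      (crd_mem_line (prodVarEquiv _ _ q).2.1)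
    have hp0 := kumVec_crd_ne_zero (prodVarEquiv _ _ p).1 (prodVarEquiv _ _ p).2
    have hq0 := kumVec_crd_ne_zero (prodVarEquiv _ _ q).1 (prodVarEquiv _ _ q).2
    obtain ⟨P, Q, rfl⟩ : ∃ P Q, p = (prodVarEquiv _ _).symm (P, Q) :=
      ⟨_, _, ((prodVarEquiv _ _).symm_apply_apply p).symm⟩
    obtain ⟨P', Q', rfl⟩ : ∃ P Q, q = (prodVarEquiv _ _).symm (P, Q) :=
      ⟨_, _, ((prodVarEquiv _ _).symm_apply_apply q).symm⟩
    simp only [Equiv.apply_symm_apply] at hp hq hp0 hq0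
    have hvE := onE_of_mem_line P.2 (crd_mem_line P.1)
    have hwE := onE_of_mem_line Q.2 (crd_mem_line Q.1)
    have hvE' := onE_of_mem_line P'.2 (crd_mem_line P'.1)
    have hwE' := onE_of_mem_line Q'.2 (crd_mem_line Q'.1)
    have hv0 := crd_ne_zero P.1
    have hw0 := crd_ne_zero Q.1
    rw [← h] at hq
    obtain ⟨s, hs⟩ : ∃ s : ℂ, kumVec (crd P'.1) (crd Q'.1) = s • kumVec (crd P.1) (crd Q.1) := by
      obtain ⟨c, hc⟩ := mem_line_iff.1 hp
      obtain ⟨c', hc'⟩ := mem_line_iff.1 hq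
      have hc0 : c ≠ 0 := fun h => hp0 (by rw [hc, h, zero_smul])
      exact ⟨c' * c⁻¹, by rw [hc, hc', smul_smul, inv_mul_cancel_right₀ hc0]⟩
    have hs0 : s ≠ 0 := fun h => hq0 (by rw [hs, h, zero_smul])
    have hs' : kumVec (s • crd P.1) (crd Q.1) = kumVec (crd P'.1) (crd Q'.1) := by
      have := kumVec_smul s 1 (crd P.1) (crd Q.1)
      rw [one_smul, mul_one] at this
      rw [this, hs]
    obtain ⟨k1, k2, k3, k4, k5, k6⟩ := kumVec_eq_iff.1 hs'
    simp only [Pi.smul_apply, smul_eq_mul] at k1 k2 k3 k4 k5 k6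
    have hvt : s * crd P.1 2 ≠ 0 ∨ s * crd P.1 3 ≠ 0 :=
      (hvE.tail_ne_zero hv0).imp (mul_ne_zero hs0) (mul_ne_zero hs0)
    obtain ⟨t, ht, t1, t2, t3, t4⟩ := rank_one_unique hvt (hwE.tail_ne_zero hw0) k1 k2 k3 k4
    obtain ⟨α, a1, a2⟩ := exists_common_sign (a := t * s * crd P.1 0) (a' := t⁻¹ * crd Q.1 0)
      (e := crd P'.1 0) (e' := crd Q'.1 0) (by
        rw [hvE'.1, mul_pow, hvE.1, t1, t2]
        ring) (by
        rw [hwE'.1, mul_pow, hwE.1, t3, t4]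
        field_simp) (by
        rw [← k6]
        field_simp)
    obtain ⟨β, b1, b2⟩ := exists_common_sign (a := t * s * crd P.1 1) (a' := t⁻¹ * crd Q.1 1)
      (e := crd P'.1 1) (e' := crd Q'.1 1) (by
        rw [hvE'.2, mul_pow, hvE.2, t1, t2]
        ring) (by
        rw [hwE'.2, mul_pow, hwE.2, t3, t4]
        field_simp) (by
        rw [← k5]
        field_simp)
    refine ⟨_, diagPerm_curveSign_mem α β, congrArg (prodVarEquiv _ _).symm (Prod.ext ?_ ?_)⟩
    · refine Subtype.ext (eq_of_mem_line (crd_ne_zero P'.1) ?_ (crd_mem_line _))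
      change _ ∈ line (curveSign ![α, β, 1, 1] P).1
      convert Submodule.smul_mem _ (t * s)
        (signed_mem_line (ε := ![α, β, 1, 1]) (crd_mem_line P.1)) using 1
      funext i
      fin_cases i <;> simp
      · rw [a1]; ring
      · rw [b1]; ring
      · rw [t1]; ring
      · rw [t2]; ring
    · refine Subtype.ext (eq_of_mem_line (crd_ne_zero Q'.1) ?_ (crd_mem_line _))
      change _ ∈ line (curveSign ![α, β, 1, 1] Q).1
      convert Submodule.smul_mem _ t⁻¹
        (signed_mem_line (ε := ![α, β, 1, 1]) (crd_mem_line Q.1)) using 1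
      funext i
      fin_cases i <;> simp
      · rw [a2]; ring
      · rw [b2]; ring
      · rw [t3, inv_mul_cancel_left₀ ht]
      · rw [t4, inv_mul_cancel_left₀ ht]
  · rintro ⟨g, hg, rfl⟩
    have hg' : g ∈ (groupH : Set (Equiv.Perm surfEE)) := hg
    rw [groupH_coe] at hg'
    obtain ⟨f, hf, rfl⟩ := hg'
    rcases hf with rfl | rfl | rfl | rfl <;> exact (kumMap_diagPerm rfl p).symm


/-- The forms that define the map `E × E → B / σ`. -/
def kumForms (k : IntermediateField ℚ ℂ) (a : Coord (fun _ : Unit => 5)) :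
    MvPolynomial (Coord (Sum.elim (fun _ : Unit => 3) fun _ : Unit => 3)) k :=
  kumVec (fun j => X ⟨Sum.inl (), j⟩) (fun j => X ⟨Sum.inr (), j⟩) a.2

theorem map_kumVec {R S : Type} [CommRing R] [CommRing S] (f : R →+* S) (v w : Fin 4 → R)
    (i : Fin 6) : f (kumVec v w i) = kumVec (fun j => f (v j)) (fun j => f (w j)) i := by
  fin_cases i <;> simp [kumVec]

theorem aeval_kumForms {k : IntermediateField ℚ ℂ}
    (x : Coord (Sum.elim (fun _ : Unit => 3) fun _ : Unit => 3) → ℂ) :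
    (fun a => aeval x (kumForms k a)) =
      fun a => kumVec (fun j => x ⟨Sum.inl (), j⟩) (fun j => x ⟨Sum.inr (), j⟩) a.2 := by
  funext a
  refine (map_kumVec (aeval (R := k) x).toRingHom _ _ a.2).trans ?_
  congr 1 <;> funext j <;> exact aeval_X _ _

section Segre

variable {k : IntermediateField ℚ ℂ} {α : Type} {φ : Coord (fun _ : Unit => 5) → α → ℂ}
  {v w : α → Fin 4 → ℂ} (hφ : ∀ i x, φ ⟨(), i⟩ x = kumVec (v x) (w x) i)

include hφ

/-- The products of coordinates are linear combinations of the six forms. -/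
theorem isFormIn_entry : IsFormIn k φ (fun _ => 1) (fun x => v x 2 * w x 2) ∧
    IsFormIn k φ (fun _ => 1) (fun x => v x 3 * w x 3) ∧
    IsFormIn k φ (fun _ => 1) (fun x => v x 2 * w x 3) ∧
    IsFormIn k φ (fun _ => 1) (fun x => v x 3 * w x 2) ∧
    IsFormIn k φ (fun _ => 1) (fun x => v x 1 * w x 1) ∧
    IsFormIn k φ (fun _ => 1) (fun x => v x 0 * w x 0) := by
  have g : ∀ i, IsFormIn k φ (fun _ => 1) (fun x => kumVec (v x) (w x) i) := fun i =>
    (IsFormIn.gen ⟨(), i⟩).congr (by funext u; simp) (hφ i)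
  refine ⟨((g 0).add (g 1)).half.congr rfl fun x => ?_,
    ((g 0).sub (g 1)).half.congr rfl fun x => ?_, ((g 3).add (g 2)).half.congr rfl fun x => ?_,
    ((g 3).sub (g 2)).half.congr rfl fun x => ?_, g 4, g 5⟩ <;> simp [kumVec]

/-- A monomial of the same degree in `c, d` and in `c', d'` is a form in the products
`cc', dd', cd', dc'`. -/
theorem isFormIn_segre (r : ℕ) : ∀ i j i' j' : ℕ, i + j = r → i' + j' = r →
    IsFormIn k φ (fun _ => r) fun x => v x 2 ^ i * v x 3 ^ j * (w x 2 ^ i' * w x 3 ^ j') := by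
  obtain ⟨h1, h2, h3, h4, -, -⟩ := isFormIn_entry (k := k) hφ
  induction r with
  | zero =>
    intro i j i' j' h h'
    obtain ⟨rfl, rfl⟩ := Nat.add_eq_zero_iff.1 h
    obtain ⟨rfl, rfl⟩ := Nat.add_eq_zero_iff.1 h'
    exact IsFormIn.one.congr rfl fun x => by simp
  | succ r ih =>
    intro i j i' j' h h'
    rcases i with _ | i <;> rcases i' with _ | i'
    · obtain ⟨j, rfl⟩ : ∃ t, j = t + 1 := ⟨j - 1, by omega⟩
      obtain ⟨j', rfl⟩ : ∃ t, j' = t + 1 := ⟨j' - 1, by omega⟩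
      exact ((ih 0 j 0 j' (by omega) (by omega)).mul h2).congr rfl fun x => by
        simp only [Pi.mul_apply]; ring
    · obtain ⟨j, rfl⟩ : ∃ t, j = t + 1 := ⟨j - 1, by omega⟩
      exact ((ih 0 j i' j' (by omega) (by omega)).mul h4).congr rfl fun x => by
        simp only [Pi.mul_apply]; ring
    · obtain ⟨j', rfl⟩ : ∃ t, j' = t + 1 := ⟨j' - 1, by omega⟩
      exact ((ih i j 0 j' (by omega) (by omega)).mul h3).congr rfl fun x => by
        simp only [Pi.mul_apply]; ring
    · exact ((ih i j i' j' (by omega) (by omega)).mul h1).congr rfl fun x => by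
        simp only [Pi.mul_apply]; ring

/-- A product of powers of `c² ± d²` and a monomial in `c, d`, times the same in `c', d'`, of the
same total degrees, is a form in `cc', dd', cd', dc'`. -/
theorem isFormIn_segre_squares (s t : ℕ) : ∀ s' t' r i j i' j' : ℕ,
    2 * s + 2 * t + i + j = r → 2 * s' + 2 * t' + i' + j' = r →
    IsFormIn k φ (fun _ => r) fun x =>
      (v x 2 ^ 2 + v x 3 ^ 2) ^ s * (v x 2 ^ 2 - v x 3 ^ 2) ^ t * (v x 2 ^ i * v x 3 ^ j) *
      ((w x 2 ^ 2 + w x 3 ^ 2) ^ s' * (w x 2 ^ 2 - w x 3 ^ 2) ^ t' *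
        (w x 2 ^ i' * w x 3 ^ j')) := by
  induction s with
  | succ s ih =>
    intro s' t' r i j i' j' h h'
    exact ((ih s' t' r (i + 2) j i' j' (by omega) h').add
      (ih s' t' r i (j + 2) i' j' (by omega) h')).congr rfl fun x => by
        simp only [Pi.add_apply]; ring
  | zero =>
  induction t with
  | succ t ih =>
    intro s' t' r i j i' j' h h'
    exact ((ih s' t' r (i + 2) j i' j' (by omega) h').sub
      (ih s' t' r i (j + 2) i' j' (by omega) h')).congr rfl fun x => by
        simp only [Pi.sub_apply]; ring
  | zero =>
  intro s'
  induction s' with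
  | succ s' ih =>
    intro t' r i j i' j' h h'
    exact ((ih t' r i j (i' + 2) j' h (by omega)).add
      (ih t' r i j i' (j' + 2) h (by omega))).congr rfl fun x => by
        simp only [Pi.add_apply]; ring
  | zero =>
  intro t'
  induction t' with
  | succ t' ih =>
    intro r i j i' j' h h'
    exact ((ih r i j (i' + 2) j' h (by omega)).sub
      (ih r i j i' (j' + 2) h (by omega))).congr rfl fun x => by
        simp only [Pi.sub_apply]; ring
  | zero =>
    intro r i j i' j' h h'
    exact (isFormIn_segre hφ r i j i' j' (by omega) (by omega)).congr rfl fun x => by ring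

/-- On `E × E`, a monomial of bidegree `(r, r)` that is even in `a, a'` and in `b, b'` is a form in
the coordinates of `B / σ`. -/
theorem isFormIn_of_even (hv : ∀ x, OnE (v x)) (hw : ∀ x, OnE (w x)) {e e' : Fin 4 → ℕ} {r : ℕ}
    (he : e 0 + e 1 + e 2 + e 3 = r) (he' : e' 0 + e' 1 + e' 2 + e' 3 = r)
    (h0 : Even (e 0 + e' 0)) (h1 : Even (e 1 + e' 1)) :
    IsFormIn k φ (fun _ => r) fun x => (∏ j, v x j ^ e j) * ∏ j, w x j ^ e' j := by
  have hsplit : ∀ i i' : ℕ, Even (i + i') → ∃ z u u', i = z + 2 * u ∧ i' = z + 2 * u' := by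
    rintro i i' ⟨t, ht⟩
    rcases le_total i i' with h | h
    · exact ⟨i, 0, t - i, by omega, by omega⟩
    · exact ⟨i', t - i', 0, by omega, by omega⟩
  obtain ⟨z, u, u', hz, hz'⟩ := hsplit _ _ h0
  obtain ⟨y, t, t', hy, hy'⟩ := hsplit _ _ h1
  obtain ⟨-, -, -, -, g4, g5⟩ := isFormIn_entry (k := k) hφ
  refine (((g5.pow z).mul (g4.pow y)).mul (isFormIn_segre_squares hφ u t u' t' (r - z - y)
    (e 2) (e 3) (e' 2) (e' 3) (by omega) (by omega))).congr ?_ fun x => ?_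
  · funext i
    simp
    omega
  · simp only [Pi.mul_apply, Pi.pow_apply, Fin.prod_univ_four]
    rw [← (hv x).1, ← (hv x).2, ← (hw x).1, ← (hw x).2, hz, hz', hy, hy']
    ring

end Segre

theorem kumMap_isSignQuotient (k : IntermediateField ℚ ℂ) :
    IsSignQuotient k [diagSign ![1, -1, 1, 1], diagSign ![1, 1, -1, -1]] kumMap (kumForms k) where
  surjective := kumMap_surjective
  lift ε hε v := by
    simp only [List.mem_cons, List.not_mem_nil, or_false] at hε
    rcases hε with rfl | rfl <;> exact ⟨_, kumMap_diagPerm rfl v, isCoordOf_diagSign _ v⟩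
  forms := ⟨fun _ _ => 1, fun a => isMultiHom_of_aeval_rescale fun c x => by
    rw [congrFun (aeval_kumForms _) a, congrFun (aeval_kumForms _) a]
    have h := kumVec_smul (c (Sum.inl ())) (c (Sum.inr ())) (fun j => x ⟨Sum.inl (), j⟩)
      (fun j => x ⟨Sum.inr (), j⟩)
    refine (congrFun h a.2).trans ?_
    simp⟩
  coord v := by
    have h := aeval_kumForms (k := k) (homCoord v.1)
    change IsCoordOf (fun a => aeval (homCoord v.1) (kumForms k a)) _
    rw [h]
    exact isCoordOf_unit (kumVec_crd_ne_zero (prodVarEquiv _ _ v).1 (prodVarEquiv _ _ v).2)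
      (kumMap_line (crd_mem_line _) (crd_mem_line _))
  invariants p d := by
    obtain ⟨s, hs, hs0⟩ : ∃ s : Fin 4, (s = 2 ∨ s = 3) ∧ homCoord p.1 ⟨Sum.inl (), s⟩ ≠ 0 := by
      rcases (onE_of_mem_line (prodVarEquiv _ _ p).1.2 (crd_mem_line _)).tail_ne_zero
        (crd_ne_zero _) with h | h
      exacts [⟨2, Or.inl rfl, h⟩, ⟨3, Or.inr rfl, h⟩]
    obtain ⟨s', hs', hs0'⟩ : ∃ s : Fin 4, (s = 2 ∨ s = 3) ∧
        homCoord p.1 ⟨Sum.inr (), s⟩ ≠ 0 := by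
      rcases (onE_of_mem_line (prodVarEquiv _ _ p).2.2 (crd_mem_line _)).tail_ne_zero
        (crd_ne_zero _) with h | h
      exacts [⟨2, Or.inl rfl, h⟩, ⟨3, Or.inr rfl, h⟩]
    refine ⟨X ⟨Sum.inl (), s⟩ ^ (2 * d (Sum.inr ())) * X ⟨Sum.inr (), s'⟩ ^ (2 * d (Sum.inl ())),
      fun _ => 2 * d (Sum.inl ()) + 2 * d (Sum.inr ()), ?_, fun e he hε => ?_⟩
    · simp only [evalAt, map_mul, map_pow, aeval_X]
      exact mul_ne_zero (pow_ne_zero _ hs0) (pow_ne_zero _ hs0')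
    have hd1 := he (Sum.inl ())
    have hd2 := he (Sum.inr ())
    have hb := hε _ (List.mem_cons_self)
    have hc := hε _ (List.mem_cons_of_mem _ (List.mem_cons_self))
    rw [Fintype.prod_sigma, Fintype.prod_sum_type] at hb hc
    simp only [Finset.univ_unique, Finset.prod_singleton, PUnit.default_eq_unit] at hb hc
    set e₁ : Fin 4 → ℕ := fun j => e ⟨Sum.inl (), j⟩ with he₁
    set e₂ : Fin 4 → ℕ := fun j => e ⟨Sum.inr (), j⟩ with he₂
    have hd1 : e₁ 0 + e₁ 1 + e₁ 2 + e₁ 3 = 2 * d (Sum.inl ()) :=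
      (Fin.sum_univ_four e₁).symm.trans (he (Sum.inl ()))
    have hd2 : e₂ 0 + e₂ 1 + e₂ 2 + e₂ 3 = 2 * d (Sum.inr ()) :=
      (Fin.sum_univ_four e₂).symm.trans (he (Sum.inr ()))
    replace hb : (∏ j : Fin 4, (![1, -1, 1, 1] : Fin 4 → ℤˣ) j ^ e₁ j) *
      ∏ j : Fin 4, (![1, -1, 1, 1] : Fin 4 → ℤˣ) j ^ e₂ j = 1 := hb
    replace hc : (∏ j : Fin 4, (![1, 1, -1, -1] : Fin 4 → ℤˣ) j ^ e₁ j) *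
      ∏ j : Fin 4, (![1, 1, -1, -1] : Fin 4 → ℤˣ) j ^ e₂ j = 1 := hc
    simp only [Fin.prod_univ_four, Matrix.cons_val, one_pow, one_mul, mul_one, ← pow_add] at hb hc
    have hb' := even_of_neg_one_pow hb
    have hc' := even_of_neg_one_pow hc
    have ha' : Even (e₁ 0 + e₂ 0) := by
      rw [Nat.even_iff] at *
      omega
    -- multiply by powers of `c` or `d` and of `c'` or `d'` to make the two degrees equal
    obtain ⟨Ψ, h1, h2⟩ := isFormIn_of_even (k := k)
      (φ := fun a v => aeval (homCoord v.1) (kumForms k a))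
      (v := fun v : surfEE => crd (prodVarEquiv _ _ v).1.1) (w := fun v => crd (prodVarEquiv _ _ v).2.1)
      (fun i v => congrFun (aeval_kumForms _) ⟨(), i⟩)
      (fun v => onE_of_mem_line (prodVarEquiv _ _ v).1.2 (crd_mem_line _))
      (fun v => onE_of_mem_line (prodVarEquiv _ _ v).2.2 (crd_mem_line _))
      (e := e₁ + Pi.single s (2 * d (Sum.inr ()))) (e' := e₂ + Pi.single s' (2 * d (Sum.inl ())))
      (r := 2 * d (Sum.inl ()) + 2 * d (Sum.inr ()))
      (by rcases hs with rfl | rfl <;> simp <;> omega)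
      (by rcases hs' with rfl | rfl <;> simp <;> omega)
      (by rcases hs with rfl | rfl <;> rcases hs' with rfl | rfl <;> simpa using ha')
      (by rcases hs with rfl | rfl <;> rcases hs' with rfl | rfl <;> simpa using hb')
    refine ⟨Ψ, h1, fun v => (Eq.trans ?_ (h2 v))⟩
    rw [Fintype.prod_sigma, Fintype.prod_sum_type]
    simp only [Finset.univ_unique, Finset.prod_singleton, PUnit.default_eq_unit, evalAt, map_mul,
      map_pow, aeval_X, Pi.add_apply, pow_add, Finset.prod_mul_distrib]
    rw [Fintype.prod_eq_single (f := fun j => crd (prodVarEquiv _ _ v).1.1 j ^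
        (Pi.single s (2 * d (Sum.inr ())) : Fin 4 → ℕ) j) s
        (fun j hj => by rw [Pi.single_eq_of_ne hj, pow_zero]),
      Fintype.prod_eq_single (f := fun j => crd (prodVarEquiv _ _ v).2.1 j ^
        (Pi.single s' (2 * d (Sum.inl ())) : Fin 4 → ℕ) j) s'
        (fun j hj => by rw [Pi.single_eq_of_ne hj, pow_zero]), Pi.single_eq_same,
      Pi.single_eq_same]
    change crd (prodVarEquiv _ _ v).1.1 s ^ _ * crd (prodVarEquiv _ _ v).2.1 s' ^ _ *
      ((∏ j, crd (prodVarEquiv _ _ v).1.1 j ^ e₁ j) *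
        ∏ j, crd (prodVarEquiv _ _ v).2.1 j ^ e₂ j) = _
    ring

theorem curveE_closed_prod (k : IntermediateField ℚ ℂ) : IsClosedOver k surfEE :=
  (curveE_closed k).prodVar (curveE_closed k)

theorem kumMap_isQuotientBy (k : IntermediateField ℚ ℂ) : IsQuotientBy k groupH kumMap :=
  (kumMap_isSignQuotient k).isQuotientBy finite_groupH (groupH_regular k) (curveE_closed_prod k)
    (boxQuot_closed k) kumMap_eq_iff

/-! ### The quotient of the curve by `ρ` -/

/-- The two halves `(a, b)` and `(c, d)` of a coordinate vector. -/
def splitVec {R : Type} (v : Fin 4 → R) : Bool → Fin 2 → R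
  | true => ![v 0, v 1]
  | false => ![v 2, v 3]

/-- The curve `a² (c² - d²) = b² (c² + d²)` in `ℙ¹ × ℙ¹`, with coordinates `(a, b)` on the factor
`true` and `(c, d)` on the factor `false`. It is the quotient of `E` by `ρ`. -/
def splitE : Set (MultiProj (fun _ : Bool => 1)) :=
  {p | homCoord p ⟨true, 0⟩ ^ 2 * (homCoord p ⟨false, 0⟩ ^ 2 - homCoord p ⟨false, 1⟩ ^ 2) =
    homCoord p ⟨true, 1⟩ ^ 2 * (homCoord p ⟨false, 0⟩ ^ 2 + homCoord p ⟨false, 1⟩ ^ 2)}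

theorem splitE_closed (k : IntermediateField ℚ ℂ) : IsClosedOver k splitE := by
  refine isClosedOver_of_intForms (α := Unit) (d := fun _ _ => 2)
    (f := fun _ x => x ⟨true, 0⟩ ^ 2 * (x ⟨false, 0⟩ ^ 2 - x ⟨false, 1⟩ ^ 2) -
      x ⟨true, 1⟩ ^ 2 * (x ⟨false, 0⟩ ^ 2 + x ⟨false, 1⟩ ^ 2))
    (fun _ => ⟨⟨X ⟨true, 0⟩ ^ 2 * (X ⟨false, 0⟩ ^ 2 - X ⟨false, 1⟩ ^ 2) -
      X ⟨true, 1⟩ ^ 2 * (X ⟨false, 0⟩ ^ 2 + X ⟨false, 1⟩ ^ 2), fun x => by simp⟩, fun c x => by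
        simp [rescale]
        ring⟩) (fun p => ?_) k
  simp only [forall_const, sub_eq_zero]
  rfl

theorem OnE.split_relation {v : Fin 4 → ℂ} (h : OnE v) :
    v 0 ^ 2 * (v 2 ^ 2 - v 3 ^ 2) = v 1 ^ 2 * (v 2 ^ 2 + v 3 ^ 2) := by
  rw [h.1, h.2, mul_comm]

theorem vec2_ne_zero {x y : ℂ} (h : x ≠ 0 ∨ y ≠ 0) : ![x, y] ≠ 0 := by
  intro h0
  exact h.elim (fun h => h (congrFun h0 0)) fun h => h (congrFun h0 1)

theorem OnE.head_ne_zero {v : Fin 4 → ℂ} (h : OnE v) (hv : v ≠ 0) : v 0 ≠ 0 ∨ v 1 ≠ 0 := by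
  by_contra! h0
  obtain ⟨h1, h2⟩ := id h
  rw [h0.1] at h1
  rw [h0.2] at h2
  refine hv (vec4_eq_zero h0.1 h0.2 ?_ ?_) <;> refine pow_eq_zero_iff two_ne_zero |>.1 ?_
  · linear_combination -(h1 + h2) / 2
  · linear_combination (h2 - h1) / 2

theorem splitVec_ne_zero {v : Fin 4 → ℂ} (h : OnE v) (hv : v ≠ 0) (b : Bool) :
    splitVec v b ≠ 0 := by
  cases b
  · exact vec2_ne_zero (h.tail_ne_zero hv)
  · exact vec2_ne_zero (h.head_ne_zero hv)

theorem splitVec_smul (c : ℂ) (v : Fin 4 → ℂ) (b : Bool) : splitVec (c • v) b = c • splitVec v b := by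
  funext i
  cases b <;> fin_cases i <;> simp [splitVec]

theorem split_relation {p : MultiProj (fun _ : Bool => 1)} (hp : p ∈ splitE)
    {x : Bool → Fin 2 → ℂ} (hx : ∀ b, x b ∈ (p b).submodule) :
    x true 0 ^ 2 * (x false 0 ^ 2 - x false 1 ^ 2) =
      x true 1 ^ 2 * (x false 0 ^ 2 + x false 1 ^ 2) := by
  obtain ⟨s, hs⟩ := mem_submodule_iff.1 (hx true)
  obtain ⟨t, ht⟩ := mem_submodule_iff.1 (hx false)
  rw [hs, ht]
  simp only [Pi.smul_apply, smul_eq_mul]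
  have hp' : (p true).rep 0 ^ 2 * ((p false).rep 0 ^ 2 - (p false).rep 1 ^ 2) =
    (p true).rep 1 ^ 2 * ((p false).rep 0 ^ 2 + (p false).rep 1 ^ 2) := hp
  linear_combination s ^ 2 * t ^ 2 * hp'

theorem mem_splitE {p : MultiProj (fun _ : Bool => 1)} {x : Bool → Fin 2 → ℂ}
    (hx0 : ∀ b, x b ≠ 0) (hx : ∀ b, x b ∈ (p b).submodule)
    (h : x true 0 ^ 2 * (x false 0 ^ 2 - x false 1 ^ 2) =
      x true 1 ^ 2 * (x false 0 ^ 2 + x false 1 ^ 2)) : p ∈ splitE := by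
  obtain ⟨s, hs⟩ := mem_submodule_iff.1 (hx true)
  obtain ⟨t, ht⟩ := mem_submodule_iff.1 (hx false)
  have hs0 : s ≠ 0 := fun h => hx0 true (by rw [hs, h, zero_smul])
  have ht0 : t ≠ 0 := fun h => hx0 false (by rw [ht, h, zero_smul])
  rw [hs, ht] at h
  simp only [Pi.smul_apply, smul_eq_mul] at h
  refine mul_left_cancel₀ (mul_ne_zero (pow_ne_zero 2 hs0) (pow_ne_zero 2 ht0)) ?_
  change s ^ 2 * t ^ 2 * ((p true).rep 0 ^ 2 * ((p false).rep 0 ^ 2 - (p false).rep 1 ^ 2)) =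
    s ^ 2 * t ^ 2 * ((p true).rep 1 ^ 2 * ((p false).rep 0 ^ 2 + (p false).rep 1 ^ 2))
  linear_combination h

theorem crd_onE (P : curveE) : OnE (crd P.1) := onE_of_mem_line P.2 (crd_mem_line _)

/-- The quotient map of `E` by `ρ`. -/
def splitMap (P : curveE) : splitE :=
  ⟨fun b => Projectivization.mk ℂ _ (splitVec_ne_zero (crd_onE P) (crd_ne_zero _) b),
    mem_splitE (splitVec_ne_zero (crd_onE P) (crd_ne_zero _))
      (fun b => by rw [Projectivization.submodule_mk]; exact Submodule.mem_span_singleton_self _)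
      (crd_onE P).split_relation⟩

theorem splitMap_mem {P : curveE} {v : Fin 4 → ℂ} (hv : v ∈ line P.1) (b : Bool) :
    splitVec v b ∈ ((splitMap P).1 b).submodule := by
  obtain ⟨c, rfl⟩ := mem_line_iff.1 hv
  rw [splitVec_smul]
  refine Submodule.smul_mem _ _ ?_
  change _ ∈ (Projectivization.mk ℂ _ _).submodule
  rw [Projectivization.submodule_mk]
  exact Submodule.mem_span_singleton_self _

/-- A vector satisfying the equation of `splitE` becomes a vector on `E` when its first half
is rescaled. -/
theorem exists_onE_rescale {a b c d : ℂ} (h : a ^ 2 * (c ^ 2 - d ^ 2) = b ^ 2 * (c ^ 2 + d ^ 2))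
    (hab : a ≠ 0 ∨ b ≠ 0) (hcd : c ≠ 0 ∨ d ≠ 0) :
    ∃ t : ℂ, t ≠ 0 ∧ OnE ![t * a, t * b, c, d] := by
  have key : ∃ s : ℂ, s * a ^ 2 = c ^ 2 + d ^ 2 ∧ s * b ^ 2 = c ^ 2 - d ^ 2 := by
    by_cases ha : a = 0
    · have hb : b ≠ 0 := by tauto
      rw [ha, zero_pow two_ne_zero, zero_mul, eq_comm, mul_eq_zero] at h
      have h' := h.resolve_left (pow_ne_zero 2 hb)
      exact ⟨(c ^ 2 - d ^ 2) / b ^ 2, by rw [ha, h']; simp, by field_simp⟩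
    · exact ⟨(c ^ 2 + d ^ 2) / a ^ 2, by field_simp, by field_simp; linear_combination -h⟩
  obtain ⟨s, hs, hs'⟩ := key
  obtain ⟨t, rfl⟩ := IsAlgClosed.exists_pow_nat_eq s (n := 2) (by norm_num)
  have hE : OnE ![t * a, t * b, c, d] := by
    constructor
    · change (t * a) ^ 2 = c ^ 2 + d ^ 2
      rw [mul_pow, hs]
    · change (t * b) ^ 2 = c ^ 2 - d ^ 2
      rw [mul_pow, hs']
  refine ⟨t, ?_, hE⟩
  rintro rfl
  have hv : ![0 * a, 0 * b, c, d] ≠ 0 := fun h =>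
    hcd.elim (fun h' => h' (congrFun h 2)) fun h' => h' (congrFun h 3)
  rcases hE.head_ne_zero hv with h | h <;> exact h (zero_mul _)

theorem vec2_ne_zero_iff {x : Fin 2 → ℂ} : x ≠ 0 ↔ x 0 ≠ 0 ∨ x 1 ≠ 0 := by
  constructor
  · intro h
    by_contra! h0
    exact h (by funext i; fin_cases i; exacts [h0.1, h0.2])
  · rintro (h | h) rfl <;> exact h rfl

theorem exists_splitMap_eq {p : splitE} {x : Bool → Fin 2 → ℂ} (hx0 : ∀ b, x b ≠ 0)
    (hx : ∀ b, x b ∈ (p.1 b).submodule) :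
    ∃ (P : curveE) (v : Fin 4 → ℂ) (t : ℂ), splitMap P = p ∧ v ≠ 0 ∧ OnE v ∧ v ∈ line P.1 ∧
      t ≠ 0 ∧ v = ![t * x true 0, t * x true 1, x false 0, x false 1] := by
  have hf := vec2_ne_zero_iff.1 (hx0 false)
  obtain ⟨t, ht, hE⟩ := exists_onE_rescale (split_relation p.2 hx)
    (vec2_ne_zero_iff.1 (hx0 true)) hf
  have hv : ![t * x true 0, t * x true 1, x false 0, x false 1] ≠ 0 := fun h =>
    hf.elim (fun h' => h' (congrFun h 2)) fun h' => h' (congrFun h 3)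
  refine ⟨curvePt _ hv hE, _, t, ?_, hv, hE, mkPt_mem_line _ hv, ht, rfl⟩
  refine Subtype.ext (funext fun b => ?_)
  refine eq_of_mem_submodule (splitVec_ne_zero hE hv b)
    (splitMap_mem (P := curvePt _ hv hE) (mkPt_mem_line _ hv) b) ?_
  cases b
  · convert hx false using 1
    funext i
    fin_cases i <;> rfl
  · convert Submodule.smul_mem _ t (hx true) using 1
    funext i
    fin_cases i <;> rfl

theorem splitMap_surjective : Function.Surjective splitMap := fun p => by
  obtain ⟨P, -, -, h, -⟩ := exists_splitMap_eq (p := p) (fun b => (p.1 b).rep_nonzero)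
    fun b => mem_submodule_iff.2 ⟨1, (one_smul _ _).symm⟩
  exact ⟨P, h⟩

theorem splitMap_rho (P : curveE) : splitMap (rho P) = splitMap P := by
  refine Subtype.ext (funext fun b => ?_)
  refine eq_of_mem_submodule (splitVec_ne_zero (crd_onE P) (crd_ne_zero _) b) ?_
    (splitMap_mem (crd_mem_line _) b)
  have h := splitMap_mem (rho_line (crd_mem_line P.1)) b
  cases b
  · convert Submodule.neg_mem _ h using 1
    funext i
    fin_cases i <;> simp [splitVec]
  · exact h

theorem splitMap_eq_iff {P Q : curveE} : splitMap P = splitMap Q ↔ Q = P ∨ Q = rho P := by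
  constructor
  · intro h
    have hm := fun b => splitMap_mem (crd_mem_line Q.1) b
    rw [← h] at hm
    have hex : ∀ b, ∃ c : ℂ, splitVec (crd Q.1) b = c • splitVec (crd P.1) b := fun b => by
      obtain ⟨c, hc⟩ := mem_submodule_iff.1 (hm b)
      obtain ⟨c', hc'⟩ := mem_submodule_iff.1 (splitMap_mem (crd_mem_line P.1) b)
      have h0 : c' ≠ 0 := fun h =>
        splitVec_ne_zero (crd_onE P) (crd_ne_zero _) b (by rw [hc', h, zero_smul])
      exact ⟨c * c'⁻¹, by rw [hc, hc', smul_smul, inv_mul_cancel_right₀ h0]⟩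
    obtain ⟨s, hs⟩ := hex true
    obtain ⟨t, ht⟩ := hex false
    have s0 : crd Q.1 0 = s * crd P.1 0 := congrFun hs 0
    have s1 : crd Q.1 1 = s * crd P.1 1 := congrFun hs 1
    have t0 : crd Q.1 2 = t * crd P.1 2 := congrFun ht 0
    have t1 : crd Q.1 3 = t * crd P.1 3 := congrFun ht 1
    obtain ⟨p1, p2⟩ := crd_onE P
    obtain ⟨q1, q2⟩ := crd_onE Q
    have hst : s ^ 2 = t ^ 2 := by
      rw [s0, t0, t1] at q1
      rw [s1, t0, t1] at q2
      rcases (crd_onE P).head_ne_zero (crd_ne_zero _) with h0 | h0 <;>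
        refine mul_right_cancel₀ (pow_ne_zero 2 h0) ?_
      · linear_combination q1 - t ^ 2 * p1
      · linear_combination q2 - t ^ 2 * p2
    rcases sq_eq_sq_iff_eq_or_eq_neg.1 hst with rfl | rfl
    · refine Or.inl (Subtype.ext (eq_of_mem_line (crd_ne_zero Q.1) (crd_mem_line _)
        (mem_line_iff.2 ⟨s, ?_⟩)))
      funext i
      fin_cases i <;> assumption
    · refine Or.inr (Subtype.ext (eq_of_mem_line (crd_ne_zero Q.1) (crd_mem_line _) ?_))
      convert Submodule.smul_mem _ (-t) (rho_line (crd_mem_line P.1)) using 1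
      funext i
      fin_cases i <;> simp [s0, s1, t0, t1]
  · rintro (rfl | rfl)
    exacts [rfl, (splitMap_rho P).symm]

/-- The position in `(a, b, c, d)` of the coordinates of `ℙ¹ × ℙ¹`. -/
def splitIndex (b : Bool) (j : Fin 2) : Fin 4 := splitVec id b j

theorem splitVec_eq {R : Type} (v : Fin 4 → R) (b : Bool) (j : Fin 2) :
    splitVec v b j = v (splitIndex b j) := by
  cases b <;> fin_cases j <;> rfl

theorem splitMap_regular (k : IntermediateField ℚ ℂ) : IsRegularMap k splitMap := by
  refine isRegularMap_of_intForms (fun P b => ⟨fun _ => 1, fun x j => x ⟨(), splitIndex b j⟩,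
    fun j => ⟨⟨X _, fun x => aeval_X _ _⟩, fun c x => by simp [rescale]⟩, ?_, fun Q => ?_⟩) k
  · have h := splitVec_ne_zero (crd_onE P) (crd_ne_zero _) b
    intro h0
    exact h (funext fun j => (splitVec_eq _ b j).trans (congrFun h0 j))
  · have h := splitMap_mem (crd_mem_line Q.1) b
    convert h using 1
    exact funext fun j => (splitVec_eq _ b j).symm

/-! ### The quotient of the product by `ρ` acting on the first factor -/

/-- The index of the coordinate of `E × E` that is equal to a coordinate of
`splitE × E`. -/
def splitCoord : Coord (Sum.elim (fun _ : Bool => 1) fun _ : Unit => 3) →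
    Coord (Sum.elim (fun _ : Unit => 3) fun _ : Unit => 3)
  | ⟨Sum.inl b, j⟩ => ⟨Sum.inl (), splitIndex b j⟩
  | ⟨Sum.inr _, j⟩ => ⟨Sum.inr (), j⟩

/-- The quotient map of `E × E` by `ρ` acting on the first factor. -/
def splitMapLeft (p : surfEE) : prodVar splitE curveE :=
  (prodVarEquiv _ _).symm (splitMap (prodVarEquiv _ _ p).1, (prodVarEquiv _ _ p).2)

/-- The action of `ρ` on the first factor. -/
def rhoLeft : Equiv.Perm surfEE :=
  (prodVarEquiv _ _).trans ((rho.prodCongr (Equiv.refl _)).trans (prodVarEquiv _ _).symm)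

theorem rhoLeft_mul_self : rhoLeft * rhoLeft = 1 := by
  ext1 p
  refine (prodVarEquiv _ _).injective (Prod.ext ?_ rfl)
  exact congrArg (· (prodVarEquiv _ _ p).1) rho_mul_self

/-- The signs of the action of `ρ` on the first factor. -/
def signLeft : Coord (Sum.elim (fun _ : Unit => 3) fun _ : Unit => 3) → ℤˣ :=
  pairSign (fun a => (![1, 1, -1, -1] : Fin 4 → ℤˣ) a.2) 1

theorem isCoordOf_signLeft (p : surfEE) :
    IsCoordOf (signed signLeft (homCoord p.1)) (rhoLeft p).1 := by
  refine isCoordOf_pairSign (r := (prodVarEquiv _ _ p).2)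
    (isCoordOf_signPerm ![1, 1, -1, -1] (prodVarEquiv _ _ p).1.1) ?_
  convert isCoordOf_homCoord _ using 1
  funext a
  simp [signed]

theorem splitMapLeft_rhoLeft (p : surfEE) : splitMapLeft (rhoLeft p) = splitMapLeft p :=
  congrArg (prodVarEquiv splitE curveE).symm (Prod.ext (splitMap_rho _) rfl)

theorem splitMapLeft_eq_iff (p q : surfEE) :
    splitMapLeft p = splitMapLeft q ↔ ∃ g ∈ Subgroup.zpowers rhoLeft, g p = q := by
  rw [splitMapLeft, splitMapLeft, (prodVarEquiv splitE curveE).symm.apply_eq_iff_eq,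
    Prod.ext_iff, splitMap_eq_iff]
  constructor
  · rintro ⟨h | h, h'⟩
    · exact ⟨1, one_mem _, (prodVarEquiv _ _).injective (Prod.ext h.symm h')⟩
    · exact ⟨rhoLeft, Subgroup.mem_zpowers _, (prodVarEquiv _ _).injective (Prod.ext h.symm h')⟩
  · rintro ⟨g, hg, rfl⟩
    rcases (mem_zpowers_involution rhoLeft_mul_self).1 hg with rfl | rfl
    exacts [⟨Or.inl rfl, rfl⟩, ⟨Or.inr rfl, rfl⟩]

theorem splitMapLeft_surjective : Function.Surjective splitMapLeft := fun x => by
  obtain ⟨P, hP⟩ := splitMap_surjective (prodVarEquiv _ _ x).1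
  exact ⟨(prodVarEquiv _ _).symm (P, (prodVarEquiv _ _ x).2),
    (prodVarEquiv _ _).injective (Prod.ext hP rfl)⟩

theorem splitMapLeft_isSignQuotient (k : IntermediateField ℚ ℂ) :
    IsSignQuotient k [signLeft] splitMapLeft (fun a => X (splitCoord a)) where
  surjective := splitMapLeft_surjective
  lift ε hε v := by
    rw [List.mem_singleton.1 hε]
    exact ⟨_, splitMapLeft_rhoLeft v, isCoordOf_signLeft v⟩
  forms := by
    classical
    refine ⟨Sum.elim (fun _ => Pi.single (Sum.inl ()) 1) fun _ => Pi.single (Sum.inr ()) 1,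
      fun a => ?_⟩
    obtain ⟨i | i, j⟩ := a <;> exact isMultiHom_X _
  coord v := by
    rw [isCoordOf_iff]
    simp only [evalAt, aeval_X]
    rintro (b | u)
    · have h : (fun j => homCoord v.1 (splitCoord ⟨Sum.inl b, j⟩)) =
          splitVec (crd (prodVarEquiv _ _ v).1.1) b := funext fun j => (splitVec_eq _ b j).symm
      rw [h]
      exact ⟨splitVec_ne_zero (crd_onE _) (crd_ne_zero _) b, splitMap_mem (crd_mem_line _) b⟩
    · exact ⟨crd_ne_zero (prodVarEquiv _ _ v).2.1, crd_mem_line (prodVarEquiv _ _ v).2.1⟩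
  invariants p d := by
    classical
    set φ : Coord (Sum.elim (fun _ : Bool => 1) fun _ : Unit => 3) → surfEE → ℂ :=
      fun a v => evalAt (X (splitCoord a) : MvPolynomial _ k) v.1 with hφ
    set x : surfEE → Fin 4 → ℂ := fun v => crd (prodVarEquiv _ _ v).1.1 with hx
    set y : surfEE → Fin 4 → ℂ := fun v => crd (prodVarEquiv _ _ v).2.1 with hy
    have gen : ∀ b j, IsFormIn k φ (Pi.single (Sum.inl b) 1) fun v => x v (splitIndex b j) :=
      fun b j => (IsFormIn.gen ⟨Sum.inl b, j⟩).congr rfl fun v => by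
        simp only [hφ, evalAt, aeval_X]; rfl
    have gen' : ∀ j, IsFormIn k φ (Pi.single (Sum.inr ()) 1) fun v => y v j :=
      fun j => (IsFormIn.gen ⟨Sum.inr (), j⟩).congr rfl fun v => by
        simp only [hφ, evalAt, aeval_X]; rfl
    -- `2c² = a² + b²` and `2d² = a² - b²` are forms in either half of the coordinates
    obtain ⟨z, hz, h1, h2⟩ : ∃ z, x p z ≠ 0 ∧
        IsFormIn k φ (2 • Pi.single (Sum.inl true) 1) (fun v => x v z ^ 2 + x v z ^ 2) ∧
        IsFormIn k φ (2 • Pi.single (Sum.inl false) 1) fun v => x v z ^ 2 + x v z ^ 2 := by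
      rcases (crd_onE (prodVarEquiv _ _ p).1).tail_ne_zero (crd_ne_zero _) with h | h
      · refine ⟨2, h, (((gen true 0).pow 2).add ((gen true 1).pow 2)).congr rfl fun v => ?_,
          (((gen false 0).pow 2).add ((gen false 0).pow 2)).congr rfl fun v => rfl⟩
        obtain ⟨e1, e2⟩ := crd_onE (prodVarEquiv _ _ v).1
        change x v 0 ^ 2 + x v 1 ^ 2 = x v 2 ^ 2 + x v 2 ^ 2
        linear_combination e1 + e2
      · refine ⟨3, h, (((gen true 0).pow 2).sub ((gen true 1).pow 2)).congr rfl fun v => ?_,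
          (((gen false 1).pow 2).add ((gen false 1).pow 2)).congr rfl fun v => rfl⟩
        obtain ⟨e1, e2⟩ := crd_onE (prodVarEquiv _ _ v).1
        change x v 0 ^ 2 - x v 1 ^ 2 = x v 3 ^ 2 + x v 3 ^ 2
        linear_combination e1 - e2
    refine ⟨(X ⟨Sum.inl (), z⟩ ^ 2 + X ⟨Sum.inl (), z⟩ ^ 2) ^ d (Sum.inl ()),
      Sum.elim (fun _ => 2 * d (Sum.inl ())) fun _ => 2 * d (Sum.inr ()), ?_, fun e he hε => ?_⟩
    · simp only [evalAt, map_pow, map_add, aeval_X]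
      rw [← two_mul]
      exact pow_ne_zero _ (mul_ne_zero two_ne_zero (pow_ne_zero 2 hz))
    have hc := hε _ (List.mem_cons_self)
    rw [Fintype.prod_sigma, Fintype.prod_sum_type] at hc
    simp only [Finset.univ_unique, Finset.prod_singleton, PUnit.default_eq_unit] at hc
    set e₁ : Fin 4 → ℕ := fun j => e ⟨Sum.inl (), j⟩ with he₁
    set e₂ : Fin 4 → ℕ := fun j => e ⟨Sum.inr (), j⟩ with he₂
    have hd1 : e₁ 0 + e₁ 1 + e₁ 2 + e₁ 3 = 2 * d (Sum.inl ()) :=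
      (Fin.sum_univ_four e₁).symm.trans (he (Sum.inl ()))
    have hd2 : e₂ 0 + e₂ 1 + e₂ 2 + e₂ 3 = 2 * d (Sum.inr ()) :=
      (Fin.sum_univ_four e₂).symm.trans (he (Sum.inr ()))
    replace hc : (∏ j : Fin 4, (![1, 1, -1, -1] : Fin 4 → ℤˣ) j ^ e₁ j) *
      ∏ j : Fin 4, (1 : ℤˣ) ^ e₂ j = 1 := hc
    simp only [Fin.prod_univ_four, Matrix.cons_val, one_pow, one_mul, mul_one, ← pow_add] at hc
    obtain ⟨w, hw⟩ := even_of_neg_one_pow hc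
    obtain ⟨u, hu⟩ : ∃ u, e₁ 0 + e₁ 1 = u + u := ⟨d (Sum.inl ()) - w, by omega⟩
    obtain ⟨Ψ, hΨ, hΨe⟩ := ((((((gen true 0).pow (e₁ 0)).mul ((gen true 1).pow (e₁ 1))).mul
      (h1.pow w)).mul ((((gen false 0).pow (e₁ 2)).mul ((gen false 1).pow (e₁ 3))).mul
      (h2.pow u))).mul (((((gen' 0).pow (e₂ 0)).mul ((gen' 1).pow (e₂ 1))).mul
      ((gen' 2).pow (e₂ 2))).mul ((gen' 3).pow (e₂ 3)))).congr
      (d' := Sum.elim (fun _ => 2 * d (Sum.inl ())) fun _ => 2 * d (Sum.inr ())) (by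
        funext i
        rcases i with (_ | _) | _ <;> simp <;> omega) (fun v => rfl)
    refine ⟨Ψ, hΨ, fun v => Eq.trans ?_ (hΨe v)⟩
    have hd : d (Sum.inl ()) = u + w := by omega
    rw [Fintype.prod_sigma, Fintype.prod_sum_type]
    simp only [Finset.univ_unique, Finset.prod_singleton, PUnit.default_eq_unit, evalAt, map_add,
      map_pow, aeval_X, Pi.mul_apply, Pi.pow_apply]
    change (x v z ^ 2 + x v z ^ 2) ^ d (Sum.inl ()) *
      ((∏ j, x v j ^ e₁ j) * ∏ j, y v j ^ e₂ j) =
      x v 0 ^ e₁ 0 * x v 1 ^ e₁ 1 * (x v z ^ 2 + x v z ^ 2) ^ w *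
      (x v 2 ^ e₁ 2 * x v 3 ^ e₁ 3 * (x v z ^ 2 + x v z ^ 2) ^ u) *
      (y v 0 ^ e₂ 0 * y v 1 ^ e₂ 1 * y v 2 ^ e₂ 2 * y v 3 ^ e₂ 3)
    rw [Fin.prod_univ_four, Fin.prod_univ_four, hd, pow_add]
    ring

theorem rhoLeft_regular (k : IntermediateField ℚ ℂ) : IsRegularMap k rhoLeft :=
  isRegularMap_of_signed _ isCoordOf_signLeft k

theorem splitMapLeft_isQuotientBy (k : IntermediateField ℚ ℂ) :
    IsQuotientBy k (Subgroup.zpowers rhoLeft) splitMapLeft :=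
  (splitMapLeft_isSignQuotient k).isQuotientBy (finite_zpowers_involution rhoLeft_mul_self)
    (fun g hg => by
      rcases (mem_zpowers_involution rhoLeft_mul_self).1 hg with rfl | rfl
      exacts [isRegularMap_id, rhoLeft_regular k])
    (curveE_closed_prod k) ((splitE_closed k).prodVar (curveE_closed k)) splitMapLeft_eq_iff

/-! ### The quotient of the product by the diagonal action of `ρ` -/

/-- The shear `(P, Q) ↦ (P, Q - P)` of `E × E`. It turns the diagonal action of `ρ`, which is a
translation, into the action on the first factor. -/
def shear : surfEE ≃ surfEE where
  toFun p := (prodVarEquiv _ _).symm ((prodVarEquiv _ _ p).1,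
    (prodVarEquiv _ _ p).2 - (prodVarEquiv _ _ p).1)
  invFun p := (prodVarEquiv _ _).symm ((prodVarEquiv _ _ p).1,
    (prodVarEquiv _ _ p).1 + (prodVarEquiv _ _ p).2)
  left_inv p := (prodVarEquiv _ _).injective (Prod.ext rfl (by simp))
  right_inv p := (prodVarEquiv _ _).injective (Prod.ext rfl (by simp))

theorem curveSign_regular (ε : Fin 4 → ℤˣ) (k : IntermediateField ℚ ℂ) :
    IsRegularMap k (curveSign ε) :=
  isRegularMap_of_signed (fun a => ε a.2) (fun P => isCoordOf_signPerm ε P.1) k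

theorem curveNeg_regular (k : IntermediateField ℚ ℂ) : IsRegularMap k (fun P : curveE => -P) :=
  curveSign_regular ![1, 1, 1, -1] k

theorem add_regular_comp {k : IntermediateField ℚ ℂ} {ι : Type} [Fintype ι] {n : ι → ℕ}
    {V : Set (MultiProj n)} {f g : V → curveE} (hf : IsRegularMap k f) (hg : IsRegularMap k g) :
    IsRegularMap k fun p => f p + g p :=
  (curveAdd_regular k).comp (hf.pair hg)

theorem shear_isIsoOver (k : IntermediateField ℚ ℂ) : IsIsoOver k shear := by
  constructor
  · refine IsRegularMap.pair isRegularMap_fst ?_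
    simp only [sub_eq_add_neg]
    exact add_regular_comp isRegularMap_snd ((curveNeg_regular k).comp isRegularMap_fst)
  · exact IsRegularMap.pair isRegularMap_fst (add_regular_comp isRegularMap_fst isRegularMap_snd)

/-- The point `[1, 1, -1, 0]` of order two. -/
def rhoZero : curveE := rho 0

theorem rho_eq_add (P : curveE) : rho P = P + rhoZero := by
  have h0 : ![1, 1, -1, 0] ∈ line rhoZero.1 := by
    have h : _ ∈ line rhoZero.1 := rho_line curveZero_line
    simpa using h
  refine (curveAdd_eq (crd_ne_zero P.1) (crd_mem_line P.1) vec_ne_zero_of_head h0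
    (rho_line (crd_mem_line P.1)) fun b => ⟨cond b (-crd P.1 2) (-crd P.1 3), ?_⟩).symm
  funext i
  cases b <;> fin_cases i <;> simp [lawE] <;> ring

theorem rho_sub_rho (P Q : curveE) : rho Q - rho P = Q - P := by
  rw [rho_eq_add, rho_eq_add, add_sub_add_right_eq_sub]

theorem shear_diagPerm_rho (p : surfEE) : shear (diagPerm rho p) = rhoLeft (shear p) :=
  (prodVarEquiv _ _).injective (Prod.ext rfl (rho_sub_rho _ _))

/-- The quotient map of `E × E` by the diagonal action of `ρ`. -/
def rhoQuot (p : surfEE) : prodVar splitE curveE := splitMapLeft (shear p)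

theorem rhoQuot_isQuotientBy (k : IntermediateField ℚ ℂ) :
    IsQuotientBy k (Subgroup.zpowers (diagPerm rho)) rhoQuot where
  finite := finite_zpowers_involution diagPerm_rho_mul_self
  action g hg := by
    rcases (mem_zpowers_involution diagPerm_rho_mul_self).1 hg with rfl | rfl
    exacts [isRegularMap_id, diagPerm_regular _ k]
  source_closed := curveE_closed_prod k
  target_closed := (splitE_closed k).prodVar (curveE_closed k)
  regular := (splitMapLeft_isQuotientBy k).regular.comp (shear_isIsoOver k).1
  surjective := splitMapLeft_surjective.comp shear.surjective
  fibre p q := by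
    refine ((splitMapLeft_isQuotientBy k).fibre _ _).trans ?_
    simp only [mem_zpowers_involution rhoLeft_mul_self,
      mem_zpowers_involution diagPerm_rho_mul_self, exists_eq_or_imp, exists_eq_left,
      ← shear_diagPerm_rho, shear.apply_eq_iff_eq, Equiv.Perm.one_apply]
  topology U := by
    rw [(splitMapLeft_isQuotientBy k).topology, (shear_isIsoOver k).isOpenOver_iff]
    rfl
  functions U hU g := by
    rw [(splitMapLeft_isQuotientBy k).functions U hU, (shear_isIsoOver k).isRegularOn_iff]
    rfl

/-! ### Renumbering the factors of a product of projective spaces -/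

section Reindex

variable {ι κ : Type} {n : κ → ℕ} (e : ι ≃ κ)

/-- The factors of a multiprojective space in another order. -/
def reindexEquiv : MultiProj n ≃ MultiProj fun i => n (e i) :=
  (Equiv.piCongrLeft (fun j => Projectivization ℂ (Fin (n j + 1) → ℂ)) e).symm

/-- The renumbering of the coordinates. -/
def coordEquiv : (Coord fun i => n (e i)) ≃ Coord n :=
  Equiv.sigmaCongrLeft (β := fun j => Fin (n j + 1)) e

/-- A subset of a multiprojective space, after a renumbering of the factors. -/
def reindexSet (V : Set (MultiProj n)) : Set (MultiProj fun i => n (e i)) :=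
  reindexEquiv e '' V

/-- The bijection of a set with its renumbering. -/
def reindex (V : Set (MultiProj n)) : V ≃ reindexSet e V := (reindexEquiv e).image V

theorem homCoord_reindex (p : MultiProj n) (a : Coord fun i => n (e i)) :
    homCoord (reindexEquiv e p) a = homCoord p (coordEquiv e a) := rfl

variable [Fintype ι] [Fintype κ]

theorem reindex_isIsoOver (k : IntermediateField ℚ ℂ) (V : Set (MultiProj n)) :
    IsIsoOver k (reindex e V) := by
  classical
  constructor
  · intro p i
    refine ⟨Pi.single (e i) 1, fun l => X ⟨e i, l⟩, fun l => isMultiHom_X _, ?_, fun q => ?_⟩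
    · obtain ⟨l, hl⟩ := Function.ne_iff.1 (p.1 (e i)).rep_nonzero
      exact ⟨l, by simp only [evalAt, aeval_X]; exact hl⟩
    · simp only [evalAt, aeval_X]
      exact mem_submodule_iff.2 ⟨1, (one_smul _ _).symm⟩
  · intro p j
    obtain ⟨i, rfl⟩ := e.surjective j
    obtain ⟨p, rfl⟩ := (reindex e V).surjective p
    refine ⟨Pi.single i 1, fun l => X ⟨i, l⟩, fun l => isMultiHom_X _, ?_, fun q => ?_⟩
    · obtain ⟨l, hl⟩ := Function.ne_iff.1 (p.1 (e i)).rep_nonzero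
      exact ⟨l, by simp only [evalAt, aeval_X]; exact hl⟩
    · obtain ⟨q, rfl⟩ := (reindex e V).surjective q
      rw [Equiv.symm_apply_apply]
      simp only [evalAt, aeval_X]
      exact mem_submodule_iff.2 ⟨1, (one_smul _ _).symm⟩

theorem reindexSet_closed {k : IntermediateField ℚ ℂ} {V : Set (MultiProj n)}
    (h : IsClosedOver k V) : IsClosedOver k (reindexSet e V) := by
  rw [isClosedOver_iff] at *
  intro p hp
  obtain ⟨p, rfl⟩ := (reindexEquiv e).surjective p
  obtain ⟨F, d, hF, hFp, hFV⟩ := h p fun h => hp ⟨p, h, rfl⟩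
  have hcoord : ∀ q : MultiProj n,
      homCoord (reindexEquiv e q) ∘ (coordEquiv (n := n) e).symm = homCoord q := fun q =>
    funext fun a => by
      rw [Function.comp_apply, homCoord_reindex, Equiv.apply_symm_apply]
  have hev : ∀ q : MultiProj n,
      evalAt (rename (coordEquiv e).symm F) (reindexEquiv e q) = evalAt F q := fun q => by
    rw [evalAt, aeval_rename, hcoord]
    rfl
  refine ⟨rename (coordEquiv e).symm F, fun i => d (e i),
    isMultiHom_of_aeval_rescale fun c x => ?_, by rwa [hev], ?_⟩
  · rw [aeval_rename, aeval_rename]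
    have hc : rescale c x ∘ (coordEquiv (n := n) e).symm =
        rescale (c ∘ e.symm) (x ∘ (coordEquiv (n := n) e).symm) := by
      funext a
      obtain ⟨a, rfl⟩ := (coordEquiv (n := n) e).surjective a
      simp only [Function.comp_apply, rescale, Equiv.symm_apply_apply]
      congr 2
      exact (e.symm_apply_apply a.1).symm
    rw [hc, hF.aeval_rescale]
    congr 1
    rw [← e.prod_comp]
    simp
  · rintro - ⟨q, hq, rfl⟩
    rw [hev, hFV q hq]

end Reindex

/-! ### The group structure of the quotient of the curve -/

theorem basePt_line : ![(Real.sqrt 2 : ℂ), 0, 1, 1] ∈ line basePt.1 := mkPt_mem_line _ _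

theorem sqrt_two_sq : (Real.sqrt 2 : ℂ) ^ 2 = 2 := by
  rw [← Complex.ofReal_pow, Real.sq_sqrt (by norm_num)]
  norm_num

theorem sqrt_two_ne_zero : (Real.sqrt 2 : ℂ) ≠ 0 := fun h => by
  have := sqrt_two_sq
  rw [h] at this
  norm_num at this

/-- The translate by `-P₀`, where `P₀ = [√2, 0, 1, 1]`, exchanges the two halves of the
coordinates. -/
theorem sub_basePt_line {S : curveE} {x : Fin 4 → ℂ} (hx : x ∈ line S.1) :
    ![Real.sqrt 2 * x 2, Real.sqrt 2 * x 3, x 0, -x 1] ∈ line (S - basePt).1 := by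
  by_cases hx0 : x = 0
  · convert Submodule.zero_mem _ using 1
    funext i
    fin_cases i <;> simp [hx0]
  have hneg : ![(Real.sqrt 2 : ℂ), 0, 1, -1] ∈ line (-basePt).1 := curveNeg_line basePt_line
  have hneg0 : ![(Real.sqrt 2 : ℂ), 0, 1, -1] ≠ 0 := fun h => one_ne_zero (congrFun h 2)
  have hlaw : ∀ b, _ ∈ line (S + -basePt).1 := lawE_mem_line hx0 hx hneg0 hneg
  rw [sub_eq_add_neg]
  obtain ⟨h1, h2⟩ := onE_of_mem_line S.2 hx
  rcases (onE_of_mem_line S.2 hx).head_ne_zero hx0 with h | h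
  · convert Submodule.smul_mem _ (x 0)⁻¹ (hlaw true) using 1
    funext i
    fin_cases i <;> simp [lawE] <;> field_simp
    linear_combination h1
  · convert Submodule.smul_mem _ (x 1)⁻¹ (hlaw false) using 1
    funext i
    fin_cases i <;> simp [lawE] <;> field_simp
    linear_combination -h2

theorem tau_zero_line : ![1, -1, 1, 0] ∈ line (tau 0).1 := by
  have h : _ ∈ line (tau 0).1 := tau_line curveZero_line
  simpa using h

theorem tau_add (P : curveE) : tau P + P = tau 0 := by
  have hP := crd_onE P
  have h0 : ![crd P.1 0, -crd P.1 1, crd P.1 2, crd P.1 3] ≠ 0 := fun h => crd_ne_zero P.1 (by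
    have e0 := congrFun h 0
    have e1 := congrFun h 1
    have e2 := congrFun h 2
    have e3 := congrFun h 3
    simp at e0 e1 e2 e3
    exact vec4_eq_zero e0 e1 e2 e3)
  refine curveAdd_eq h0 (tau_line (crd_mem_line P.1)) (crd_ne_zero P.1) (crd_mem_line P.1)
    tau_zero_line fun b => ⟨cond b (crd P.1 2 ^ 4 + crd P.1 3 ^ 4)
      (2 * crd P.1 0 * crd P.1 1 * crd P.1 2 * crd P.1 3), ?_⟩
  obtain ⟨h1, h2⟩ := hP
  funext i
  cases b <;> fin_cases i <;> simp [lawE] <;> grind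

theorem tau_basePt : tau basePt = basePt := by
  have h := tau_line basePt_line
  refine Subtype.ext (eq_of_mem_line (fun h0 => one_ne_zero (congrFun h0 2)) h ?_)
  simpa using basePt_line

theorem tau_eq_sub (P : curveE) : tau P = basePt + basePt - P := by
  rw [eq_sub_iff_add_eq, tau_add, ← tau_add basePt, tau_basePt]

theorem rhoZero_add_self : rhoZero + rhoZero = 0 := by
  rw [← rho_eq_add]
  exact congrArg (· (0 : curveE)) rho_mul_self

theorem splitMap_add_rhoZero (P : curveE) : splitMap (P + rhoZero) = splitMap P := by
  rw [← rho_eq_add, splitMap_rho]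

theorem splitMap_eq_iff' {P Q : curveE} : splitMap P = splitMap Q ↔ Q = P ∨ Q = P + rhoZero := by
  rw [splitMap_eq_iff, rho_eq_add]

/-- A point of `E` over a given point of the quotient. -/
def splitLift (x : splitE) : curveE := Function.surjInv splitMap_surjective x

theorem splitMap_splitLift (x : splitE) : splitMap (splitLift x) = x :=
  Function.surjInv_eq splitMap_surjective x

instance : Zero splitE := ⟨splitMap basePt⟩

instance : Add splitE := ⟨fun x y => splitMap (splitLift x + splitLift y - basePt)⟩

instance : Neg splitE := ⟨fun x => splitMap (tau (splitLift x))⟩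

theorem splitMap_add (P Q : curveE) : splitMap P + splitMap Q = splitMap (P + Q - basePt) := by
  change splitMap (splitLift (splitMap P) + splitLift (splitMap Q) - basePt) = _
  rcases splitMap_eq_iff'.1 (splitMap_splitLift (splitMap P)).symm with h | h <;>
    rcases splitMap_eq_iff'.1 (splitMap_splitLift (splitMap Q)).symm with h' | h' <;> rw [h, h']
  · rw [← splitMap_add_rhoZero (P + Q - basePt)]
    congr 1
    abel
  · rw [← splitMap_add_rhoZero (P + Q - basePt)]
    congr 1
    abel
  · congr 1
    calc _ = P + Q - basePt + (rhoZero + rhoZero) := by abel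
      _ = _ := by rw [rhoZero_add_self, add_zero]

theorem splitMap_tau (P : curveE) : splitMap (tau P) = -splitMap P := by
  change _ = splitMap (tau (splitLift (splitMap P)))
  rcases splitMap_eq_iff'.1 (splitMap_splitLift (splitMap P)).symm with h | h <;> rw [h]
  rw [← splitMap_add_rhoZero (tau (P + rhoZero)), tau_eq_sub, tau_eq_sub]
  congr 1
  abel

/-- The group structure of the quotient of `E` by `ρ`: the image of the group structure of `E`
whose origin is `P₀`. -/
instance : AddCommGroup splitE where
  add_assoc x y z := by
    obtain ⟨P, rfl⟩ := splitMap_surjective x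
    obtain ⟨Q, rfl⟩ := splitMap_surjective y
    obtain ⟨R, rfl⟩ := splitMap_surjective z
    simp only [splitMap_add]
    congr 1
    abel
  zero_add x := by
    obtain ⟨P, rfl⟩ := splitMap_surjective x
    change splitMap basePt + splitMap P = _
    rw [splitMap_add, add_sub_cancel_left]
  add_zero x := by
    obtain ⟨P, rfl⟩ := splitMap_surjective x
    change splitMap P + splitMap basePt = _
    rw [splitMap_add, add_sub_cancel_right]
  nsmul := nsmulRec
  zsmul := zsmulRec
  neg_add_cancel x := by
    obtain ⟨P, rfl⟩ := splitMap_surjective x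
    change -splitMap P + splitMap P = splitMap basePt
    rw [← splitMap_tau, splitMap_add, tau_eq_sub]
    congr 1
    abel
  add_comm x y := by
    obtain ⟨P, rfl⟩ := splitMap_surjective x
    obtain ⟨Q, rfl⟩ := splitMap_surjective y
    rw [splitMap_add, splitMap_add, add_comm P Q]

/-- Bilinear addition laws on the quotient of `E` by `ρ`. The curve `splitE` is the completed
Edwards curve `x² + y² = 1 - x² y²` for `x = b / a`, `y = d / c`, and the second component differs
from the first one by the translation by `P₀`. -/
def splitLaw {R : Type} [CommRing R] : Bool → Bool → (Fin 4 → R) → (Fin 4 → R) → Fin 2 → R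
  | true, true, v, w => ![v 0 * w 0 * v 2 * w 2 - v 1 * w 1 * v 3 * w 3,
      v 1 * v 2 * w 0 * w 3 + v 0 * v 3 * w 1 * w 2]
  | true, false, v, w => ![v 0 * w 0 * v 3 * w 3 + v 1 * w 1 * v 2 * w 2,
      v 1 * v 3 * w 0 * w 2 + v 0 * v 2 * w 1 * w 3]
  | false, true, v, w => ![v 0 * w 0 * v 2 * w 2 + v 1 * w 1 * v 3 * w 3,
      v 0 * w 0 * v 3 * w 3 - v 1 * w 1 * v 2 * w 2]
  | false, false, v, w => ![v 1 * v 2 * w 0 * w 3 - v 0 * v 3 * w 1 * w 2,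
      v 1 * v 3 * w 0 * w 2 - v 0 * v 2 * w 1 * w 3]

theorem splitLaw_true_minor {v w : Fin 4 → ℂ} (hv : OnE v) (hw : OnE w) (b b' : Bool) :
    splitLaw true b v w 0 * lawE b' v w 3 = splitLaw true b v w 1 * lawE b' v w 2 := by
  obtain ⟨h1, h2⟩ := hv
  obtain ⟨h3, h4⟩ := hw
  cases b <;> cases b' <;> simp [lawE, splitLaw] <;> grind

theorem splitLaw_false_minor {v w : Fin 4 → ℂ} (hv : OnE v) (hw : OnE w) (b b' : Bool) :
    splitLaw false b v w 0 * -lawE b' v w 1 = splitLaw false b v w 1 * lawE b' v w 0 := by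
  obtain ⟨h1, h2⟩ := hv
  obtain ⟨h3, h4⟩ := hw
  cases b <;> cases b' <;> simp [lawE, splitLaw] <;> grind

/-- The two laws for a component have no common zero; `s = 1` and `s = -1` are the two
components. -/
theorem splitLaw_aux {v w : Fin 4 → ℂ} (hv : OnE v) (hw : OnE w) (hv0 : v ≠ 0) (hw0 : w ≠ 0)
    {s : ℂ} (hs : s ^ 2 = 1) (e1 : v 0 * w 0 * v 2 * w 2 = s * (v 1 * w 1 * v 3 * w 3))
    (e2 : v 1 * v 2 * w 0 * w 3 = -s * (v 0 * v 3 * w 1 * w 2))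
    (e3 : v 0 * w 0 * v 3 * w 3 = -s * (v 1 * w 1 * v 2 * w 2))
    (e4 : v 1 * v 3 * w 0 * w 2 = -s * (v 0 * v 2 * w 1 * w 3)) : False := by
  have k1 := hv.tail_ne_zero hv0
  have k2 := hw.tail_ne_zero hw0
  have k3 := hv.head_ne_zero hv0
  have k4 := hw.head_ne_zero hw0
  obtain ⟨h1, h2⟩ := hv
  obtain ⟨h3, h4⟩ := hw
  have hs0 : s ≠ 0 := by rintro rfl; simp at hs
  have ha : v 0 ≠ 0 := by grind
  have hb : v 1 ≠ 0 := by grind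
  have ha' : w 0 ≠ 0 := by grind
  have hb' : w 1 ≠ 0 := by grind
  have hc : v 2 ≠ 0 := by grind
  have hd : v 3 ≠ 0 := by grind
  have hc' : w 2 ≠ 0 := by grind
  have hd' : w 3 ≠ 0 := by grind
  have r1 : (v 2 * w 2) ^ 2 = -(v 3 * w 3) ^ 2 := by
    refine mul_left_cancel₀ (mul_ne_zero (mul_ne_zero ha hb) (mul_ne_zero ha' hb')) ?_
    linear_combination (v 1 * w 1 * v 2 * w 2) * e1 + (v 1 * w 1 * v 3 * w 3) * e3
  have r2 : (v 2 * w 3) ^ 2 = (v 3 * w 2) ^ 2 := by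
    refine mul_left_cancel₀ (mul_ne_zero (mul_ne_zero ha hb) (mul_ne_zero ha' hb')) ?_
    linear_combination (v 0 * v 2 * w 1 * w 3) * e2 - (v 0 * v 3 * w 1 * w 2) * e4
  have r3 : w 0 ^ 2 * v 2 ^ 2 = -(w 1 ^ 2 * v 3 ^ 2) := by
    refine mul_left_cancel₀ (mul_ne_zero (mul_ne_zero ha hb) (mul_ne_zero hc' hd')) ?_
    linear_combination (v 1 * v 2 * w 0 * w 3) * e1 + s * (v 1 * w 1 * v 3 * w 3) * e2 -
      (v 0 * v 1 * w 2 * w 3 * w 1 ^ 2 * v 3 ^ 2) * hs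
  have r4 : v 1 ^ 2 * w 3 ^ 2 = 0 := by
    linear_combination w 3 ^ 2 * h2 + (r3 - v 2 ^ 2 * h3 - v 3 ^ 2 * h4 - r1 + r2) / 2
  exact mul_ne_zero (pow_ne_zero 2 hb) (pow_ne_zero 2 hd') r4

theorem splitLaw_ne_zero {v w : Fin 4 → ℂ} (hv : OnE v) (hw : OnE w) (hv0 : v ≠ 0) (hw0 : w ≠ 0)
    (j : Bool) : ∃ b, splitLaw j b v w ≠ 0 := by
  by_contra! h0
  have e1 := congrFun (h0 true) 0
  have e2 := congrFun (h0 true) 1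
  have e3 := congrFun (h0 false) 0
  have e4 := congrFun (h0 false) 1
  cases j <;> simp [splitLaw] at e1 e2 e3 e4
  · refine splitLaw_aux hv hw hv0 hw0 (s := -1) (by norm_num) ?_ ?_ ?_ ?_
    · linear_combination e1
    · linear_combination e3
    · linear_combination e2
    · linear_combination e4
  · refine splitLaw_aux hv hw hv0 hw0 (s := 1) (by norm_num) ?_ ?_ ?_ ?_
    · linear_combination e1
    · linear_combination e2
    · linear_combination e3
    · linear_combination e4

theorem mem_of_minor {M : Submodule ℂ (Fin 2 → ℂ)} {x y : Fin 2 → ℂ} (hy : y ≠ 0) (hyM : y ∈ M)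
    (h : x 0 * y 1 = x 1 * y 0) : x ∈ M := by
  rcases vec2_ne_zero_iff.1 hy with h0 | h0
  · convert Submodule.smul_mem _ (x 0 / y 0) hyM using 1
    funext i
    fin_cases i <;> simp <;> field_simp
    linear_combination -h
  · convert Submodule.smul_mem _ (x 1 / y 1) hyM using 1
    funext i
    fin_cases i <;> simp <;> field_simp
    linear_combination h

theorem splitLaw_mem {P Q : curveE} {v w : Fin 4 → ℂ} (hv : v ≠ 0) (hvP : v ∈ line P.1)
    (hw : w ≠ 0) (hwQ : w ∈ line Q.1) (j b : Bool) :
    splitLaw j b v w ∈ ((splitMap P + splitMap Q).1 j).submodule := by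
  have hvE := onE_of_mem_line P.2 hvP
  have hwE := onE_of_mem_line Q.2 hwQ
  obtain ⟨b', hb'⟩ := lawE_ne_zero hvE hwE hv hw
  have hS : lawE b' v w ∈ line (P + Q).1 := lawE_mem_line hv hvP hw hwQ b'
  have hE := onE_lawE hvE hwE b'
  have hmem := splitMap_mem (sub_basePt_line hS) j
  rw [splitMap_add]
  cases j
  · refine mem_of_minor ?_ hmem ?_
    · exact vec2_ne_zero ((hE.head_ne_zero hb').imp id neg_ne_zero.2)
    · exact splitLaw_false_minor hvE hwE b b'
  · refine mem_of_minor ?_ hmem ?_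
    · exact vec2_ne_zero ((hE.tail_ne_zero hb').imp (mul_ne_zero sqrt_two_ne_zero)
        (mul_ne_zero sqrt_two_ne_zero))
    · change _ * (Real.sqrt 2 * lawE b' v w 3) = _ * (Real.sqrt 2 * lawE b' v w 2)
      linear_combination (Real.sqrt 2 : ℂ) * splitLaw_true_minor hvE hwE b b'

/-- The coordinates `(a, b, c, d)` of a point of `ℙ¹ × ℙ¹`. -/
def joinVec {R : Type} (x : Bool → Fin 2 → R) : Fin 4 → R :=
  ![x true 0, x true 1, x false 0, x false 1]

theorem splitLaw_joinVec_smul {R : Type} [CommRing R] (j b : Bool) (s t : Bool → R)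
    (x y : Bool → Fin 2 → R) :
    splitLaw j b (joinVec fun i => s i • x i) (joinVec fun i => t i • y i) =
      (s true * s false * (t true * t false)) • splitLaw j b (joinVec x) (joinVec y) := by
  funext l
  cases j <;> cases b <;> fin_cases l <;> simp [splitLaw, joinVec] <;> ring

theorem map_splitLaw {R S : Type} [CommRing R] [CommRing S] (f : R →+* S) (j b : Bool)
    (v w : Fin 4 → R) (l : Fin 2) :
    f (splitLaw j b v w l) = splitLaw j b (fun i => f (v i)) (fun i => f (w i)) l := by
  cases j <;> cases b <;> fin_cases l <;> simp [splitLaw]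

theorem isIntForm_splitLaw (j b : Bool) (l : Fin 2) :
    IsIntForm (n := Sum.elim (fun _ : Bool => 1) fun _ : Bool => 1) (fun _ => 1) fun x =>
      splitLaw j b (joinVec fun i a => x ⟨Sum.inl i, a⟩) (joinVec fun i a => x ⟨Sum.inr i, a⟩)
        l where
  poly := by
    refine ⟨splitLaw j b (joinVec fun i a => X ⟨Sum.inl i, a⟩)
      (joinVec fun i a => X ⟨Sum.inr i, a⟩) l, fun x => ?_⟩
    refine (map_splitLaw (aeval (R := ℤ) x).toRingHom j b _ _ l).trans ?_
    congr 1 <;> funext i <;> fin_cases i <;> exact aeval_X _ _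
  scale c x := by
    have h := congrFun (splitLaw_joinVec_smul j b (fun i => c (Sum.inl i)) (fun i => c (Sum.inr i))
      (fun i a => x ⟨Sum.inl i, a⟩) fun i a => x ⟨Sum.inr i, a⟩) l
    refine Eq.trans ?_ (h.trans ?_)
    · rfl
    · simp [Fintype.prod_sum_type]

theorem splitAdd_regular (k : IntermediateField ℚ ℂ) : IsRegularMap k
    (fun p : prodVar splitE splitE => (prodVarEquiv _ _ p).1 + (prodVarEquiv _ _ p).2) := by
  have hrep : ∀ p : prodVar splitE splitE, ∃ v w : Fin 4 → ℂ, v ≠ 0 ∧ w ≠ 0 ∧ OnE v ∧ OnE w ∧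
      (∀ j b, splitLaw j b v w ∈
        (((prodVarEquiv _ _ p).1 + (prodVarEquiv _ _ p).2).1 j).submodule) ∧
      ∃ t : ℂ, t ≠ 0 ∧ ∀ j b, splitLaw j b v w =
        t • splitLaw j b (joinVec fun i a => homCoord p.1 ⟨Sum.inl i, a⟩)
          (joinVec fun i a => homCoord p.1 ⟨Sum.inr i, a⟩) := fun p => by
    obtain ⟨P, v, s, hP, hv0, hvE, hvP, hs, hv⟩ := exists_splitMap_eq (p := (prodVarEquiv _ _ p).1)
      (x := fun b => (p.1 (Sum.inl b)).rep) (fun b => (p.1 (Sum.inl b)).rep_nonzero)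
      fun b => mem_submodule_iff.2 ⟨1, (one_smul _ _).symm⟩
    obtain ⟨Q, w, t, hQ, hw0, hwE, hwQ, ht, hw⟩ := exists_splitMap_eq (p := (prodVarEquiv _ _ p).2)
      (x := fun b => (p.1 (Sum.inr b)).rep) (fun b => (p.1 (Sum.inr b)).rep_nonzero)
      fun b => mem_submodule_iff.2 ⟨1, (one_smul _ _).symm⟩
    refine ⟨v, w, hv0, hw0, hvE, hwE, fun j b => ?_, s * t, mul_ne_zero hs ht, fun j b => ?_⟩
    · rw [← hP, ← hQ]
      exact splitLaw_mem hv0 hvP hw0 hwQ j b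
    · have h := splitLaw_joinVec_smul j b (fun i => cond i s 1) (fun i => cond i t 1)
        (fun i a => homCoord p.1 ⟨Sum.inl i, a⟩) fun i a => homCoord p.1 ⟨Sum.inr i, a⟩
      simp only [cond_true, cond_false, mul_one] at h
      rw [← h, hv, hw]
      simp only [joinVec, Pi.smul_apply, smul_eq_mul, cond_true, cond_false, one_mul]
      rfl
  refine isRegularMap_of_intForms (fun p j => ?_) k
  obtain ⟨v, w, hv0, hw0, hvE, hwE, -, t, ht, htv⟩ := hrep p
  obtain ⟨b, hb⟩ := splitLaw_ne_zero hvE hwE hv0 hw0 j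
  refine ⟨fun _ => 1, fun x l => splitLaw j b (joinVec fun i a => x ⟨Sum.inl i, a⟩)
    (joinVec fun i a => x ⟨Sum.inr i, a⟩) l, isIntForm_splitLaw j b, fun h => hb ?_, fun q => ?_⟩
  · rw [htv j b, show splitLaw j b _ _ = _ from h, smul_zero]
  · obtain ⟨v, w, -, -, -, -, hmem, t, ht, htv⟩ := hrep q
    have h := Submodule.smul_mem _ t⁻¹ (hmem j b)
    rwa [htv j b, inv_smul_smul₀ ht] at h

/-- The signs of the negation of `splitE`, which changes the sign of the coordinate `b`. -/
def splitNegSign : Coord (fun _ : Bool => 1) → ℤˣ := fun a => cond a.1 (![1, -1] a.2) 1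

theorem splitNeg_regular (k : IntermediateField ℚ ℂ) : IsRegularMap k fun x : splitE => -x := by
  refine isRegularMap_of_signed splitNegSign (fun x => isCoordOf_iff.2 fun b => ?_) k
  obtain ⟨P, rfl⟩ := splitMap_surjective x
  obtain ⟨c, hc, h⟩ : ∃ c : ℂ, c ≠ 0 ∧
      ((splitMap P).1 b).rep = c • splitVec (crd P.1) b := by
    obtain ⟨c, hc⟩ := mem_submodule_iff.1 (splitMap_mem (crd_mem_line P.1) b)
    have hc0 : c ≠ 0 := fun h => splitVec_ne_zero (crd_onE P) (crd_ne_zero _) b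
      (by rw [hc, h, zero_smul])
    exact ⟨c⁻¹, inv_ne_zero hc0, by rw [hc, inv_smul_smul₀ hc0]⟩
  have hτ : (fun l => signed splitNegSign (homCoord (splitMap P).1) ⟨b, l⟩) =
      c • splitVec ![crd P.1 0, -crd P.1 1, crd P.1 2, crd P.1 3] b := by
    funext l
    refine (congrArg (_ * ·) (congrFun h l)).trans ?_
    cases b <;> fin_cases l <;> simp [splitVec, splitNegSign]
  have hline := tau_line (crd_mem_line P.1)
  have hne : ![crd P.1 0, -crd P.1 1, crd P.1 2, crd P.1 3] ≠ 0 := fun h => crd_ne_zero P.1 (by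
    have e0 := congrFun h 0
    have e1 := congrFun h 1
    have e2 := congrFun h 2
    have e3 := congrFun h 3
    simp at e0 e1 e2 e3
    exact vec4_eq_zero e0 e1 e2 e3)
  rw [hτ, ← splitMap_tau]
  exact ⟨smul_ne_zero hc (splitVec_ne_zero (onE_of_mem_line (tau P).2 hline) hne b),
    Submodule.smul_mem _ _ (splitMap_mem hline b)⟩

/-! ### Abelian varieties -/

theorem isAbelianVariety_curveE (k : IntermediateField ℚ ℂ) : IsAbelianVariety k curveE where
  closed := curveE_closed k
  irreducible := curveE_irreducible
  zero_rational _ := ⟨![1, 1, 1, 0], fun h => one_ne_zero (congrFun h 0), by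
    change _ ∈ line curveZero.1
    convert curveZero_line using 1
    funext i
    fin_cases i <;> simp⟩
  add_regular := curveAdd_regular k
  neg_regular := curveNeg_regular k

theorem isAbelianVariety_splitE (k : IntermediateField ℚ ℂ) : IsAbelianVariety k splitE where
  closed := splitE_closed k
  irreducible := curveE_irreducible.of_surjective (splitMap_regular ⊤) splitMap_surjective
  zero_rational b := by
    have h := splitMap_mem basePt_line b
    cases b
    · refine ⟨![1, 1], fun h => one_ne_zero (congrFun h 0), ?_⟩
      change _ ∈ ((splitMap basePt).1 false).submodule
      convert h using 1
      funext i
      fin_cases i <;> simp [splitVec]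
    · refine ⟨![1, 0], fun h => one_ne_zero (congrFun h 0), ?_⟩
      change _ ∈ ((splitMap basePt).1 true).submodule
      convert Submodule.smul_mem _ (Real.sqrt 2 : ℂ)⁻¹ h using 1
      funext i
      fin_cases i <;> simp [splitVec]
  add_regular := splitAdd_regular k
  neg_regular := splitNeg_regular k

section AbelianVarieties

variable {k : IntermediateField ℚ ℂ} {ι κ : Type} [Fintype ι] [Fintype κ] {n : ι → ℕ} {m : κ → ℕ}
  {A : Set (MultiProj n)} {B : Set (MultiProj m)} [AddCommGroup A]

/-- An isomorphism of varieties with rational origin transports the structure of an abelian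
variety. -/
theorem IsAbelianVariety.transport (hA : IsAbelianVariety k A) [AddCommGroup B] (e : A ≃ B)
    (he : IsIsoOver k e) (htop : IsIsoOver ⊤ e) (hB : IsClosedOver k B)
    (hadd : ∀ x y, e (x + y) = e x + e y) (hrat : IsRationalPoint k (e 0).1) :
    IsAbelianVariety k B where
  closed := hB
  irreducible := hA.irreducible.of_surjective htop.1 e.surjective
  zero_rational := by
    have h0 : e 0 = 0 := (AddMonoidHom.mk' e hadd).map_zero
    rwa [h0] at hrat
  add_regular := by
    have h := he.1.comp (hA.add_regular.comp
      ((he.2.comp (isRegularMap_fst (V := B) (W := B))).pair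
        (he.2.comp (isRegularMap_snd (V := B) (W := B)))))
    convert h using 1
    funext p
    simp [hadd]
  neg_regular := by
    have h := he.1.comp (hA.neg_regular.comp he.2)
    convert h using 1
    funext p
    have hneg : ∀ x, e (-x) = -e x := (AddMonoidHom.mk' e hadd).map_neg
    simp [hneg]

/-- The group structure of a product. -/
instance [AddCommGroup B] : AddCommGroup (prodVar A B) := (prodVarEquiv A B).addCommGroup

theorem IsAbelianVariety.prodVar [AddCommGroup B] (hA : IsAbelianVariety k A)
    (hB : IsAbelianVariety k B) : IsAbelianVariety k (prodVar A B) where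
  closed := hA.closed.prodVar hB.closed
  irreducible := hA.irreducible.prodVar hB.irreducible
  zero_rational i := by
    rcases i with i | j
    exacts [hA.zero_rational i, hB.zero_rational j]
  add_regular :=
    (hA.add_regular.comp
      ((isRegularMap_fst.comp isRegularMap_fst).pair (isRegularMap_fst.comp isRegularMap_snd))).pair
    (hB.add_regular.comp
      ((isRegularMap_snd.comp isRegularMap_fst).pair (isRegularMap_snd.comp isRegularMap_snd)))
  neg_regular := (hA.neg_regular.comp isRegularMap_fst).pair (hB.neg_regular.comp isRegularMap_snd)

end AbelianVarieties

theorem rhoQuot_basePt : rhoQuot ((prodVarEquiv _ _).symm (basePt, basePt)) = 0 :=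
  congrArg (prodVarEquiv _ _).symm (Prod.ext rfl (sub_self basePt))

theorem rhoQuot_tau (p : surfEE) : rhoQuot (diagPerm tau p) = -rhoQuot p :=
  congrArg (prodVarEquiv _ _).symm (Prod.ext (splitMap_tau _) (by
    change tau _ - tau _ = -(_ - _)
    rw [tau_eq_sub, tau_eq_sub]
    abel))

/-! ### The Kummer variety of the quotient by `ρ` -/

section Kummer

variable {k : IntermediateField ℚ ℂ} {ι : Type} {n : ι → ℕ} {X : Set (MultiProj n)}
  {q : surfEE → X}

/-- The map `E × E → B / σ` descends to every quotient of `E × E` by `ρ`. -/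
theorem exists_kummerMap (hq : IsQuotientBy k (Subgroup.zpowers (diagPerm rho)) q) :
    ∃ κ : X → boxQuot, ∀ p, κ (q p) = kumMap p := by
  refine ⟨fun x => kumMap (Function.surjInv hq.surjective x), fun p => ?_⟩
  obtain ⟨g, hg, h⟩ := (hq.fibre _ _).1 (Function.surjInv_eq hq.surjective (q p))
  refine (kumMap_eq_iff _ _).2 ⟨g, ?_, h⟩
  rw [mem_groupH]
  rcases (mem_zpowers_involution diagPerm_rho_mul_self).1 hg with rfl | rfl <;> simp

variable [AddCommGroup X]

theorem neg_mul_neg_perm : Equiv.neg X * Equiv.neg X = 1 := by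
  ext1 x
  exact neg_neg x

variable [Fintype ι]

/-- If negation is induced by `τ`, then the quotient of `E × E` by `τ` and `ρ` is the quotient
by `±1` of the quotient by `ρ`. -/
theorem kummerMap_isQuotientBy (hq : IsQuotientBy k (Subgroup.zpowers (diagPerm rho)) q)
    (hτ : ∀ p, q (diagPerm tau p) = -q p) (hneg : IsRegularMap k fun x : X => -x)
    {κ : X → boxQuot} (hκ : ∀ p, κ (q p) = kumMap p) :
    IsQuotientBy k (Subgroup.zpowers (Equiv.neg X)) κ := by
  have hcomp : κ ∘ q = kumMap := funext hκ
  refine hq.of_comp (hcomp ▸ kumMap_isQuotientBy k) (finite_zpowers_involution neg_mul_neg_perm)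
    (fun g hg => ?_) fun x y => ?_
  · rcases (mem_zpowers_involution neg_mul_neg_perm).1 hg with rfl | rfl
    exacts [isRegularMap_id, hneg]
  have hρ : ∀ p, q (diagPerm rho p) = q p := fun p =>
    ((hq.fibre _ _).2 ⟨_, Subgroup.mem_zpowers _, rfl⟩).symm
  obtain ⟨p, rfl⟩ := hq.surjective x
  obtain ⟨p', rfl⟩ := hq.surjective y
  rw [hκ, hκ]
  constructor
  · rw [kumMap_eq_iff]
    rintro ⟨g, hg, rfl⟩
    rcases mem_groupH.1 hg with rfl | rfl | rfl | rfl
    · exact ⟨1, one_mem _, rfl⟩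
    · exact ⟨_, Subgroup.mem_zpowers _, (hτ p).symm⟩
    · exact ⟨1, one_mem _, (hρ p).symm⟩
    · refine ⟨_, Subgroup.mem_zpowers _, ?_⟩
      rw [Equiv.Perm.mul_apply, hτ, hρ]
      rfl
  · have hτ' : kumMap (diagPerm tau p) = kumMap p := kumMap_diagPerm rfl p
    rintro ⟨g, hg, h⟩
    rcases (mem_zpowers_involution neg_mul_neg_perm).1 hg with rfl | rfl
    · rw [← hκ, ← hκ]
      exact congrArg κ h
    · rw [← hτ', ← hκ, ← hκ, hτ]
      exact congrArg κ h

end Kummer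

end BoxVariety

end

theorem proposition5p3 :
    -- `E` is the elliptic curve `y² = x³ - x` over `ℚ`
    (BoxVariety.weierE.IsElliptic ∧
      ∃ e : BoxVariety.curveE ≃ BoxVariety.weierSet BoxVariety.weierE,
        BoxVariety.IsIsoOver BoxVariety.fieldQ e) ∧
    -- `H` is the Klein four-group
    IsKleinFour BoxVariety.groupH ∧
    -- `boxQuot` is the quotient of the box variety by `σ`
    BoxVariety.IsQuotientBy BoxVariety.fieldQ (Subgroup.zpowers BoxVariety.sigma)
      BoxVariety.forgetZ3 ∧
    -- the quotient `Y = (E × E) / H` exists over `ℚ` ...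
    ∃ (r : ℕ) (n : Fin r → ℕ) (Y : Set (BoxVariety.MultiProj n)) (π : BoxVariety.surfEE → Y),
      BoxVariety.IsQuotientBy BoxVariety.fieldQ BoxVariety.groupH π ∧
    -- ... and is isomorphic to the quotient of the box variety over `ℚ(i)`
    ∃ φ : Y ≃ BoxVariety.boxQuot, BoxVariety.IsIsoOver BoxVariety.fieldQi φ ∧
    -- the quotient `X = (E × E) / ρ` exists over `ℚ` ...
    ∃ (s : ℕ) (m : Fin s → ℕ) (X : Set (BoxVariety.MultiProj m)) (q : BoxVariety.surfEE → X),
      BoxVariety.IsQuotientBy BoxVariety.fieldQ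
        (Subgroup.zpowers (BoxVariety.diagPerm BoxVariety.rho)) q ∧
    -- ... and over `ℚ(ζ₈)` it is an abelian variety with the image of `(P₀, P₀)` as origin and
    -- with negation induced by `τ`, whose Kummer variety is `Y ≅ boxQuot`
    ∃ (_ : AddCommGroup X) (κ : X → BoxVariety.boxQuot),
      q ((BoxVariety.prodVarEquiv _ _).symm (BoxVariety.basePt, BoxVariety.basePt)) = 0 ∧
      (∀ p, q (BoxVariety.diagPerm BoxVariety.tau p) = -q p) ∧
      (∀ p, κ (q p) = φ (π p)) ∧
      BoxVariety.IsKummerVarietyOf BoxVariety.fieldQzeta8 X BoxVariety.boxQuot κ := by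
  -- the quotients of `E × E`, with their factors numbered by `Fin 1` and `Fin 3`
  let eY : Fin 1 ≃ Unit := Equiv.ofUnique _ _
  let eX : Fin 3 ≃ Bool ⊕ Unit :=
    (Fintype.equivFinOfCardEq (α := Bool ⊕ Unit) (n := 3) (by simp)).symm
  have hY := BoxVariety.reindex_isIsoOver eY (V := BoxVariety.boxQuot)
  have hX := BoxVariety.reindex_isIsoOver eX
    (V := BoxVariety.prodVar BoxVariety.splitE BoxVariety.curveE)
  have hXclosed := fun k => BoxVariety.reindexSet_closed eX
    ((BoxVariety.splitE_closed k).prodVar (BoxVariety.curveE_closed k))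
  have hq := fun k => (BoxVariety.rhoQuot_isQuotientBy k).comp_iso (hX k) (hXclosed k)
  let rX := BoxVariety.reindex eX (BoxVariety.prodVar BoxVariety.splitE BoxVariety.curveE)
  let _ : AddCommGroup (BoxVariety.reindexSet eX
    (BoxVariety.prodVar BoxVariety.splitE BoxVariety.curveE)) := rX.symm.addCommGroup
  have hneg : ∀ x, rX (-x) = -rX x := fun x => (congrArg (fun y => rX (-y))
    (rX.symm_apply_apply x)).symm
  have hadd : ∀ x y, rX (x + y) = rX x + rX y := fun x y => (congrArg₂ (fun u v => rX (u + v))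
    (rX.symm_apply_apply x) (rX.symm_apply_apply y)).symm
  have hτ : ∀ p, (rX ∘ BoxVariety.rhoQuot) (BoxVariety.diagPerm BoxVariety.tau p) =
      -(rX ∘ BoxVariety.rhoQuot) p := fun p => by
    rw [Function.comp_apply, BoxVariety.rhoQuot_tau, hneg]
    rfl
  have hA : ∀ k, BoxVariety.IsAbelianVariety k (BoxVariety.reindexSet eX
      (BoxVariety.prodVar BoxVariety.splitE BoxVariety.curveE)) := fun k => by
    have h := (BoxVariety.isAbelianVariety_splitE k).prodVar (BoxVariety.isAbelianVariety_curveE k)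
    exact h.transport rX (hX k) (hX ⊤) (hXclosed k) hadd fun i => h.zero_rational (eX i)
  obtain ⟨e, he⟩ := BoxVariety.exists_weierIso
  obtain ⟨κ, hκ⟩ := BoxVariety.exists_kummerMap (hq BoxVariety.fieldQ)
  refine ⟨⟨BoxVariety.weierE_isElliptic, e, he _⟩, BoxVariety.isKleinFour_groupH,
    BoxVariety.forgetZ3_isQuotientBy _, 1, _, _, _,
    (BoxVariety.kumMap_isQuotientBy _).comp_iso (hY _)
      (BoxVariety.reindexSet_closed eY (BoxVariety.boxQuot_closed _)),
    (BoxVariety.reindex eY BoxVariety.boxQuot).symm, (hY _).symm, 3, _, _, _, hq _, inferInstance, κ,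
    ?_, hτ, fun p => ?_, hA _, BoxVariety.kummerMap_isQuotientBy (hq _) hτ (hA _).neg_regular hκ⟩
  · exact congrArg rX BoxVariety.rhoQuot_basePt
  · rw [hκ]
    exact ((BoxVariety.reindex eY BoxVariety.boxQuot).symm_apply_apply _).symm
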